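/- **Setting.** Let $\Sigma_{n+1}$ be the set of reduced words ${\bf i}=(i_1,\dots,i_N)$, $N=n(n+1)/2$, of the longest element $w_0=s_{i_1}\cdots s_{i_N}$ of the symmetric group $\mathfrak S_{n+1}$, where $s_a=(a,a+1)$. *String cone.* The wiring diagram $G({\bf i})$ has wires $\ell_1,\dots,\ell_{n+1}$, which start at the top in this order from left to right; for $j=1,\dots,N$ (from top to bottom) the node $t_j$ is a crossing of the wires in positions $i_j$ and $i_j+1$. The lower end of $\ell_k$ is $L_k$. For $k\in[n]$, let $G({\bf i},k)$ be $G({\bf i})$ with $\ell_1,\dots,\ell_k$ oriented upward and $\ell_{k+1},\dots,\ell_{n+1}$ oriented downward. A *rigorous path* is an oriented path in $G({\bf i},k)$, for some $k\in[n]$, from $L_k$ to $L_{k+1}$ which passes through each node at most once and never continues along a wire $\ell_r$ straight through its crossing with a wire $\ell_q$ where either both wires are oriented downward and $r>q$, or both are oriented upward and $r<q$. Its *string inequality* is $\sum_j a_jt_j\ge 0$, where $a_j=1$ (resp. $a_j=-1$) if the path changes at $t_j$ from some $\ell_r$ to some $\ell_s$ with $r<s$ (resp. $r>s$), and $a_j=0$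 otherwise. The string cone $C_{\bf i}\subset\mathbb R^N$ is the set of solutions of all string inequalities (Gleizer–Postnikov description), and $\lVert{\bf i}\rVert$ denotes its number of facets. *Indices and contractions.* A 2-move exchanges two adjacent letters $a,b$ of a word with $|a-b|>1$. Put $A_n=(1,2,\dots,n)$ and $D_n=(n,\dots,2,1)$. For $\bullet\in\{A,D\}$, every ${\bf i}\in\Sigma_{n+1}$ can be turned by 2-moves into a word ${\bf i}_\bullet^-\,\bullet_n\,{\bf i}_\bullet^+$; choose such a word that is reached with as few 2-moves as possible. Put $\mathrm{ind}_\bullet({\bf i})=|{\bf i}_\bullet^+|$ (the length), and define the contractions $C_A({\bf i})=({\bf i}_A^- -1)\,{\bf i}_A^+$ and $C_D({\bf i})={\bf i}_D^-\,({\bf i}_D^+-1)$ in $\Sigma_n$, where $-1$ is subtracted from every letter. **Proposition.** For every ${\bf i}\in\Sigma_{n+1}$ and every $\bullet\in\{A,D\}$, $$\lVert{\bf i}\rVert\ \ge\ \lVert C_\bullet({\bf i})\rVert+n .$$ Moreover, if $\mathrm{ind}_A({\bf i})\cdot\mathrm{ind}_D({\bf i})>0$, then this inequality is strict for at least one $\bullet\in\{A,D\}$.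 -/

import Mathlib

/-- The word `i` is a reduced word of the longest element `w₀` of the symmetric group on
`{1, …, m}`: its letters lie in `{1, …, m - 1}`, it has `m (m - 1) / 2` letters, and
`s_{i₁} s_{i₂} ⋯ = w₀`, where `s_a = (a, a + 1)` and `w₀ p = m + 1 - p` for `1 ≤ p ≤ m`.
(Permutations of `{1, …, m}` are viewed as permutations of `ℕ`.) -/
def IsLongestReducedWord (m : ℕ) (i : List ℕ) : Prop :=
  (∀ a ∈ i, 1 ≤ a ∧ a < m) ∧
  i.length = m * (m - 1) / 2 ∧
  ∀ p, 1 ≤ p → p ≤ m → (i.map fun a => Equiv.swap a (a + 1)).prod p = m + 1 - p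

/-- The set `Σ_m` of reduced words of the longest element of the symmetric group on `m` letters. -/
def ReducedWords (m : ℕ) : Set (List ℕ) := {i | IsLongestReducedWord m i}

namespace Wiring

/-- The arrangement of the wires below the first `j` nodes (counted from the top) of the wiring
diagram `G(i)`: the index of the wire at horizontal position `p` (counted from the left). At the
top of the diagram, wire `p` is at position `p`; a node in column `a` exchanges positions `a` and
`a + 1`. -/
def arrangement (i : List ℕ) (j : ℕ) : Equiv.Perm ℕ :=
  ((i.take j).map fun a => Equiv.swap a (a + 1)).prod

/-- The node `t` of `G(i)` lies on the wire `ℓ_r`. The nodes are indexed from the top to the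
bottom by the letters of `i`. -/
def OnWire (i : List ℕ) (t : Fin i.length) (r : ℕ) : Prop :=
  r = arrangement i t i[t] ∨ r = arrangement i t (i[t] + 1)

/-- The node `t` is the lowest node on the wire `ℓ_r`, the one adjacent to the lower end `L_r`. -/
def IsLowest (i : List ℕ) (r : ℕ) (t : Fin i.length) : Prop :=
  OnWire i t r ∧ ∀ t', OnWire i t' r → t' ≤ t

/-- In `G(i, k)` (the wires `ℓ_1, …, ℓ_k` are oriented upward, the other ones downward), `t'` is
the node that follows `t` on the wire `ℓ_r`. -/
def Follows (i : List ℕ) (k r : ℕ) (t t' : Fin i.length) : Prop :=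
  OnWire i t r ∧ OnWire i t' r ∧
    if r ≤ k then t' < t ∧ ∀ t'', OnWire i t'' r → ¬ (t' < t'' ∧ t'' < t)
    else t < t' ∧ ∀ t'', OnWire i t'' r → ¬ (t < t'' ∧ t'' < t')

/-- The passage of a path through the node `node`: it arrives along the wire `inWire` and leaves
along the wire `outWire` (the two are equal if the path does not change wires at this node). -/
structure Passage (i : List ℕ) where
  node : Fin i.length
  inWire : ℕ
  outWire : ℕ

/-- Forbidden fragments of `G(i, k)`: the path stays on the wire `ℓ_r` at its node with the wire
`ℓ_q`, where either both wires are oriented downward and `r > q`, or both are oriented upward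
and `r < q`. -/
def Passage.IsForbidden {i : List ℕ} (k : ℕ) (s : Passage i) : Prop :=
  s.inWire = s.outWire ∧ ∃ q, OnWire i s.node q ∧
    ((k < s.inWire ∧ k < q ∧ q < s.inWire) ∨ (s.inWire ≤ k ∧ q ≤ k ∧ s.inWire < q))

/-- `P` is a rigorous path (Gleizer–Postnikov path) in `G(i, k)`, given by all the nodes which it
passes through, in order, each with the wires along which it arrives and leaves: it starts at
`L_k` and ends at `L_{k+1}`, respects the orientation of `G(i, k)`, passes through each node at
most once, and has no forbidden fragment. -/
structure IsRigorousPath (i : List ℕ) (k : ℕ) (P : List (Passage i)) : Prop where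
  start : ∃ s, P.head? = some s ∧ s.inWire = k ∧ IsLowest i k s.node
  finish : ∃ s, P.getLast? = some s ∧ s.outWire = k + 1 ∧ IsLowest i (k + 1) s.node
  onWires : ∀ s ∈ P, OnWire i s.node s.inWire ∧ OnWire i s.node s.outWire
  oriented : P.IsChain fun s s' =>
    s.outWire = s'.inWire ∧ Follows i k s.outWire s.node s'.node
  nodup : (P.map Passage.node).Nodup
  noForbidden : ∀ s ∈ P, ¬ s.IsForbidden k

/-- The left-hand side `∑ a_j t_j` of the string inequality of the path `P`: the coefficient of a
node is `1` (resp. `-1`) if the path travels there from `ℓ_r` to `ℓ_s` with `r < s`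
(resp. `r > s`). -/
def stringForm {i : List ℕ} (P : List (Passage i)) (x : Fin i.length → ℝ) : ℝ :=
  (P.map fun s =>
    if s.inWire < s.outWire then x s.node
    else if s.outWire < s.inWire then - x s.node
    else 0).sum

end Wiring

/-- The string cone `C_i` of a reduced word `i ∈ Σ_m`, in its description by Gleizer and
Postnikov: the solution set in `ℝ^N`, `N = i.length`, of the string inequalities of all rigorous
paths in `G(i, 1), …, G(i, m - 1)`. -/
def stringCone (m : ℕ) (i : List ℕ) : Set (Fin i.length → ℝ) :=
  {x | ∀ k, 1 ≤ k → k < m → ∀ P, Wiring.IsRigorousPath i k P → 0 ≤ Wiring.stringForm P x}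

/-- The dimension of (the affine span of) a set. -/
noncomputable def affineDim {N : ℕ} (S : Set (Fin N → ℝ)) : ℕ :=
  Module.finrank ℝ (affineSpan ℝ S).direction

/-- `F` is a facet of the polyhedron `C`: a nonempty face (the set of maximizers over `C` of a
linear functional) of dimension `dim C - 1`. -/
def IsFacet {N : ℕ} (C F : Set (Fin N → ℝ)) : Prop :=
  F.Nonempty ∧ IsExposed ℝ C F ∧ affineDim F + 1 = affineDim C

/-- `‖i‖`: the number of facets of the string cone of `i ∈ Σ_m`. -/
noncomputable def numFacets (m : ℕ) (i : List ℕ) : ℕ :=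
  {F | IsFacet (stringCone m i) F}.ncard

/-- A 2-move: exchanging two adjacent letters `a`, `b` with `|a - b| > 1`. -/
def TwoMove (w w' : List ℕ) : Prop :=
  ∃ (l r : List ℕ) (a b : ℕ), (a + 1 < b ∨ b + 1 < a) ∧
    w = l ++ [a, b] ++ r ∧ w' = l ++ [b, a] ++ r

/-- `TwoMoves c w w'`: the word `w'` is obtained from `w` by a sequence of `c` 2-moves. -/
inductive TwoMoves : ℕ → List ℕ → List ℕ → Prop
  | refl (w : List ℕ) : TwoMoves 0 w w
  | step {c : ℕ} {w w' w'' : List ℕ} : TwoMove w w' → TwoMoves c w' w'' → TwoMoves (c + 1) w w''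

/-- The two types `A` (ascending) and `D` (descending). -/
inductive AD
  | A
  | D

namespace AD

/-- `A_n = (1, 2, …, n)` and `D_n = (n, …, 2, 1)`. -/
def block (n : ℕ) : AD → List ℕ
  | A => List.range' 1 n
  | D => (List.range' 1 n).reverse

/-- `d = (i⁻, i⁺)`, where the word `i⁻ A_n i⁺` (resp. `i⁻ D_n i⁺`) is obtained from `i` by the
least possible number of 2-moves. -/
def IsLeastSplitting (b : AD) (n : ℕ) (i : List ℕ) (d : List ℕ × List ℕ) : Prop :=
  ∃ c, TwoMoves c i (d.1 ++ b.block n ++ d.2) ∧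
    ∀ c' u v, TwoMoves c' i (u ++ b.block n ++ v) → c ≤ c'

/-- A pair `(i⁻, i⁺)` as in `IsLeastSplitting`. -/
noncomputable def splitting (b : AD) (n : ℕ) (i : List ℕ) : List ℕ × List ℕ :=
  Classical.epsilon (b.IsLeastSplitting n i)

/-- `ind_A(i)` and `ind_D(i)` for `i ∈ Σ_{n+1}`: the length of `i⁺`. -/
noncomputable def ind (b : AD) (n : ℕ) (i : List ℕ) : ℕ :=
  (b.splitting n i).2.length

/-- The contraction of `i ∈ Σ_{n+1}`: `C_A(i) = (i⁻ - 1) i⁺` and `C_D(i) = i⁻ (i⁺ - 1)`. -/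
noncomputable def contraction (b : AD) (n : ℕ) (i : List ℕ) : List ℕ :=
  match b with
  | A => (A.splitting n i).1.map (· - 1) ++ (A.splitting n i).2
  | D => (D.splitting n i).1 ++ (D.splitting n i).2.map (· - 1)

end AD

section Polyhedra

variable {E : Type*} [AddCommGroup E] [Module ℝ E]

theorem le_direction_affineSpan {S : Set E} {W : Submodule ℝ E} {y : E} (hy : y ∈ S)
    (h : ∀ v ∈ W, ∃ ε : ℝ, 0 < ε ∧ y + ε • v ∈ S) : W ≤ (affineSpan ℝ S).direction := by
  intro v hv
  obtain ⟨ε, hε, hm⟩ := h v hv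
  have h1 : (y + ε • v) -ᵥ y ∈ (affineSpan ℝ S).direction :=
    AffineSubspace.vsub_mem_direction (subset_affineSpan ℝ S hm) (subset_affineSpan ℝ S hy)
  have h2 := Submodule.smul_mem _ ε⁻¹ h1
  simpa [smul_smul, hε.ne'] using h2

theorem direction_affineSpan_le_ker {S : Set E} {l : E →ₗ[ℝ] ℝ} {M : ℝ}
    (h : ∀ x ∈ S, l x = M) : (affineSpan ℝ S).direction ≤ LinearMap.ker l := by
  rw [direction_affineSpan, vectorSpan_def, Submodule.span_le]
  rintro _ ⟨a, ha, b, hb, rfl⟩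
  simp [h a ha, h b hb]

theorem exists_pos_forall_pos_add_mul {ι : Type*} [Finite ι] (α β : ι → ℝ) (h : ∀ a, 0 < α a) :
    ∃ ε : ℝ, 0 < ε ∧ ∀ a, 0 < α a + ε * β a := by
  have h1 : ∀ᶠ ε : ℝ in nhdsWithin 0 (Set.Ioi 0), ∀ a, 0 < α a + ε * β a := by
    rw [Filter.eventually_all]
    intro a
    have hc : Filter.Tendsto (fun ε : ℝ => α a + ε * β a) (nhds 0) (nhds (α a + 0 * β a)) :=
      (by fun_prop : Continuous fun ε : ℝ => α a + ε * β a).tendsto 0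
    simp only [zero_mul, add_zero] at hc
    exact (hc.mono_left nhdsWithin_le_nhds).eventually (lt_mem_nhds (h a))
  obtain ⟨ε, h2, h3⟩ := (h1.and self_mem_nhdsWithin).exists
  exact ⟨ε, h3, h2⟩

end Polyhedra

section Facets

variable {N : ℕ} {ι : Type*} [Finite ι] (f : ι → (Fin N → ℝ) →ₗ[ℝ] ℝ)

/-- The polyhedral cone defined by a family of linear inequalities. -/
def formCone : Set (Fin N → ℝ) := {x | ∀ a, 0 ≤ f a x}

/-- The face of the cone on which one of the inequalities is an equality. -/
def formFace (a : ι) : Set (Fin N → ℝ) := {x | x ∈ formCone f ∧ f a x = 0}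

theorem affineDim_formCone {x₀ : Fin N → ℝ} (h₀ : ∀ a, 0 < f a x₀) :
    affineDim (formCone f) = N := by
  have h : (⊤ : Submodule ℝ (Fin N → ℝ)) ≤ (affineSpan ℝ (formCone f)).direction := by
    refine le_direction_affineSpan (y := x₀) (fun a => (h₀ a).le) fun v _ => ?_
    obtain ⟨ε, hε, h⟩ := exists_pos_forall_pos_add_mul (fun a => f a x₀) (fun a => f a v) h₀
    exact ⟨ε, hε, fun a => by simpa using (h a).le⟩
  rw [affineDim, top_le_iff.mp h]
  simp

theorem affineDim_formFace {x₀ : Fin N → ℝ} (h₀ : ∀ a, 0 < f a x₀) {a : ι} {y : Fin N → ℝ}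
    (hy : f a y = 0) (hy' : ∀ b, b ≠ a → 0 < f b y) : affineDim (formFace f a) + 1 = N := by
  have hyC : y ∈ formCone f := fun b => by
    by_cases hb : b = a
    · rw [hb, hy]
    · exact (hy' b hb).le
  have h : (affineSpan ℝ (formFace f a)).direction = LinearMap.ker (f a) := by
    apply le_antisymm
    · exact direction_affineSpan_le_ker (M := 0) fun x hx => hx.2
    · refine le_direction_affineSpan (y := y) ⟨hyC, hy⟩ fun v hv => ?_
      obtain ⟨ε, hε, h⟩ := exists_pos_forall_pos_add_mul
        (fun b : {b // b ≠ a} => f b y) (fun b => f b v) fun b => hy' b b.2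
      have hv' : f a v = 0 := hv
      refine ⟨ε, hε, fun b => ?_, by simp [hy, hv']⟩
      by_cases hb : b = a
      · simp [hb, hy, hv']
      · simpa using (h ⟨b, hb⟩).le
  have hr : Module.finrank ℝ (LinearMap.range (f a)) = 1 := by
    rw [LinearMap.range_eq_top.mpr]
    · simp
    · apply LinearMap.surjective_of_ne_zero
      intro h
      have := h₀ a
      simp [h] at this
  have hk := (f a).finrank_range_add_finrank_ker
  rw [affineDim, h]
  simp at hk
  omega

theorem isFacet_formFace {x₀ : Fin N → ℝ} (h₀ : ∀ a, 0 < f a x₀) {a : ι} {y : Fin N → ℝ}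
    (hy : f a y = 0) (hy' : ∀ b, b ≠ a → 0 < f b y) : IsFacet (formCone f) (formFace f a) := by
  have hyC : y ∈ formCone f := fun b => by
    by_cases hb : b = a
    · rw [hb, hy]
    · exact (hy' b hb).le
  refine ⟨⟨y, hyC, hy⟩, fun _ => ⟨-(f a).toContinuousLinearMap, ?_⟩, ?_⟩
  · ext x
    constructor
    · rintro ⟨hx, hx0⟩
      exact ⟨hx, fun z hz => by simpa [hx0] using hz a⟩
    · rintro ⟨hx, h⟩
      refine ⟨hx, le_antisymm ?_ (hx a)⟩
      simpa [hy] using h y hyC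
  · rw [affineDim_formFace f h₀ hy hy', affineDim_formCone f h₀]

theorem exists_eq_formFace {x₀ : Fin N → ℝ} (h₀ : ∀ a, 0 < f a x₀) {y : ι → Fin N → ℝ}
    (hy : ∀ a, f a (y a) = 0) (hy' : ∀ a b, b ≠ a → 0 < f b (y a)) {F : Set (Fin N → ℝ)}
    (hF : IsFacet (formCone f) F) : ∃ a, formFace f a = F := by
  obtain ⟨hne, hexp, hdim⟩ := hF
  obtain ⟨l, hl⟩ := hexp hne
  obtain ⟨p, hp⟩ := hne
  have hadd : ∀ x z, x ∈ formCone f → z ∈ formCone f → x + z ∈ formCone f :=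
    fun x z hx hz a => by simpa using add_nonneg (hx a) (hz a)
  have h0C : (0 : Fin N → ℝ) ∈ formCone f := fun a => by simp
  have hzero : ∀ x ∈ F, l x = 0 := by
    intro x hx
    rw [hl] at hx
    have h1 := hx.2 0 h0C
    have h2 := hx.2 (x + x) (hadd x x hx.1 hx.1)
    simp at h1 h2
    linarith
  have hmem : ∀ x, x ∈ F ↔ x ∈ formCone f ∧ l x = 0 := by
    intro x
    refine ⟨fun hx => ⟨?_, hzero x hx⟩, fun hx => ?_⟩
    · rw [hl] at hx
      exact hx.1
    · have hp0 := hzero p hp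
      rw [hl] at hp ⊢
      exact ⟨hx.1, fun z hz => by rw [hx.2, ← hp0]; exact hp.2 z hz⟩
  have hmax : ∀ z ∈ formCone f, l z ≤ 0 := by
    intro z hz
    have hp0 := hzero p hp
    rw [hl] at hp
    rw [← hp0]
    exact hp.2 z hz
  have hex : ∃ a, ∀ x ∈ F, f a x = 0 := by
    by_contra! hcon
    choose x hxF hx using hcon
    have := Fintype.ofFinite ι
    set z := p + ∑ a, x a with hz
    have hpos : ∀ b, 0 < f b z := by
      intro b
      have h1 : f b (x b) ≤ ∑ a, f b (x a) :=
        Finset.single_le_sum (f := fun a => f b (x a))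
          (fun a _ => ((hmem _).mp (hxF a)).1 b) (Finset.mem_univ b)
      have h2 := ((hmem _).mp (hxF b)).1 b
      have h3 := ((hmem _).mp hp).1 b
      have h4 := lt_of_le_of_ne h2 (Ne.symm (hx b))
      rw [hz, map_add, map_sum]
      linarith
    have hlz : l z = 0 := by
      rw [hz, map_add, map_sum, hzero p hp, Finset.sum_eq_zero fun a _ => hzero _ (hxF a), add_zero]
    have hle : ∀ v, l v ≤ 0 := by
      intro v
      obtain ⟨ε, hε, h⟩ := exists_pos_forall_pos_add_mul (fun a => f a z) (fun a => f a v) hpos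
      have := hmax (z + ε • v) (fun a => by simpa using (h a).le)
      simp [hlz] at this
      nlinarith
    have hl0 : ∀ v, l v = 0 := fun v => le_antisymm (hle v) (by have := hle (-v); simp at this; exact this)
    have : F = formCone f := by
      ext x
      rw [hmem]
      simp [hl0]
    rw [this] at hdim
    omega
  obtain ⟨a, ha⟩ := hex
  refine ⟨a, ?_⟩
  have hsub : F ⊆ formFace f a := fun x hx => ⟨((hmem x).mp hx).1, ha x hx⟩
  have hdir : (affineSpan ℝ F).direction = (affineSpan ℝ (formFace f a)).direction := by
    apply Submodule.eq_of_le_of_finrank_eq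
    · exact AffineSubspace.direction_le (affineSpan_mono ℝ hsub)
    · have h1 := affineDim_formFace f h₀ (hy a) (hy' a)
      rw [affineDim_formCone f h₀] at hdim
      unfold affineDim at h1 hdim
      omega
  apply Set.Subset.antisymm _ hsub
  intro x hx
  rw [hmem]
  refine ⟨hx.1, ?_⟩
  have h1 : x -ᵥ p ∈ (affineSpan ℝ F).direction := by
    rw [hdir]
    exact AffineSubspace.vsub_mem_direction (subset_affineSpan ℝ _ hx)
      (subset_affineSpan ℝ _ (hsub hp))
  have h2 := direction_affineSpan_le_ker (l := (l : (Fin N → ℝ) →ₗ[ℝ] ℝ)) (M := 0) hzero h1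
  have h3 := hzero p hp
  simp at h2
  linarith

/-- If none of the inequalities of a cone is implied by the other ones, then its facets are in
bijection with its inequalities. -/
theorem ncard_facets_formCone {x₀ : Fin N → ℝ} (h₀ : ∀ a, 0 < f a x₀) {y : ι → Fin N → ℝ}
    (hy : ∀ a, f a (y a) = 0) (hy' : ∀ a b, b ≠ a → 0 < f b (y a)) :
    {F | IsFacet (formCone f) F}.ncard = Nat.card ι := by
  have h : {F | IsFacet (formCone f) F} = Set.range (formFace f) := by
    ext F
    constructor
    · exact fun hF => exists_eq_formFace f h₀ hy hy' hF
    · rintro ⟨a, rfl⟩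
      exact isFacet_formFace f h₀ (hy a) (hy' a)
  have hinj : Function.Injective (formFace f) := by
    intro a b hab
    by_contra hne
    have h1 : y a ∈ formFace f a := ⟨fun c => by
      by_cases hc : c = a
      · rw [hc, hy]
      · exact (hy' a c hc).le, hy a⟩
    rw [hab] at h1
    exact (hy' a b (Ne.symm hne)).ne' h1.2
  rw [h, ← Set.image_univ, Set.ncard_image_of_injective _ hinj, Set.ncard_univ]

end Facets

namespace Wiring

section Forms

variable {i : List ℕ}

theorem onWire_ne (i : List ℕ) (t : Fin i.length) :
    arrangement i t i[t] ≠ arrangement i t (i[t] + 1) := fun h => by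
  have := (arrangement i t).injective h
  omega

/-- The coefficient of the node of a passage in the string form. -/
def Passage.coeff (s : Passage i) : ℝ :=
  if s.inWire < s.outWire then 1 else if s.outWire < s.inWire then -1 else 0

theorem Passage.abs_coeff_le (s : Passage i) : |s.coeff| ≤ 1 := by
  unfold Passage.coeff
  split_ifs <;> simp

/-- The string form as a linear map. -/
def pathForm (P : List (Passage i)) : (Fin i.length → ℝ) →ₗ[ℝ] ℝ :=
  (P.map fun s => s.coeff • LinearMap.proj (R := ℝ) (φ := fun _ => ℝ) s.node).sum

theorem pathForm_nil (x : Fin i.length → ℝ) : pathForm [] x = 0 := rfl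

theorem pathForm_cons (s : Passage i) (P : List (Passage i)) (x : Fin i.length → ℝ) :
    pathForm (s :: P) x = s.coeff * x s.node + pathForm P x := by
  simp [pathForm]

theorem stringForm_eq_pathForm (P : List (Passage i)) (x : Fin i.length → ℝ) :
    stringForm P x = pathForm P x := by
  induction P with
  | nil => simp [stringForm, pathForm]
  | cons s P ih =>
    rw [pathForm_cons, ← ih]
    simp only [stringForm, List.map_cons, List.sum_cons, Passage.coeff]
    congr 1
    split_ifs <;> simp

/-- The point whose coordinate at a node is the difference of a height function at the two wires
of the node. -/
def heightPoint (i : List ℕ) (h : ℕ → ℝ) : Fin i.length → ℝ := fun t =>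
  |h (arrangement i t i[t]) - h (arrangement i t (i[t] + 1))|

theorem coeff_mul_heightPoint {h : ℕ → ℝ} (hh : Monotone h) {s : Passage i}
    (h1 : OnWire i s.node s.inWire) (h2 : OnWire i s.node s.outWire) :
    s.coeff * heightPoint i h s.node = h s.outWire - h s.inWire := by
  have key : s.inWire ≠ s.outWire →
      heightPoint i h s.node = |h s.outWire - h s.inWire| := by
    intro hne
    unfold heightPoint
    rcases h1 with h1 | h1 <;> rcases h2 with h2 | h2
    · exact absurd (h1.trans h2.symm) hne
    · rw [← h1, ← h2, abs_sub_comm]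
    · rw [← h1, ← h2]
    · exact absurd (h1.trans h2.symm) hne
  unfold Passage.coeff
  split_ifs with h3 h4
  · rw [key h3.ne, one_mul, abs_of_nonneg (sub_nonneg.mpr (hh h3.le))]
  · rw [key h4.ne', abs_of_nonpos (sub_nonpos.mpr (hh h4.le))]
    ring
  · rw [show s.inWire = s.outWire by omega]
    simp

theorem pathForm_heightPoint {h : ℕ → ℝ} (hh : Monotone h) {b : ℕ} :
    ∀ {P : List (Passage i)} {s : Passage i},
    (∀ u ∈ s :: P, OnWire i u.node u.inWire ∧ OnWire i u.node u.outWire) →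
    (s :: P).IsChain (fun u u' => u.outWire = u'.inWire) →
    (∃ u, (s :: P).getLast? = some u ∧ u.outWire = b) →
    pathForm (s :: P) (heightPoint i h) = h b - h s.inWire := by
  intro P
  induction P with
  | nil =>
    intro s hw _ hl
    obtain ⟨u, hu, hb⟩ := hl
    simp at hu
    subst hu
    rw [pathForm_cons, pathForm_nil, add_zero,
      coeff_mul_heightPoint hh (hw s (by simp)).1 (hw s (by simp)).2, hb]
  | cons s' P ih =>
    intro s hw hc hl
    rw [pathForm_cons, coeff_mul_heightPoint hh (hw s (by simp)).1 (hw s (by simp)).2,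
      ih (fun u hu => hw u (List.mem_cons_of_mem _ hu)) (List.isChain_cons_cons.mp hc).2
        (by simpa using hl), (List.isChain_cons_cons.mp hc).1]
    ring

theorem IsRigorousPath.pathForm_heightPoint {k : ℕ} {P : List (Passage i)}
    (hP : IsRigorousPath i k P) {h : ℕ → ℝ} (hh : Monotone h) :
    pathForm P (heightPoint i h) = h (k + 1) - h k := by
  obtain ⟨s, hs, hk, -⟩ := hP.start
  cases P with
  | nil => simp at hs
  | cons s' P =>
    simp at hs
    subst hs
    obtain ⟨u, hu, hb, -⟩ := hP.finish
    rw [Wiring.pathForm_heightPoint hh hP.onWires (hP.oriented.imp fun _ _ h => h.1) ⟨u, hu, hb⟩, hk]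

theorem follows_unique {k r : ℕ} {t t₁ t₂ : Fin i.length} (h₁ : Follows i k r t t₁)
    (h₂ : Follows i k r t t₂) : t₁ = t₂ := by
  obtain ⟨-, w₁, h₁⟩ := h₁
  obtain ⟨-, w₂, h₂⟩ := h₂
  split_ifs at h₁ h₂
  · have a := h₁.2 _ w₂
    have b := h₂.2 _ w₁
    have c := h₁.1
    have d := h₂.1
    grind
  · have a := h₁.2 _ w₂
    have b := h₂.2 _ w₁
    have c := h₁.1
    have d := h₂.1
    grind

/-- The condition that a nonempty list of passages ends at the lower end `L_{k+1}`. -/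
def EndsAt (k : ℕ) (P : List (Passage i)) : Prop :=
  ∃ s, P.getLast? = some s ∧ s.outWire = k + 1 ∧ IsLowest i (k + 1) s.node

theorem not_follows_of_isLowest {k : ℕ} {t t' : Fin i.length} (h : IsLowest i (k + 1) t)
    (h' : Follows i k (k + 1) t t') : False := by
  obtain ⟨-, w, h'⟩ := h'
  rw [if_neg (by omega)] at h'
  exact absurd (h.2 _ w) (not_le.mpr h'.1)

/-- Two different paths with the same beginning separate at a node. -/
theorem exists_divergence {k : ℕ} : ∀ {P Q : List (Passage i)} {p q : Passage i},
    p.node = q.node → p.inWire = q.inWire →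
    (p :: P).IsChain (fun s s' => s.outWire = s'.inWire ∧ Follows i k s.outWire s.node s'.node) →
    (q :: Q).IsChain (fun s s' => s.outWire = s'.inWire ∧ Follows i k s.outWire s.node s'.node) →
    EndsAt k (p :: P) → EndsAt k (q :: Q) → p :: P ≠ q :: Q →
    ∃ C a P' b Q', p :: P = C ++ a :: P' ∧ q :: Q = C ++ b :: Q' ∧ a.node = b.node ∧
      a.inWire = b.inWire ∧ a.outWire ≠ b.outWire := by
  intro P
  induction P with
  | nil =>
    intro Q p q hn hw cP cQ eP eQ hne
    by_cases ho : p.outWire = q.outWire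
    · have hpq : p = q := by cases p; cases q; simp_all
      subst hpq
      cases Q with
      | nil => simp at hne
      | cons q' Q =>
        obtain ⟨s, hs, h1, h2⟩ := eP
        simp at hs
        subst hs
        rw [List.isChain_cons_cons, h1] at cQ
        exact (not_follows_of_isLowest h2 cQ.1.2).elim
    · exact ⟨[], p, [], q, Q, rfl, rfl, hn, hw, ho⟩
  | cons p' P ih =>
    intro Q p q hn hw cP cQ eP eQ hne
    by_cases ho : p.outWire = q.outWire
    · have hpq : p = q := by cases p; cases q; simp_all
      subst hpq
      cases Q with
      | nil =>
        obtain ⟨s, hs, h1, h2⟩ := eQ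
        simp at hs
        subst hs
        rw [List.isChain_cons_cons, h1] at cP
        exact (not_follows_of_isLowest h2 cP.1.2).elim
      | cons q' Q =>
        rw [List.isChain_cons_cons] at cP cQ
        obtain ⟨C, a, P', b, Q', h1, h2, h3⟩ := ih (follows_unique cP.1.2 cQ.1.2)
          (cP.1.1.symm.trans cQ.1.1) cP.2 cQ.2 (by simpa [EndsAt] using eP)
          (by simpa [EndsAt] using eQ) (fun h => hne (by rw [h]))
        exact ⟨p :: C, a, P', b, Q', by simp [h1], by simp [h2], h3⟩
    · exact ⟨[], p, p' :: P, q, Q, rfl, rfl, hn, hw, ho⟩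

theorem abs_pathForm_le {P : List (Passage i)} (hP : (P.map Passage.node).Nodup)
    (x : Fin i.length → ℝ) : |pathForm P x| ≤ ∑ t, |x t| := by
  have h : ∀ P : List (Passage i), |pathForm P x| ≤ ((P.map Passage.node).map fun t => |x t|).sum := by
    intro P
    induction P with
    | nil => simp [pathForm_nil]
    | cons s P ih =>
      rw [pathForm_cons]
      refine (abs_add_le _ _).trans ?_
      simp only [List.map_cons, List.sum_cons]
      refine add_le_add ?_ ih
      rw [abs_mul]
      exact mul_le_of_le_one_left (abs_nonneg _) s.abs_coeff_le
  refine (h P).trans ?_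
  rw [← List.sum_toFinset _ hP]
  exact Finset.sum_le_univ_sum_of_nonneg fun t => abs_nonneg _

theorem exists_divergence_sign {s : Passage i} (h : OnWire i s.node s.inWire ∧ OnWire i s.node s.outWire) :
    ∃ e : ℝ, |e| ≤ 1 ∧ ∀ q : Passage i, OnWire i q.node q.outWire → s.node = q.node →
      s.inWire = q.inWire → s.outWire ≠ q.outWire → (q.coeff - s.coeff) * e = 1 := by
  by_cases hio : s.inWire = s.outWire
  · obtain ⟨o, ho⟩ : ∃ o, ∀ q : Passage i, OnWire i q.node q.outWire → s.node = q.node →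
        s.outWire ≠ q.outWire → q.outWire = o := by
      rcases h.2 with h2 | h2
      · refine ⟨arrangement i s.node (i[s.node] + 1), fun q hq hn hne => ?_⟩
        rw [← hn] at hq
        rcases hq with hq | hq
        · exact absurd (h2.trans hq.symm) hne
        · exact hq
      · refine ⟨arrangement i s.node i[s.node], fun q hq hn hne => ?_⟩
        rw [← hn] at hq
        rcases hq with hq | hq
        · exact hq
        · exact absurd (h2.trans hq.symm) hne
    refine ⟨if s.inWire < o then 1 else -1, by split_ifs <;> simp, fun q hq hn hi hne => ?_⟩
    have := ho q hq hn hne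
    unfold Passage.coeff
    rw [← hi, this, ← hio]
    split_ifs
    all_goals first | omega | simp
  · refine ⟨-s.coeff, by simpa using s.abs_coeff_le, fun q hq hn hi hne => ?_⟩
    have hq0 : q.coeff = 0 := by
      have : q.inWire = q.outWire := by
        rw [← hi]
        rw [← hn] at hq
        obtain ⟨h1, h2⟩ := h
        unfold OnWire at h1 h2 hq
        omega
      simp [Passage.coeff, this]
    rw [hq0]
    unfold Passage.coeff
    split_ifs
    all_goals first | omega | norm_num

/-- A point at which the form of a path is smaller than those of all the paths which separate
from it at some node. -/
theorem exists_separating_point : ∀ {P : List (Passage i)},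
    (∀ s ∈ P, OnWire i s.node s.inWire ∧ OnWire i s.node s.outWire) →
    (P.map Passage.node).Nodup →
    ∃ y : Fin i.length → ℝ, ∑ t, |y t| ≤ 4 / 3 ∧
      ∀ C a P' b Q', P = C ++ a :: P' → ((C ++ b :: Q').map Passage.node).Nodup →
        OnWire i b.node b.outWire → a.node = b.node → a.inWire = b.inWire →
        a.outWire ≠ b.outWire → pathForm P y < pathForm (C ++ b :: Q') y := by
  intro P
  induction P with
  | nil =>
    intro _ _
    exact ⟨0, by norm_num, fun C a P' b Q' h => by simp at h⟩
  | cons s P ih =>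
    intro hw hn
    obtain ⟨y, hy1, hy2⟩ := ih (fun u hu => hw u (List.mem_cons_of_mem _ hu))
      (List.nodup_cons.mp hn).2
    obtain ⟨e, he, hdiv⟩ := exists_divergence_sign (hw s (by simp))
    set z : Fin i.length → ℝ := Function.update ((1 / 4 : ℝ) • y) s.node e with hz
    have hzs : z s.node = e := by simp [hz]
    have hcongr : ∀ Q : List (Passage i), s.node ∉ Q.map Passage.node →
        pathForm Q z = 1 / 4 * pathForm Q y := by
      intro Q hQ
      induction Q with
      | nil => simp [pathForm_nil]
      | cons q Q ihQ =>
        simp only [List.map_cons, List.mem_cons, not_or] at hQ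
        rw [pathForm_cons, pathForm_cons, ihQ hQ.2, hz, Function.update_of_ne (Ne.symm hQ.1)]
        simp only [Pi.smul_apply, smul_eq_mul]
        ring
    refine ⟨z, ?_, ?_⟩
    · have hb : ∀ t, |z t| ≤ (if t = s.node then 1 else 0) + 1 / 4 * |y t| := by
        intro t
        by_cases ht : t = s.node
        · rw [if_pos ht, ht, hzs]
          have := abs_nonneg (y s.node)
          linarith
        · rw [if_neg ht, hz, Function.update_of_ne ht, zero_add]
          simp [abs_mul]
      refine (Finset.sum_le_sum fun t _ => hb t).trans ?_
      rw [Finset.sum_add_distrib, ← Finset.mul_sum]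
      simp
      linarith
    · intro C a P' b Q' hP hnd hb h1 h2 h3
      cases C with
      | nil =>
        simp only [List.nil_append, List.cons.injEq] at hP
        obtain ⟨rfl, rfl⟩ := hP
        simp only [List.nil_append, List.map_cons, List.nodup_cons] at hnd hn ⊢
        rw [pathForm_cons, pathForm_cons, hcongr _ hn.1, hcongr _ (by rw [h1]; exact hnd.1), ← h1,
          hzs]
        have e1 := hdiv b hb h1 h2 h3
        have e2 := (abs_le.mp ((abs_pathForm_le hn.2 y).trans hy1)).2
        have e3 := (abs_le.mp ((abs_pathForm_le hnd.2 y).trans hy1)).1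
        linarith
      | cons c C =>
        simp only [List.cons_append, List.cons.injEq] at hP
        obtain ⟨rfl, hP⟩ := hP
        simp only [List.cons_append, List.map_cons, List.nodup_cons] at hnd hn ⊢
        rw [pathForm_cons, pathForm_cons, hcongr _ hn.1, hcongr _ hnd.1]
        have := hy2 C a P' b Q' hP hnd.2 hb h1 h2 h3
        linarith

theorem isLowest_unique {r : ℕ} {t t' : Fin i.length} (h : IsLowest i r t) (h' : IsLowest i r t') :
    t = t' :=
  le_antisymm (h'.2 _ h.1) (h.2 _ h'.1)

theorem IsRigorousPath.exists_divergence {k : ℕ} {P Q : List (Passage i)}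
    (hP : IsRigorousPath i k P) (hQ : IsRigorousPath i k Q) (hne : P ≠ Q) :
    ∃ C a P' b Q', P = C ++ a :: P' ∧ Q = C ++ b :: Q' ∧ a.node = b.node ∧
      a.inWire = b.inWire ∧ a.outWire ≠ b.outWire := by
  obtain ⟨p, hp, hp1, hp2⟩ := hP.start
  obtain ⟨q, hq, hq1, hq2⟩ := hQ.start
  cases P with
  | nil => simp at hp
  | cons p' P =>
    cases Q with
    | nil => simp at hq
    | cons q' Q =>
      simp at hp hq
      subst hp hq
      exact Wiring.exists_divergence (isLowest_unique hp2 hq2) (hp1.trans hq1.symm) hP.oriented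
        hQ.oriented hP.finish hQ.finish hne

end Forms

/-- The rigorous paths in `G(i, 1), …, G(i, m - 1)`. -/
def rigorousPaths (m : ℕ) (i : List ℕ) : Set (ℕ × List (Passage i)) :=
  {p | 1 ≤ p.1 ∧ p.1 < m ∧ IsRigorousPath i p.1 p.2}

theorem finite_rigorousPaths (m : ℕ) (i : List ℕ) : (rigorousPaths m i).Finite := by
  set α := {s : Passage i // OnWire i s.node s.inWire ∧ OnWire i s.node s.outWire}
  have hα : Finite α := by
    let g : α → Fin i.length × Bool × Bool := fun s =>
      (s.1.node, decide (s.1.inWire = arrangement i s.1.node i[s.1.node]),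
        decide (s.1.outWire = arrangement i s.1.node i[s.1.node]))
    refine Finite.of_injective g ?_
    rintro ⟨⟨t, a, b⟩, h1, h2⟩ ⟨⟨t', a', b'⟩, h1', h2'⟩ h
    simp only [g, Prod.mk.injEq] at h
    obtain ⟨rfl, h3, h4⟩ := h
    simp only [decide_eq_decide] at h3 h4
    have := onWire_ne i t
    simp only [OnWire] at h1 h2 h1' h2'
    have e1 : a = a' := by grind
    have e2 : b = b' := by grind
    subst e1 e2
    rfl
  have hfin := (Set.finite_Iio m).prod
    ((List.finite_length_le α i.length).image (List.map Subtype.val))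
  refine hfin.subset ?_
  rintro ⟨k, P⟩ ⟨-, h2, h3⟩
  refine ⟨h2, P.attachWith _ h3.onWires, ?_, by simp⟩
  have := h3.nodup.length_le_card
  simp only [List.length_map, Fintype.card_fin] at this
  rw [Set.mem_ofPred_eq]
  exact List.length_attachWith.trans_le this

theorem numFacets_eq_ncard_rigorousPaths (m : ℕ) (i : List ℕ) :
    numFacets m i = (rigorousPaths m i).ncard := by
  have hfin : Finite (rigorousPaths m i) := finite_rigorousPaths m i
  set f : rigorousPaths m i → (Fin i.length → ℝ) →ₗ[ℝ] ℝ := fun p => pathForm p.1.2 with hf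
  have hC : stringCone m i = formCone f := by
    ext x
    constructor
    · rintro h ⟨⟨k, P⟩, h1, h2, h3⟩
      have := h k h1 h2 P h3
      rwa [stringForm_eq_pathForm] at this
    · intro h k h1 h2 P h3
      rw [stringForm_eq_pathForm]
      exact h ⟨⟨k, P⟩, h1, h2, h3⟩
  have hx : ∀ p, f p (heightPoint i (fun n => n)) = 1 := by
    rintro ⟨⟨k, P⟩, h1, h2, h3⟩
    simp only [hf]
    rw [h3.pathForm_heightPoint Nat.mono_cast]
    push_cast
    ring
  have hy : ∀ p, ∃ y, f p y = 0 ∧ ∀ q, q ≠ p → 0 < f q y := by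
    rintro ⟨⟨k, P⟩, hk1, hk2, hP⟩
    obtain ⟨y, -, hy⟩ := exists_separating_point hP.onWires hP.nodup
    set h : ℕ → ℝ := fun n => if k < n then 1 else 0 with hh
    have hmono : Monotone h := by
      intro a b hab
      simp only [hh]
      split_ifs
      · exact le_rfl
      · omega
      · exact zero_le_one
      · exact le_rfl
    obtain ⟨M, hM⟩ := (Set.finite_range fun q => f ⟨⟨k, P⟩, hk1, hk2, hP⟩ y - f q y).bddAbove
    set y₂ := y - (M + 1) • heightPoint i h with hy₂
    have hlt : ∀ q, q ≠ (⟨⟨k, P⟩, hk1, hk2, hP⟩ : rigorousPaths m i) → pathForm P y₂ < f q y₂ := by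
      rintro ⟨⟨k', Q⟩, hk1', hk2', hQ⟩ hne
      have e1 : pathForm P y₂ = pathForm P y - (M + 1) := by
        rw [hy₂, map_sub, map_smul, hP.pathForm_heightPoint hmono]
        simp [hh]
      rw [e1]
      simp only [hf]
      rw [hy₂, map_sub, map_smul, hQ.pathForm_heightPoint hmono]
      by_cases hk : k' = k
      · subst hk
        have hPQ : P ≠ Q := fun h => hne (by subst h; rfl)
        obtain ⟨C, a, P', b, Q', h1, h2, h3, h4, h5⟩ := hP.exists_divergence hQ hPQ
        have := hy C a P' b Q' h1 (h2 ▸ hQ.nodup) (hQ.onWires b (by rw [h2]; simp)).2 h3 h4 h5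
        rw [← h2] at this
        simp [hh]
        linarith
      · have h1 : pathForm P y - pathForm Q y ≤ M := hM ⟨⟨⟨k', Q⟩, hk1', hk2', hQ⟩, rfl⟩
        have h2 : h (k' + 1) - h k' = 0 := by
          simp only [hh]
          split_ifs
          all_goals first | omega | simp
        rw [h2]
        simp
        linarith
    refine ⟨y₂ - pathForm P y₂ • heightPoint i (fun n => n), ?_, fun q hq => ?_⟩
    · rw [map_sub, map_smul, hx]
      simp [hf]
    · rw [map_sub, map_smul, hx]
      have := hlt q hq
      simp
      exact this
  choose y hy1 hy2 using hy
  rw [numFacets, hC, ncard_facets_formCone f (fun p => by rw [hx p]; exact one_pos) hy1 hy2]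
  rfl

end Wiring

namespace Wiring

/-- The column of the node `t`. -/
def col (i : List ℕ) (t : ℕ) : ℕ := i.getD t 0

/-- The passage of a path through a node, with nodes as natural numbers. -/
@[ext] structure Step where
  node : ℕ
  inW : ℕ
  outW : ℕ

/-- The node `t` exists and lies on the wire `r`. -/
def OnW (i : List ℕ) (t r : ℕ) : Prop :=
  t < i.length ∧ (r = arrangement i t (col i t) ∨ r = arrangement i t (col i t + 1))

/-- The node `t` is the lowest one on the wire `r`. -/
def Lowest (i : List ℕ) (r t : ℕ) : Prop :=
  OnW i t r ∧ ∀ t', OnW i t' r → t' ≤ t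

/-- The node `t'` follows `t` on the wire `r`. -/
def Next (i : List ℕ) (k r t t' : ℕ) : Prop :=
  OnW i t r ∧ OnW i t' r ∧
    if r ≤ k then t' < t ∧ ∀ t'', OnW i t'' r → ¬ (t' < t'' ∧ t'' < t)
    else t < t' ∧ ∀ t'', OnW i t'' r → ¬ (t < t'' ∧ t'' < t')

/-- Forbidden fragments. -/
def Step.Forb (i : List ℕ) (k : ℕ) (s : Step) : Prop :=
  s.inW = s.outW ∧ ∃ q, OnW i s.node q ∧
    ((k < s.inW ∧ k < q ∧ q < s.inW) ∨ (s.inW ≤ k ∧ q ≤ k ∧ s.inW < q))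

/-- Rigorous paths, with nodes as natural numbers. -/
structure NPath (i : List ℕ) (k : ℕ) (P : List Step) : Prop where
  start : ∃ s, P.head? = some s ∧ s.inW = k ∧ Lowest i k s.node
  finish : ∃ s, P.getLast? = some s ∧ s.outW = k + 1 ∧ Lowest i (k + 1) s.node
  onW : ∀ s ∈ P, OnW i s.node s.inW ∧ OnW i s.node s.outW
  oriented : P.IsChain fun s s' => s.outW = s'.inW ∧ Next i k s.outW s.node s'.node
  nodup : (P.map Step.node).Nodup
  noForb : ∀ s ∈ P, ¬ s.Forb i k

/-- The rigorous paths in `G(i, 1), …, G(i, m - 1)`, with nodes as natural numbers. -/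
def paths (m : ℕ) (i : List ℕ) : Set (ℕ × List Step) :=
  {p | 1 ≤ p.1 ∧ p.1 < m ∧ NPath i p.1 p.2}

section Conversion

variable {i : List ℕ}

/-- The passage with its node as a natural number. -/
def Passage.toStep (s : Passage i) : Step := ⟨s.node, s.inWire, s.outWire⟩

theorem Passage.toStep_injective : Function.Injective (Passage.toStep (i := i)) := by
  rintro ⟨t, a, b⟩ ⟨t', a', b'⟩ h
  simp only [Passage.toStep, Step.mk.injEq] at h
  obtain ⟨h1, rfl, rfl⟩ := h
  rw [Fin.ext h1]

theorem onW_iff (t : Fin i.length) (r : ℕ) : OnW i t r ↔ OnWire i t r := by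
  simp [OnW, OnWire, col]

theorem forall_onW_iff {r : ℕ} {p : ℕ → Prop} :
    (∀ t, OnW i t r → p t) ↔ ∀ t : Fin i.length, OnWire i t r → p t :=
  ⟨fun h t ht => h t ((onW_iff t r).mpr ht), fun h t ht => h ⟨t, ht.1⟩ ((onW_iff ⟨t, ht.1⟩ r).mp ht)⟩

theorem lowest_iff (t : Fin i.length) (r : ℕ) : Lowest i r t ↔ IsLowest i r t := by
  simp only [Lowest, IsLowest, onW_iff, forall_onW_iff, Fin.le_def]

theorem next_iff (k r : ℕ) (t t' : Fin i.length) : Next i k r t t' ↔ Follows i k r t t' := by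
  simp only [Next, Follows, onW_iff, forall_onW_iff, Fin.lt_def]

theorem forb_iff (k : ℕ) (s : Passage i) : s.toStep.Forb i k ↔ s.IsForbidden k := by
  simp only [Step.Forb, Passage.IsForbidden, Passage.toStep, onW_iff]

theorem nPath_map_iff (k : ℕ) (P : List (Passage i)) :
    NPath i k (P.map Passage.toStep) ↔ IsRigorousPath i k P := by
  have hn : (P.map Passage.toStep).map Step.node = (P.map Passage.node).map Fin.val := by
    simp [List.map_map, Function.comp_def, Passage.toStep]
  constructor
  · rintro ⟨h1, h2, h3, h4, h5, h6⟩
    refine ⟨?_, ?_, ?_, ?_, ?_, ?_⟩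
    · obtain ⟨s, hs, h⟩ := h1
      rw [List.head?_map, Option.map_eq_some_iff] at hs
      obtain ⟨a, ha, rfl⟩ := hs
      exact ⟨a, ha, h.1, (lowest_iff _ _).mp h.2⟩
    · obtain ⟨s, hs, h⟩ := h2
      rw [List.getLast?_map, Option.map_eq_some_iff] at hs
      obtain ⟨a, ha, rfl⟩ := hs
      exact ⟨a, ha, h.1, (lowest_iff _ _).mp h.2⟩
    · intro s hs
      have := h3 _ (List.mem_map_of_mem hs)
      exact ⟨(onW_iff _ _).mp this.1, (onW_iff _ _).mp this.2⟩
    · rw [List.isChain_map] at h4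
      exact h4.imp fun a b h => ⟨h.1, (next_iff _ _ _ _).mp h.2⟩
    · rw [hn] at h5
      exact h5.of_map _
    · exact fun s hs h => h6 _ (List.mem_map_of_mem hs) ((forb_iff k s).mpr h)
  · rintro ⟨h1, h2, h3, h4, h5, h6⟩
    refine ⟨?_, ?_, ?_, ?_, ?_, ?_⟩
    · obtain ⟨s, hs, h⟩ := h1
      exact ⟨s.toStep, by simp [hs], h.1, (lowest_iff _ _).mpr h.2⟩
    · obtain ⟨s, hs, h⟩ := h2
      exact ⟨s.toStep, by simp [hs], h.1, (lowest_iff _ _).mpr h.2⟩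
    · intro s hs
      obtain ⟨a, ha, rfl⟩ := List.mem_map.mp hs
      exact ⟨(onW_iff _ _).mpr (h3 a ha).1, (onW_iff _ _).mpr (h3 a ha).2⟩
    · rw [List.isChain_map]
      exact h4.imp fun a b h => ⟨h.1, (next_iff _ _ _ _).mpr h.2⟩
    · rw [hn]
      exact h5.map Fin.val_injective
    · intro s hs h
      obtain ⟨a, ha, rfl⟩ := List.mem_map.mp hs
      exact h6 a ha ((forb_iff k a).mp h)

theorem paths_eq_image (m : ℕ) :
    paths m i = (Prod.map id (List.map Passage.toStep)) '' rigorousPaths m i := by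
  ext ⟨k, L⟩
  constructor
  · rintro ⟨h1, h2, h3⟩
    have hL : L ∈ Set.range (List.map (Passage.toStep (i := i))) := by
      rw [Set.range_list_map]
      exact fun s hs => ⟨⟨⟨s.node, (h3.onW s hs).1.1⟩, s.inW, s.outW⟩, rfl⟩
    obtain ⟨P, rfl⟩ := hL
    exact ⟨(k, P), ⟨h1, h2, (nPath_map_iff k P).mp h3⟩, rfl⟩
  · rintro ⟨⟨k', P⟩, ⟨h1, h2, h3⟩, h⟩
    simp only [Prod.map_apply, id_eq, Prod.mk.injEq] at h
    obtain ⟨rfl, rfl⟩ := h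
    exact ⟨h1, h2, (nPath_map_iff _ P).mpr h3⟩

theorem finite_paths (m : ℕ) (i : List ℕ) : (paths m i).Finite := by
  rw [paths_eq_image]
  exact (finite_rigorousPaths m i).image _

/-- The number of facets of a string cone is the number of rigorous paths. -/
theorem numFacets_eq_ncard_paths (m : ℕ) (i : List ℕ) : numFacets m i = (paths m i).ncard := by
  rw [numFacets_eq_ncard_rigorousPaths, paths_eq_image, Set.ncard_image_of_injective]
  exact Function.Injective.prodMap Function.injective_id
    (List.map_injective_iff.mpr Passage.toStep_injective)

end Conversion

section Walks

/-- The gap of the wiring diagram before a step of a path. -/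
def Step.pre (k : ℕ) (s : Step) : ℕ := if s.inW ≤ k then s.node + 1 else s.node

/-- The gap of the wiring diagram after a step of a path. -/
def Step.post (k : ℕ) (s : Step) : ℕ := if s.outW ≤ k then s.node else s.node + 1

/-- The list `P` of steps leads from the wire `w` at the gap `j` to `L_{k+1}`. -/
inductive Walk (i : List ℕ) (k : ℕ) : ℕ → ℕ → List Step → Prop
  | done : Walk i k i.length (k + 1) []
  | skipUp {t w : ℕ} {P : List Step} : w ≤ k → t < i.length → ¬ OnW i t w → Walk i k t w P →
      Walk i k (t + 1) w P
  | skipDown {t w : ℕ} {P : List Step} : k < w → t < i.length → ¬ OnW i t w →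
      Walk i k (t + 1) w P → Walk i k t w P
  | step {s : Step} {P : List Step} : OnW i s.node s.inW → OnW i s.node s.outW → ¬ s.Forb i k →
      Walk i k (s.post k) s.outW P → Walk i k (s.pre k) s.inW (s :: P)

variable {i : List ℕ} {k : ℕ}

theorem Walk.skip_up {w : ℕ} {P : List Step} (hw : w ≤ k) {j j' : ℕ} (hj : j ≤ j')
    (hj' : j' ≤ i.length) (h : ∀ t, OnW i t w → ¬ (j ≤ t ∧ t < j')) (hP : Walk i k j w P) :
    Walk i k j' w P := by
  induction j', hj using Nat.le_induction with
  | base => exact hP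
  | succ l hl ih =>
    exact .skipUp hw (by omega) (fun hc => h l hc (by omega))
      (ih (by omega) fun t ht hc => h t ht (by omega))

theorem Walk.skip_down {w : ℕ} {P : List Step} (hw : k < w) {j j' : ℕ} (hj : j ≤ j')
    (hj' : j' ≤ i.length) (h : ∀ t, OnW i t w → ¬ (j ≤ t ∧ t < j')) (hP : Walk i k j' w P) :
    Walk i k j w P := by
  induction hn : j' - j generalizing j with
  | zero =>
    obtain rfl : j = j' := by omega
    exact hP
  | succ n ih =>
    exact .skipDown hw (by omega) (fun hc => h j hc (by omega))
      (ih (by omega) (fun t ht hc => h t ht (by omega)) (by omega))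

theorem Walk.onW {j w : ℕ} {P : List Step} (h : Walk i k j w P) :
    ∀ s ∈ P, OnW i s.node s.inW ∧ OnW i s.node s.outW := by
  induction h with
  | done => simp
  | skipUp _ _ _ _ ih => exact ih
  | skipDown _ _ _ _ ih => exact ih
  | step h1 h2 _ _ ih =>
    intro s hs
    rcases List.mem_cons.mp hs with rfl | hs
    · exact ⟨h1, h2⟩
    · exact ih s hs

theorem Walk.noForb {j w : ℕ} {P : List Step} (h : Walk i k j w P) : ∀ s ∈ P, ¬ s.Forb i k := by
  induction h with
  | done => simp
  | skipUp _ _ _ _ ih => exact ih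
  | skipDown _ _ _ _ ih => exact ih
  | step _ _ h3 _ ih =>
    intro s hs
    rcases List.mem_cons.mp hs with rfl | hs
    · exact h3
    · exact ih s hs

/-- The first node of a walk is the next one on its first wire. -/
theorem Walk.head {j w : ℕ} {P : List Step} (h : Walk i k j w P) :
    (P = [] → w = k + 1 ∧ ∀ t, OnW i t w → t < j) ∧
    ∀ s ∈ P.head?, s.inW = w ∧ if w ≤ k then s.node < j ∧ ∀ t, OnW i t w → ¬ (s.node < t ∧ t < j)
      else j ≤ s.node ∧ ∀ t, OnW i t w → ¬ (j ≤ t ∧ t < s.node) := by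
  induction h with
  | done => exact ⟨fun _ => ⟨rfl, fun t ht => ht.1⟩, by simp⟩
  | @skipUp t w P h1 h2 h3 _ ih =>
    refine ⟨fun h => absurd (ih.1 h).1 (by omega), fun s hs => ?_⟩
    obtain ⟨h4, h5⟩ := ih.2 s hs
    rw [if_pos h1] at h5 ⊢
    refine ⟨h4, by omega, fun t' ht' hc => h5.2 t' ht' ⟨hc.1, ?_⟩⟩
    by_contra hcon
    obtain rfl : t' = t := by omega
    exact h3 ht'
  | @skipDown t w P h1 h2 h3 _ ih =>
    refine ⟨fun h => ⟨(ih.1 h).1, fun t' ht' => ?_⟩, fun s hs => ?_⟩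
    · have := (ih.1 h).2 t' ht'
      by_contra hcon
      obtain rfl : t' = t := by omega
      exact h3 ht'
    · obtain ⟨h4, h5⟩ := ih.2 s hs
      rw [if_neg (by omega)] at h5 ⊢
      refine ⟨h4, by omega, fun t' ht' hc => h5.2 t' ht' ⟨?_, hc.2⟩⟩
      by_contra hcon
      obtain rfl : t' = t := by omega
      exact h3 ht'
  | @step s P h1 h2 h3 _ ih =>
    refine ⟨fun h => by simp at h, fun u hu => ?_⟩
    simp only [List.head?_cons, Option.mem_def, Option.some.injEq] at hu
    subst hu
    refine ⟨rfl, ?_⟩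
    unfold Step.pre
    split_ifs
    · exact ⟨by omega, fun t _ hc => by omega⟩
    · exact ⟨by omega, fun t _ hc => by omega⟩

theorem Walk.oriented {j w : ℕ} {P : List Step} (h : Walk i k j w P) :
    P.IsChain fun s s' => s.outW = s'.inW ∧ Next i k s.outW s.node s'.node := by
  induction h with
  | done => simp
  | skipUp _ _ _ _ ih => exact ih
  | skipDown _ _ _ _ ih => exact ih
  | @step s P h1 h2 h3 h4 ih =>
    cases P with
    | nil => simp
    | cons s' P =>
      rw [List.isChain_cons_cons]
      refine ⟨?_, ih⟩
      obtain ⟨h5, h6⟩ := h4.head.2 s' (by simp)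
      refine ⟨h5.symm, h2, h5 ▸ (h4.onW s' (by simp)).1, ?_⟩
      unfold Step.post at h6
      split_ifs at h6 ⊢
      · exact h6
      · exact ⟨by omega, fun t ht hc => h6.2 t ht (by omega)⟩

theorem Walk.finish {j w : ℕ} {P : List Step} (h : Walk i k j w P) :
    ∀ s ∈ P.getLast?, s.outW = k + 1 ∧ Lowest i (k + 1) s.node := by
  induction h with
  | done => simp
  | skipUp _ _ _ _ ih => exact ih
  | skipDown _ _ _ _ ih => exact ih
  | @step s P h1 h2 h3 h4 ih =>
    cases P with
    | nil =>
      intro u hu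
      simp only [List.getLast?_singleton, Option.mem_def, Option.some.injEq] at hu
      subst hu
      obtain ⟨h5, h6⟩ := h4.head.1 rfl
      refine ⟨h5, h5 ▸ h2, fun t ht => ?_⟩
      have := h6 t (h5 ▸ ht)
      unfold Step.post at this
      split_ifs at this <;> omega
    | cons s' P =>
      rw [List.getLast?_cons_cons]
      exact ih

theorem Walk.nPath {P : List Step} (h : Walk i k i.length k P)
    (hn : (P.map Step.node).Nodup) : NPath i k P := by
  cases P with
  | nil => exact absurd (h.head.1 rfl).1 (by omega)
  | cons s P =>
    obtain ⟨h1, h2⟩ := h.head.2 s (by simp)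
    rw [if_pos le_rfl] at h2
    refine ⟨⟨s, by simp, h1, h1 ▸ (h.onW s (by simp)).1, fun t ht => ?_⟩, ?_, h.onW, h.oriented, hn,
      h.noForb⟩
    · by_contra hcon
      exact h2.2 t ht ⟨by omega, ht.1⟩
    · obtain ⟨u, hu⟩ : ∃ u, (s :: P).getLast? = some u := by
        rw [← Option.isSome_iff_exists]
        simp
      exact ⟨u, hu, h.finish u hu⟩

theorem walk_of_chain : ∀ {P : List Step} {s : Step},
    (∀ u ∈ s :: P, OnW i u.node u.inW ∧ OnW i u.node u.outW) →
    ((s :: P).IsChain fun s s' => s.outW = s'.inW ∧ Next i k s.outW s.node s'.node) →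
    (∃ u, (s :: P).getLast? = some u ∧ u.outW = k + 1 ∧ Lowest i (k + 1) u.node) →
    (∀ u ∈ s :: P, ¬ u.Forb i k) → Walk i k (s.pre k) s.inW (s :: P) := by
  intro P
  induction P with
  | nil =>
    intro s h1 _ h3 h4
    obtain ⟨u, hu, h5, h6⟩ := h3
    simp only [List.getLast?_singleton, Option.some.injEq] at hu
    subst hu
    refine .step (h1 s (by simp)).1 (h1 s (by simp)).2 (h4 s (by simp)) ?_
    unfold Step.post
    rw [if_neg (by omega), h5]
    refine Walk.skip_down (by omega) (h1 s (by simp)).1.1 le_rfl (fun t ht hc => ?_) .done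
    have := h6.2 t ht
    omega
  | cons s' P ih =>
    intro s h1 h2 h3 h4
    refine .step (h1 s (by simp)).1 (h1 s (by simp)).2 (h4 s (by simp)) ?_
    rw [List.isChain_cons_cons] at h2
    have hW := ih (fun u hu => h1 u (List.mem_cons_of_mem _ hu)) h2.2 (by simpa using h3)
      (fun u hu => h4 u (List.mem_cons_of_mem _ hu))
    obtain ⟨⟨h5, h6, h7, h8⟩, -⟩ := h2
    rw [← h5] at hW
    have hs := h6.1
    have hs' := h7.1
    unfold Step.pre at hW
    unfold Step.post
    rw [← h5] at hW
    split_ifs at h8 hW ⊢ with hle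
    · exact hW.skip_up hle (by omega) (by omega) fun t ht hc => h8.2 t ht (by omega)
    · exact hW.skip_down (by omega) (by omega) (by omega) fun t ht hc => h8.2 t ht (by omega)

theorem NPath.walk {P : List Step} (h : NPath i k P) : Walk i k i.length k P := by
  obtain ⟨s, hs, h1, h2⟩ := h.start
  cases P with
  | nil => simp at hs
  | cons s' P =>
    simp only [List.head?_cons, Option.some.injEq] at hs
    subst hs
    have hW := walk_of_chain h.onW h.oriented h.finish h.noForb
    rw [Step.pre, if_pos (by omega), h1] at hW
    have := h2.1.1
    refine hW.skip_up le_rfl (by omega) le_rfl fun t ht hc => ?_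
    have := h2.2 t ht
    omega

end Walks

end Wiring

theorem exists_step_of_not {p : ℕ → Prop} {a b : ℕ} (hab : a ≤ b) (ha : p a) (hb : ¬ p b) :
    ∃ t, a ≤ t ∧ t < b ∧ p t ∧ ¬ p (t + 1) := by
  by_contra! h
  exact hb (Nat.le_induction (P := fun t _ => t ≤ b → p t) (fun _ => ha)
    (fun t ht ih htb => h t ht (by omega) (ih (by omega))) b hab le_rfl)

theorem decreasing_induction {p : ℕ → Prop} {a b : ℕ} (hb : p b)
    (h : ∀ t, a ≤ t → t < b → p (t + 1) → p t) : ∀ t, a ≤ t → t ≤ b → p t := by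
  intro t hat htb
  induction hn : b - t generalizing t with
  | zero =>
    obtain rfl : t = b := by omega
    exact hb
  | succ n ih => exact h t hat (by omega) (ih (t + 1) (by omega) (by omega) (by omega))

namespace Wiring

section Arrangement

variable {i : List ℕ}

theorem arrangement_zero (i : List ℕ) : arrangement i 0 = 1 := by simp [arrangement]

theorem arrangement_succ {t : ℕ} (ht : t < i.length) :
    arrangement i (t + 1) = arrangement i t * Equiv.swap (col i t) (col i t + 1) := by
  have hc : col i t = i[t] := by simp [col, ht]
  rw [hc, arrangement, List.take_succ_eq_append_getElem ht, List.map_append, List.prod_append,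
    arrangement]
  simp

theorem arrangement_succ_left {t : ℕ} (ht : t < i.length) :
    arrangement i (t + 1) (col i t) = arrangement i t (col i t + 1) := by
  simp [arrangement_succ ht]

theorem arrangement_succ_right {t : ℕ} (ht : t < i.length) :
    arrangement i (t + 1) (col i t + 1) = arrangement i t (col i t) := by
  simp [arrangement_succ ht]

theorem arrangement_succ_of_ne {t x : ℕ} (ht : t < i.length) (h1 : x ≠ col i t)
    (h2 : x ≠ col i t + 1) : arrangement i (t + 1) x = arrangement i t x := by
  simp [arrangement_succ ht, Equiv.swap_apply_of_ne_of_ne h1 h2]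

theorem not_onW {t x : ℕ} (h1 : x ≠ col i t) (h2 : x ≠ col i t + 1) :
    ¬ OnW i t (arrangement i t x) := by
  rintro ⟨-, h | h⟩
  · exact h1 ((arrangement i t).injective h)
  · exact h2 ((arrangement i t).injective h)

theorem onW_left {t : ℕ} (ht : t < i.length) : OnW i t (arrangement i t (col i t)) :=
  ⟨ht, Or.inl rfl⟩

theorem onW_right {t : ℕ} (ht : t < i.length) : OnW i t (arrangement i t (col i t + 1)) :=
  ⟨ht, Or.inr rfl⟩

end Arrangement

end Wiring

namespace IsLongestReducedWord

open Wiring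

variable {m : ℕ} {i : List ℕ} (hi : IsLongestReducedWord m i)

include hi

theorem col_bounds {t : ℕ} (ht : t < i.length) : 1 ≤ col i t ∧ col i t < m := by
  have := hi.1 i[t] (List.getElem_mem ht)
  simpa [col, ht] using this

theorem arrangement_length {x : ℕ} (h1 : 1 ≤ x) (h2 : x ≤ m) :
    arrangement i i.length x = m + 1 - x := by
  simpa [arrangement] using hi.2.2 x h1 h2

theorem arrangement_of_not_mem {j x : ℕ} (hj : j ≤ i.length) (hx : ¬ (1 ≤ x ∧ x ≤ m)) :
    arrangement i j x = x := by
  induction j with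
  | zero => simp [arrangement_zero]
  | succ t ih =>
    have := hi.col_bounds (t := t) (by omega)
    rw [arrangement_succ_of_ne (by omega) (by omega) (by omega), ih (by omega)]

theorem arrangement_bounds {j x : ℕ} (hj : j ≤ i.length) (h1 : 1 ≤ x) (h2 : x ≤ m) :
    1 ≤ arrangement i j x ∧ arrangement i j x ≤ m := by
  by_contra h
  have h3 := hi.arrangement_of_not_mem hj h
  rw [(arrangement i j).injective h3] at h
  exact h ⟨h1, h2⟩

/-- The wires of a node are in increasing order above the node. -/
theorem arrangement_lt {t : ℕ} (ht : t < i.length) :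
    arrangement i t (col i t) < arrangement i t (col i t + 1) := by
  set inc : Finset ℕ := (Finset.range i.length).filter fun t =>
    arrangement i t (col i t) < arrangement i t (col i t + 1) with hinc
  set prs : Finset (Σ _ : ℕ, ℕ) := (Finset.range m).sigma fun s => Finset.range s with hprs
  have hcard : prs.card = i.length := by
    rw [hprs, Finset.card_sigma, hi.2.1]
    simp [Finset.sum_range_id]
  have hex : ∀ p ∈ prs, ∃ t ∈ inc, arrangement i t (col i t) = p.2 + 1 ∧
      arrangement i t (col i t + 1) = p.1 + 1 := by
    rintro ⟨s, r⟩ hp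
    simp only [hprs, Finset.mem_sigma, Finset.mem_range] at hp
    obtain ⟨t, -, ht, h1, h2⟩ := exists_step_of_not
      (p := fun j => (arrangement i j).symm (r + 1) < (arrangement i j).symm (s + 1))
      (Nat.zero_le i.length) (by rw [arrangement_zero]; change r + 1 < s + 1; omega) (by
        have e : ∀ x, x < m → (arrangement i i.length).symm (x + 1) = m - x := by
          intro x hx
          rw [Equiv.symm_apply_eq, hi.arrangement_length (by omega) (by omega)]
          omega
        rw [e r (by omega), e s (by omega)]
        omega)
    have hsw : ∀ w, (arrangement i (t + 1)).symm w =
        Equiv.swap (col i t) (col i t + 1) ((arrangement i t).symm w) := by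
      intro w
      rw [arrangement_succ ht, Equiv.symm_apply_eq]
      simp
    rw [hsw, hsw] at h2
    have e1 : (arrangement i t).symm (r + 1) = col i t ∧
        (arrangement i t).symm (s + 1) = col i t + 1 := by
      simp only [Equiv.swap_apply_def] at h2
      split_ifs at h2 <;> omega
    rw [Equiv.symm_apply_eq, Equiv.symm_apply_eq] at e1
    refine ⟨t, ?_, e1.1.symm, e1.2.symm⟩
    rw [hinc, Finset.mem_filter, Finset.mem_range, ← e1.1, ← e1.2]
    exact ⟨ht, by omega⟩
  have hle : prs.card ≤ inc.card := by
    choose! g hg1 hg2 using hex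
    refine Finset.card_le_card_of_injOn g hg1 fun p hp q hq hpq => ?_
    have h1 := hg2 p hp
    have h2 := hg2 q hq
    rw [hpq] at h1
    obtain ⟨a, b⟩ := p
    obtain ⟨a', b'⟩ := q
    simp only at h1 h2
    obtain rfl : a = a' := by omega
    obtain rfl : b = b' := by omega
    rfl
  have heq : inc = Finset.range i.length := by
    apply Finset.eq_of_subset_of_card_le (Finset.filter_subset _ _)
    exact (Finset.card_range _).le.trans (hcard.symm.le.trans hle)
  have : t ∈ inc := by rw [heq]; simpa using ht
  exact (Finset.mem_filter.mp this).2

end IsLongestReducedWord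

namespace Wiring

/-- The position, at the gap `j`, of the path which goes up from `L_k`, goes straight on at the
nodes at which it is at the lower right, and changes wires at the nodes at which it is at the
lower left. -/
def upPos (m : ℕ) (i : List ℕ) (k j : ℕ) : ℕ :=
  (i.drop j).foldr (fun c z => if z = c + 1 then c else z) (m + 1 - k)

theorem upPos_length (m : ℕ) (i : List ℕ) (k : ℕ) : upPos m i k i.length = m + 1 - k := by
  simp [upPos]

theorem upPos_eq (m : ℕ) {i : List ℕ} (k : ℕ) {t : ℕ} (ht : t < i.length) :
    upPos m i k t = if upPos m i k (t + 1) = col i t + 1 then col i t else upPos m i k (t + 1) := by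
  have hc : col i t = i[t] := by simp [col, ht]
  rw [hc, upPos, List.drop_eq_getElem_cons ht, List.foldr_cons]
  rfl

theorem upPos_step (m : ℕ) {i : List ℕ} (k : ℕ) {t : ℕ} (ht : t < i.length) :
    upPos m i k (t + 1) = col i t + 1 ∧ upPos m i k t = col i t ∨
    upPos m i k (t + 1) ≠ col i t + 1 ∧ upPos m i k t = upPos m i k (t + 1) := by
  rw [upPos_eq m k ht]
  split_ifs with h
  · exact Or.inl ⟨h, rfl⟩
  · exact Or.inr ⟨h, rfl⟩

theorem upPos_mono (m : ℕ) {i : List ℕ} (k : ℕ) {j j' : ℕ} (hj : j ≤ j') (hj' : j' ≤ i.length) :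
    upPos m i k j ≤ upPos m i k j' := by
  refine decreasing_induction (p := fun t => upPos m i k t ≤ upPos m i k j') le_rfl
    (fun t _ h2 h3 => ?_) j le_rfl hj
  rcases upPos_step m k (i := i) (t := t) (by omega) with h | h <;> omega

theorem upPos_anti (m : ℕ) {i : List ℕ} {k k' : ℕ} (hk : k ≤ k') {j : ℕ} (hj : j ≤ i.length) :
    upPos m i k' j ≤ upPos m i k j := by
  refine decreasing_induction (a := 0) (p := fun t => upPos m i k' t ≤ upPos m i k t) ?_
    (fun t _ h2 h3 => ?_) j (Nat.zero_le _) hj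
  · rw [upPos_length, upPos_length]
    omega
  · rcases upPos_step m k (i := i) (t := t) (by omega) with h | h <;>
    rcases upPos_step m k' (i := i) (t := t) (by omega) with h' | h' <;> omega

end Wiring

namespace IsLongestReducedWord

open Wiring

variable {m : ℕ} {i : List ℕ} (hi : IsLongestReducedWord m i)

include hi

theorem upPos_bounds {k : ℕ} (h2 : k ≤ m) {j : ℕ} (hj : j ≤ i.length) :
    1 ≤ upPos m i k j ∧ upPos m i k j ≤ m + 1 - k := by
  have := upPos_mono m k hj le_rfl
  rw [upPos_length] at this
  refine ⟨?_, this⟩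
  refine decreasing_induction (a := 0) (p := fun t => 1 ≤ upPos m i k t) ?_
    (fun t _ h2 h3 => ?_) j (Nat.zero_le _) hj
  · rw [upPos_length]
    omega
  · have := hi.col_bounds h2
    rcases upPos_step m k (i := i) (t := t) (by omega) with h | h <;> omega

theorem upPos_aux {k : ℕ} (h1 : 1 ≤ k) (h2 : k ≤ m) {j : ℕ} (hj : j ≤ i.length) :
    (∀ x, 1 ≤ x → x < upPos m i k j → k < arrangement i j x) ∧
      arrangement i j (upPos m i k j) ≤ k := by
  refine decreasing_induction (a := 0) (p := fun j =>
    (∀ x, 1 ≤ x → x < upPos m i k j → k < arrangement i j x) ∧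
      arrangement i j (upPos m i k j) ≤ k) ?_ (fun t _ ht ih => ?_) j (Nat.zero_le _) hj
  · rw [upPos_length]
    refine ⟨fun x hx hx' => ?_, ?_⟩
    · rw [hi.arrangement_length hx (by omega)]
      omega
    · rw [hi.arrangement_length (by omega) (by omega)]
      omega
  · have hc := hi.col_bounds ht
    have hl := arrangement_succ_left ht
    have hr := arrangement_succ_right ht
    have hlt := hi.arrangement_lt ht
    have hne := fun x => arrangement_succ_of_ne (x := x) ht
    rcases upPos_step m k (i := i) (t := t) (by omega) with h | h
    · rw [h.1] at ih
      rw [h.2]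
      refine ⟨fun x hx hx' => ?_, by omega⟩
      rw [← hne x (by omega) (by omega)]
      exact ih.1 x hx (by omega)
    · rw [h.2]
      refine ⟨fun x hx hx' => ?_, ?_⟩
      · by_cases e1 : x = col i t
        · subst e1
          rw [← hr]
          exact ih.1 _ (by omega) (by omega)
        · by_cases e2 : x = col i t + 1
          · subst e2
            rw [← hl]
            exact ih.1 _ (by omega) (by omega)
          · rw [← hne x e1 e2]
            exact ih.1 x hx hx'
      · by_cases e1 : upPos m i k (t + 1) = col i t
        · rw [e1] at ih ⊢
          omega
        · rw [← hne _ e1 h.1]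
          exact ih.2

theorem lt_arrangement {k : ℕ} (h1 : 1 ≤ k) (h2 : k ≤ m) {j : ℕ} (hj : j ≤ i.length) {x : ℕ}
    (hx : 1 ≤ x) (hx' : x < upPos m i k j) : k < arrangement i j x :=
  (hi.upPos_aux h1 h2 hj).1 x hx hx'

theorem arrangement_upPos_le {k : ℕ} (h1 : 1 ≤ k) (h2 : k ≤ m) {j : ℕ} (hj : j ≤ i.length) :
    arrangement i j (upPos m i k j) ≤ k :=
  (hi.upPos_aux h1 h2 hj).2

theorem upPos_zero {k : ℕ} (h1 : 1 ≤ k) (h2 : k ≤ m) : upPos m i k 0 = 1 := by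
  have := (hi.upPos_bounds h2 (Nat.zero_le _)).1
  by_contra h
  have := hi.lt_arrangement h1 h2 (Nat.zero_le _) (x := 1) le_rfl (by omega)
  rw [arrangement_zero, Equiv.Perm.one_apply] at this
  omega

theorem arrangement_upPos_one (hm : 1 ≤ m) {j : ℕ} (hj : j ≤ i.length) :
    arrangement i j (upPos m i 1 j) = 1 := by
  have h1 := hi.arrangement_upPos_le le_rfl hm hj
  have h2 := hi.upPos_bounds hm hj
  have h3 := hi.arrangement_bounds hj h2.1 (by omega)
  omega

theorem upPos_eq_one {j : ℕ} (hj : j ≤ i.length) : upPos m i m j = 1 := by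
  have := hi.upPos_bounds le_rfl hj
  omega

end IsLongestReducedWord

namespace Wiring

section Steps

variable {i : List ℕ} {k : ℕ}

theorem not_forb_of_ne {s : Step} (h : s.inW ≠ s.outW) : ¬ s.Forb i k := fun h' => h h'.1

theorem Walk.up {t a b : ℕ} {P : List Step} (ha : a ≤ k) (hb : b ≤ k) (h1 : OnW i t a)
    (h2 : OnW i t b) (hf : ¬ Step.Forb i k ⟨t, a, b⟩) (hP : Walk i k t b P) :
    Walk i k (t + 1) a (⟨t, a, b⟩ :: P) := by
  have := Walk.step (s := ⟨t, a, b⟩) (P := P) h1 h2 hf (by simpa [Step.post, hb] using hP)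
  simpa [Step.pre, ha] using this

theorem Walk.down {t a b : ℕ} {P : List Step} (ha : k < a) (hb : k < b) (h1 : OnW i t a)
    (h2 : OnW i t b) (hf : ¬ Step.Forb i k ⟨t, a, b⟩) (hP : Walk i k (t + 1) b P) :
    Walk i k t a (⟨t, a, b⟩ :: P) := by
  have := Walk.step (s := ⟨t, a, b⟩) (P := P) h1 h2 hf (by simpa [Step.post, hb.not_ge] using hP)
  simpa [Step.pre, ha.not_ge] using this

theorem Walk.peak {t a b : ℕ} {P : List Step} (ha : a ≤ k) (hb : k < b) (h1 : OnW i t a)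
    (h2 : OnW i t b) (hP : Walk i k (t + 1) b P) :
    Walk i k (t + 1) a (⟨t, a, b⟩ :: P) := by
  have := Walk.step (k := k) (s := ⟨t, a, b⟩) (P := P) h1 h2 (not_forb_of_ne (by simp; omega))
    (by simpa [Step.post, hb.not_ge] using hP)
  simpa [Step.pre, ha] using this

theorem Walk.valley {t a b : ℕ} {P : List Step} (ha : k < a) (hb : b ≤ k) (h1 : OnW i t a)
    (h2 : OnW i t b) (hP : Walk i k t b P) :
    Walk i k t a (⟨t, a, b⟩ :: P) := by
  have := Walk.step (k := k) (s := ⟨t, a, b⟩) (P := P) h1 h2 (not_forb_of_ne (by simp; omega))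
    (by simpa [Step.post, hb] using hP)
  simpa [Step.pre, ha.not_ge] using this

end Steps

/-- The steps go down from the gap `j`, and stay to the left of `upPos m i k`. -/
def DownRun (m : ℕ) (i : List ℕ) (k j : ℕ) (P : List Step) : Prop :=
  (∀ s ∈ P, j ≤ s.node ∧ k < s.inW ∧ k < s.outW ∧ col i s.node + 1 < upPos m i k (s.node + 1)) ∧
    P.Pairwise fun s s' => s.node < s'.node

/-- The steps go up to the gap `j` along wires which are oriented upward. -/
def UpRun (k j : ℕ) (P : List Step) : Prop :=
  (∀ s ∈ P, j ≤ s.node ∧ s.inW ≤ k ∧ s.outW ≤ k) ∧ P.Pairwise fun s s' => s'.node < s.node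

theorem DownRun.cons {m : ℕ} {i : List ℕ} {k t a b : ℕ} {P : List Step}
    (hP : DownRun m i k (t + 1) P) (ha : k < a) (hb : k < b)
    (ht : col i t + 1 < upPos m i k (t + 1)) : DownRun m i k t (⟨t, a, b⟩ :: P) := by
  refine ⟨fun s hs => ?_, List.pairwise_cons.mpr ⟨fun s hs => ?_, hP.2⟩⟩
  · rcases List.mem_cons.mp hs with rfl | hs
    · exact ⟨le_rfl, ha, hb, ht⟩
    · have := hP.1 s hs
      exact ⟨by omega, this.2⟩
  · have := hP.1 s hs
    change t < s.node
    omega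

theorem DownRun.anti {m : ℕ} {i : List ℕ} {k j j' : ℕ} {P : List Step}
    (hP : DownRun m i k j P) (hj : j' ≤ j) : DownRun m i k j' P :=
  ⟨fun s hs => ⟨hj.trans (hP.1 s hs).1, (hP.1 s hs).2⟩, hP.2⟩

theorem UpRun.cons {k t a b : ℕ} {P : List Step} {j : ℕ} (hP : UpRun k j P)
    (h : ∀ s ∈ P, s.node < t) (hj : j ≤ t) (ha : a ≤ k) (hb : b ≤ k) :
    UpRun k j (⟨t, a, b⟩ :: P) := by
  refine ⟨fun s hs => ?_, List.pairwise_cons.mpr ⟨fun s hs => h s hs, hP.2⟩⟩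
  rcases List.mem_cons.mp hs with rfl | hs
  · exact ⟨hj, ha, hb⟩
  · exact hP.1 s hs

theorem nodup_of_pairwise_lt {P : List Step} (h : P.Pairwise fun s s' => s.node < s'.node) :
    (P.map Step.node).Nodup :=
  List.pairwise_map.mpr (h.imp fun h => h.ne)

theorem nodup_of_pairwise_gt {P : List Step} (h : P.Pairwise fun s s' => s'.node < s.node) :
    (P.map Step.node).Nodup :=
  List.pairwise_map.mpr (h.imp fun h => h.ne')

/-- Up-walks at constant position. -/
theorem exists_const_up {i : List ℕ} {k x j₀ j₁ : ℕ} (hj : j₀ ≤ j₁) (hj₁ : j₁ ≤ i.length)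
    (hup : ∀ j, j₀ ≤ j → j ≤ j₁ → arrangement i j x ≤ k)
    (hcol : ∀ t, j₀ ≤ t → t < j₁ → x ≠ col i t + 1) {P : List Step}
    (hP : Walk i k j₀ (arrangement i j₀ x) P) :
    ∃ Q, Walk i k j₁ (arrangement i j₁ x) (Q ++ P) ∧ UpRun k j₀ Q ∧
      ∀ s ∈ Q, s.node < j₁ ∧ col i s.node = x := by
  induction j₁, hj using Nat.le_induction with
  | base => exact ⟨[], hP, ⟨by simp, by simp⟩, by simp⟩
  | succ t ht ih =>
    obtain ⟨Q, h1, h2, h3⟩ := ih (by omega) (fun j h h' => hup j h (by omega))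
      (fun t' h h' => hcol t' h (by omega))
    have ht' : t < i.length := by omega
    by_cases hx : x = col i t
    · have hl := arrangement_succ_left ht'
      have hu := hup t ht (by omega)
      have hu' := hup (t + 1) (by omega) le_rfl
      subst hx
      refine ⟨⟨t, arrangement i (t + 1) (col i t), arrangement i t (col i t)⟩ :: Q, ?_,
        h2.cons (fun s hs => (h3 s hs).1) ht hu' hu, ?_⟩
      · refine h1.up hu' hu (by rw [hl]; exact onW_right ht') (onW_left ht') (not_forb_of_ne ?_)
        rw [hl]
        simp
      · intro s hs
        rcases List.mem_cons.mp hs with rfl | hs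
        · exact ⟨by simp, rfl⟩
        · exact ⟨by have := (h3 s hs).1; omega, (h3 s hs).2⟩
    · have hx' := hcol t ht (by omega)
      refine ⟨Q, ?_, h2, fun s hs => ⟨by have := (h3 s hs).1; omega, (h3 s hs).2⟩⟩
      have hu := hup t ht (by omega)
      rw [arrangement_succ_of_ne ht' hx hx']
      exact .skipUp hu ht' (not_onW hx hx') h1

end Wiring

namespace IsLongestReducedWord

open Wiring

variable {m : ℕ} {i : List ℕ} (hi : IsLongestReducedWord m i)

include hi

/-- Walking down to the right, one arrives at the `L_{k+1}` to which the position belongs. -/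
theorem exists_down_right {k : ℕ} (h1 : 1 ≤ k) (h2 : k < m) {j : ℕ} (hj : j ≤ i.length) :
    ∀ x, upPos m i (k + 1) j ≤ x → x < upPos m i k j →
      ∃ P, Walk i k j (arrangement i j x) P ∧ DownRun m i k j P := by
  refine decreasing_induction (a := 0) (p := fun j =>
    ∀ x, upPos m i (k + 1) j ≤ x → x < upPos m i k j →
      ∃ P, Walk i k j (arrangement i j x) P ∧ DownRun m i k j P) ?_ (fun t _ ht ih => ?_)
      j (Nat.zero_le _) hj
  · intro x hx hx'
    rw [upPos_length] at hx hx'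
    refine ⟨[], ?_, by simp [DownRun]⟩
    rw [hi.arrangement_length (by omega) (by omega), show m + 1 - x = k + 1 by omega]
    exact .done
  · intro x hx hx'
    have hc := hi.col_bounds ht
    have hl := arrangement_succ_left ht
    have hr := arrangement_succ_right ht
    have hlt := hi.arrangement_lt ht
    have hx1 := (hi.upPos_bounds (k := k + 1) (by omega) ht.le).1
    have hin := hi.lt_arrangement h1 (by omega) ht.le (x := x) (by omega) hx'
    have hs := upPos_step m k ht
    have hs' := upPos_step m (k + 1) ht
    have hb := fun x => hi.lt_arrangement h1 (by omega) (j := t + 1) ht (x := x)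
    by_cases e1 : x = col i t
    · subst e1
      have hz : col i t + 1 < upPos m i k (t + 1) := by omega
      obtain ⟨P, hP, hP'⟩ := ih (col i t + 1) (by omega) hz
      rw [hr] at hP
      refine ⟨_, hP.down hin hin (onW_left ht) (onW_left ht) ?_, hP'.cons hin hin hz⟩
      rintro ⟨-, q, ⟨-, hq⟩, h | h⟩
      · simp only at hq h
        omega
      · simp only at h
        omega
    · by_cases e2 : x = col i t + 1
      · subst e2
        have hz : col i t + 1 < upPos m i k (t + 1) := by omega
        obtain ⟨P, hP, hP'⟩ := ih (col i t + 1) (by omega) hz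
        have hout := hb (col i t + 1) (by omega) hz
        rw [hr] at hP hout
        exact ⟨_, hP.down hin hout (onW_right ht) (onW_left ht)
          (not_forb_of_ne (by simp)), hP'.cons hin hout hz⟩
      · obtain ⟨P, hP, hP'⟩ := ih x (by omega) (by omega)
        rw [arrangement_succ_of_ne ht e1 e2] at hP
        exact ⟨P, .skipDown hin ht (not_onW e1 e2) hP, hP'.anti (by omega)⟩

/-- Walking down at constant position. -/
theorem exists_const_down {k : ℕ} (h1 : 1 ≤ k) (h2 : k < m) {j₀ j₁ x : ℕ} (hj : j₀ ≤ j₁)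
    (hj₁ : j₁ ≤ i.length) (hx : 1 ≤ x) (hup : ∀ j, j₀ ≤ j → j ≤ j₁ → x < upPos m i k j)
    {P : List Step} (hP : Walk i k j₁ (arrangement i j₁ x) P) (hP' : DownRun m i k j₁ P) :
    ∃ Q, Walk i k j₀ (arrangement i j₀ x) (Q ++ P) ∧ DownRun m i k j₀ (Q ++ P) := by
  refine decreasing_induction (a := j₀) (p := fun j =>
    ∃ Q, Walk i k j (arrangement i j x) (Q ++ P) ∧ DownRun m i k j (Q ++ P))
    ⟨[], hP, hP'⟩ (fun t ht1 ht2 ih => ?_) j₀ le_rfl hj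
  have ht : t < i.length := by omega
  obtain ⟨Q, hQ, hQ'⟩ := ih
  have hl := arrangement_succ_left ht
  have hr := arrangement_succ_right ht
  have hb := hi.lt_arrangement h1 (by omega) ht.le hx (hup t ht1 (by omega))
  have hb' := hi.lt_arrangement h1 (by omega) (j := t + 1) ht hx (hup (t + 1) (by omega) (by omega))
  have hs := upPos_step m k ht
  have hu := hup t ht1 (by omega)
  have hu' := hup (t + 1) (by omega) (by omega)
  by_cases e1 : x = col i t
  · subst e1
    refine ⟨⟨t, arrangement i t (col i t), arrangement i (t + 1) (col i t)⟩ :: Q, ?_,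
      hQ'.cons hb hb' (by omega)⟩
    refine hQ.down hb hb' (onW_left ht) (by rw [hl]; exact onW_right ht) (not_forb_of_ne ?_)
    rw [hl]
    simp
  · by_cases e2 : x = col i t + 1
    · subst e2
      refine ⟨⟨t, arrangement i t (col i t + 1), arrangement i (t + 1) (col i t + 1)⟩ :: Q, ?_,
        hQ'.cons hb hb' (by omega)⟩
      refine hQ.down hb hb' (onW_right ht) (by rw [hr]; exact onW_left ht) (not_forb_of_ne ?_)
      rw [hr]
      simp
    · rw [arrangement_succ_of_ne ht e1 e2] at hQ
      exact ⟨Q, .skipDown hb ht (not_onW e1 e2) hQ, hQ'.anti (by omega)⟩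

/-- The up-walk from `L_k` along the positions `upPos`. -/
theorem exists_up {k : ℕ} (h1 : 1 ≤ k) (h2 : k < m) {j : ℕ} (hj : j ≤ i.length)
    {P : List Step} (hP : Walk i k j (arrangement i j (upPos m i k j)) P) :
    ∃ Q, Walk i k i.length k (Q ++ P) ∧ UpRun k j Q ∧
      (∀ s ∈ Q, upPos m i k (s.node + 1) ≤ col i s.node + 1) ∧
      (∀ s ∈ Q, s.inW = 1 → s.outW = 1) ∧
      (upPos m i k j < upPos m i k i.length → ∃ s ∈ Q, ∃ q, OnW i s.node q ∧ k < q) := by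
  have key : ∀ j', j ≤ j' → j' ≤ i.length → ∃ Q, Walk i k j' (arrangement i j' (upPos m i k j')) (Q ++ P) ∧
      UpRun k j Q ∧ (∀ s ∈ Q, s.node < j') ∧
      (∀ s ∈ Q, upPos m i k (s.node + 1) ≤ col i s.node + 1) ∧
      (∀ s ∈ Q, s.inW = 1 → s.outW = 1) ∧
      (upPos m i k j < upPos m i k j' → ∃ s ∈ Q, ∃ q, OnW i s.node q ∧ k < q) := by
    intro j' hj'
    induction j', hj' using Nat.le_induction with
    | base => exact fun _ => ⟨[], hP, ⟨by simp, by simp⟩, by simp, by simp, by simp, by simp⟩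
    | succ t ht ih =>
      intro ht'
      obtain ⟨Q, hQ, hQ1, hQ2, hQ3, hQ4, hQ5⟩ := ih (by omega)
      have htl : t < i.length := by omega
      have hc := hi.col_bounds htl
      have hl := arrangement_succ_left htl
      have hr := arrangement_succ_right htl
      have hlt := hi.arrangement_lt htl
      have hw := hi.arrangement_upPos_le h1 h2.le htl.le
      have hw' := hi.arrangement_upPos_le h1 h2.le (j := t + 1) htl
      have hb' := fun x => hi.lt_arrangement h1 h2.le (j := t + 1) htl (x := x)
      have hpos := hi.arrangement_bounds htl.le hc.1 (by omega)
      rcases upPos_step m k htl with h | h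
      · rw [h.2] at hQ hw
        have hmix := hb' (col i t) (by omega) (by omega)
        rw [hl] at hmix
        refine ⟨⟨t, arrangement i t (col i t), arrangement i t (col i t)⟩ :: Q, ?_,
          hQ1.cons hQ2 ht hw hw, ?_, ?_, ?_, ?_⟩
        · rw [h.1, hr]
          refine hQ.up hw hw (onW_left htl) (onW_left htl) ?_
          rintro ⟨-, q, ⟨-, hq⟩, h' | h'⟩
          · simp only at h'
            omega
          · simp only at hq h'
            omega
        · intro s hs
          rcases List.mem_cons.mp hs with rfl | hs
          · simp
          · have := hQ2 s hs
            omega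
        · intro s hs
          rcases List.mem_cons.mp hs with rfl | hs
          · exact h.1.le
          · exact hQ3 s hs
        · intro s hs
          rcases List.mem_cons.mp hs with rfl | hs
          · exact fun h => h
          · exact hQ4 s hs
        · exact fun _ => ⟨_, List.mem_cons_self, _, onW_right htl, hmix⟩
      · rw [h.2] at hQ hw
        by_cases e1 : upPos m i k (t + 1) = col i t
        · rw [e1] at hQ hw hw'
          refine ⟨⟨t, arrangement i t (col i t + 1), arrangement i t (col i t)⟩ :: Q, ?_,
            hQ1.cons hQ2 ht (by omega) hw, ?_, ?_, ?_, ?_⟩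
          · rw [e1, hl]
            exact hQ.up (by omega) hw (onW_right htl) (onW_left htl) (not_forb_of_ne (by simp))
          · intro s hs
            rcases List.mem_cons.mp hs with rfl | hs
            · simp
            · have := hQ2 s hs
              omega
          · intro s hs
            rcases List.mem_cons.mp hs with rfl | hs
            · simp only
              omega
            · exact hQ3 s hs
          · intro s hs
            rcases List.mem_cons.mp hs with rfl | hs
            · simp only
              omega
            · exact hQ4 s hs
          · intro h'
            obtain ⟨s, hs, h''⟩ := hQ5 (by omega)
            exact ⟨s, List.mem_cons_of_mem _ hs, h''⟩
        · refine ⟨Q, ?_, hQ1, fun s hs => by have := hQ2 s hs; omega, hQ3, hQ4, fun h' =>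
            hQ5 (by omega)⟩
          rw [arrangement_succ_of_ne htl e1 h.1]
          exact .skipUp hw htl (not_onW e1 h.1) hQ
  obtain ⟨Q, hQ, hQ1, -, hQ3⟩ := key i.length hj le_rfl
  rw [upPos_length, hi.arrangement_length (by omega) (by omega),
    show m + 1 - (m + 1 - k) = k by omega] at hQ
  exact ⟨Q, hQ, hQ1, hQ3⟩

end IsLongestReducedWord

namespace Wiring

/-- The path `P` runs along the wire `w`. -/
def Uses (w : ℕ) (P : List Step) : Prop := ∃ s ∈ P, s.inW = w ∨ s.outW = w

/-- The path leaves the wire `ℓ_1` exactly once, at the node `t`, for a wire which is oriented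
downward, and it goes down only at the nodes where both wires are oriented downward. -/
structure LeavesAt (i : List ℕ) (k : ℕ) (P : List Step) (t : ℕ) : Prop where
  leaves : ∃ s ∈ P, s.node = t ∧ s.inW = 1 ∧ s.outW ≠ 1
  eq_of_leaves : ∀ s ∈ P, s.inW = 1 → s.outW ≠ 1 → s.node = t
  down : ∀ s ∈ P, k < s.inW → ∀ q, OnW i s.node q → k < q
  out : ∀ s ∈ P, s.inW = 1 → s.outW = 1 ∨ k < s.outW

theorem LeavesAt.unique {i : List ℕ} {k t t' : ℕ} {P : List Step} (h : LeavesAt i k P t)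
    (h' : LeavesAt i k P t') : t = t' := by
  obtain ⟨s, hs, h1, h2, h3⟩ := h.leaves
  exact h1.symm.trans (h'.eq_of_leaves s hs h2 h3)

end Wiring

namespace IsLongestReducedWord

open Wiring

variable {m : ℕ} {i : List ℕ} (hi : IsLongestReducedWord m i)

include hi

theorem wires_of_lt_upPos {k : ℕ} (h1 : 1 ≤ k) (h2 : k ≤ m) {t q : ℕ}
    (h : col i t + 1 < upPos m i k (t + 1)) (hq : OnW i t q) : k < q := by
  obtain ⟨ht, hq⟩ := hq
  have hc := hi.col_bounds ht
  rw [← arrangement_succ_right ht, ← arrangement_succ_left ht] at hq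
  rcases hq with rfl | rfl
  · exact hi.lt_arrangement h1 h2 ht (by omega) h
  · exact hi.lt_arrangement h1 h2 (j := t + 1) ht (x := col i t) (by omega) (by omega)

/-- The path which goes up along `upPos`, turns at the node `t`, and goes down along `D`. -/
theorem exists_turning_path {k : ℕ} (h1 : 1 ≤ k) (h2 : k < m) {t : ℕ} (ht : t < i.length)
    (hz : upPos m i k (t + 1) = col i t + 1) {D : List Step}
    (hD : Walk i k (t + 1) (arrangement i (t + 1) (col i t)) D) (hD' : DownRun m i k (t + 1) D) :
    ∃ Q, NPath i k (Q ++ ⟨t, arrangement i t (col i t), arrangement i t (col i t + 1)⟩ :: D) ∧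
      (arrangement i t (col i t) ≤ k ∧ k < arrangement i t (col i t + 1)) ∧
      (∀ s ∈ Q, s.inW ≤ k ∧ s.outW ≤ k) ∧ (∀ s ∈ Q, s.inW = 1 → s.outW = 1) ∧
      (upPos m i k (t + 1) < upPos m i k i.length → ∃ s ∈ Q, ∃ q, OnW i s.node q ∧ k < q) := by
  have hc := hi.col_bounds ht
  have hl := arrangement_succ_left ht
  have hr := arrangement_succ_right ht
  have ha := hi.arrangement_upPos_le h1 h2.le (j := t + 1) ht
  have hb := hi.lt_arrangement h1 h2.le (j := t + 1) ht hc.1 (by omega)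
  have hz' := hz
  rw [hz, hr] at ha
  rw [hl] at hD hb
  have hp := hD.peak ha hb (onW_left ht) (onW_right ht)
  rw [← hr, ← hz] at hp
  obtain ⟨Q, hQ, hQ1, hQ2, hQ3, hQ4⟩ := hi.exists_up h1 h2 ht hp
  rw [hz, hr] at hQ
  refine ⟨Q, hQ.nPath ?_, ⟨ha, hb⟩, fun s hs => (hQ1.1 s hs).2, hQ3, hQ4⟩
  rw [List.map_append, List.map_cons, List.nodup_append, List.nodup_cons]
  refine ⟨nodup_of_pairwise_gt hQ1.2, ⟨?_, nodup_of_pairwise_lt hD'.2⟩, ?_⟩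
  · simp only [List.mem_map, not_exists, not_and]
    intro s hs hst
    have := (hD'.1 s hs).1
    omega
  · rintro _ hx _ hy rfl
    obtain ⟨s, hs, rfl⟩ := List.mem_map.mp hx
    have e1 := (hQ1.1 s hs).1
    have e2 := hQ2 s hs
    rcases List.mem_cons.mp hy with hy | hy
    · simp only at hy
      omega
    · obtain ⟨u, hu, hus⟩ := List.mem_map.mp hy
      have e3 := (hD'.1 u hu).2.2.2
      rw [hus] at e3
      omega

theorem exists_leavesAt {p : ℕ} (hp : 1 ≤ p) (hpm : p < m) :
    ∃ t k P, col i t = p ∧ (k, P) ∈ paths m i ∧ LeavesAt i k P t := by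
  have hm : 1 ≤ m := by omega
  obtain ⟨t, -, ht, ht1, ht2⟩ := exists_step_of_not (p := fun j => upPos m i 1 j ≤ p)
    (Nat.zero_le i.length) (by rw [hi.upPos_zero le_rfl hm]; exact hp)
    (by rw [upPos_length]; omega)
  have hst : upPos m i 1 (t + 1) = col i t + 1 ∧ upPos m i 1 t = col i t := by
    rcases upPos_step m 1 ht with h | h
    · exact h
    · omega
  have hcp : col i t = p := by omega
  obtain ⟨k, hk1, hk2, hk3, hk4⟩ := exists_step_of_not (p := fun k => p + 1 ≤ upPos m i k (t + 1))
    hm (by omega) (by rw [hi.upPos_eq_one (by omega)]; omega)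
  have hk5 := upPos_anti m hk1 (i := i) (j := t + 1) ht
  have hz : upPos m i k (t + 1) = col i t + 1 := by omega
  obtain ⟨D, hD, hD'⟩ := hi.exists_down_right hk1 hk2 (j := t + 1) ht (col i t) (by omega) (by omega)
  obtain ⟨Q, hP, ⟨ha, hb⟩, hQ1, hQ2, -⟩ := hi.exists_turning_path hk1 hk2 ht hz hD hD'
  have hone : arrangement i t (col i t) = 1 := by
    rw [← hst.2]
    exact hi.arrangement_upPos_one hm ht.le
  refine ⟨t, k, _, hcp, ⟨hk1, hk2, hP⟩, ?_, ?_, ?_, ?_⟩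
  · exact ⟨_, List.mem_append_right _ List.mem_cons_self, rfl, hone, by simp only; omega⟩
  · intro s hs h3 h4
    rcases List.mem_append.mp hs with hs | hs
    · exact absurd (hQ2 s hs h3) h4
    · rcases List.mem_cons.mp hs with rfl | hs
      · rfl
      · have := (hD'.1 s hs).2.1
        omega
  · intro s hs h3 q hq
    rcases List.mem_append.mp hs with hs | hs
    · have := hQ1 s hs
      omega
    · rcases List.mem_cons.mp hs with rfl | hs
      · simp only at h3
        omega
      · exact hi.wires_of_lt_upPos hk1 hk2.le (hD'.1 s hs).2.2.2 hq
  · intro s hs h3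
    rcases List.mem_append.mp hs with hs | hs
    · exact Or.inl (hQ2 s hs h3)
    · rcases List.mem_cons.mp hs with rfl | hs
      · exact Or.inr hb
      · have := (hD'.1 s hs).2.1
        omega

/-- There are at least `m - 1` rigorous paths which run along the first wire, and more if there is
an exceptional one. -/
theorem le_ncard_uses_one :
    m - 1 ≤ {p ∈ paths m i | Uses 1 p.2}.ncard ∧
    ((∃ p ∈ paths m i, Uses 1 p.2 ∧ ∀ t, ¬ LeavesAt i p.1 p.2 t) →
      m - 1 < {p ∈ paths m i | Uses 1 p.2}.ncard) := by
  classical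
  have hfin : {p ∈ paths m i | Uses 1 p.2}.Finite := (finite_paths m i).subset fun p hp => hp.1
  have hex : ∀ p ∈ Finset.Icc 1 (m - 1), ∃ x : ℕ × List Step, ∃ t,
      col i t = p ∧ x ∈ paths m i ∧ LeavesAt i x.1 x.2 t := by
    intro p hp
    rw [Finset.mem_Icc] at hp
    obtain ⟨t, k, P, h⟩ := hi.exists_leavesAt hp.1 (by omega)
    exact ⟨(k, P), t, h⟩
  choose! f t hf using hex
  have hinj : Set.InjOn f (Finset.Icc 1 (m - 1)) := by
    intro p hp q hq hpq
    have h1 := hf p hp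
    have h2 := hf q hq
    rw [hpq] at h1
    have := h1.2.2.unique h2.2.2
    rw [← h1.1, ← h2.1, this]
  set S : Finset (ℕ × List Step) := (Finset.Icc 1 (m - 1)).image f with hS
  have hScard : S.card = m - 1 := by
    rw [hS, Finset.card_image_of_injOn hinj]
    simp
  have hSsub : (S : Set (ℕ × List Step)) ⊆ {p ∈ paths m i | Uses 1 p.2} := by
    intro x hx
    rw [hS, Finset.coe_image] at hx
    obtain ⟨p, hp, rfl⟩ := hx
    have := hf p hp
    obtain ⟨s, hs, -, h, -⟩ := this.2.2.leaves
    exact ⟨this.2.1, s, hs, Or.inl h⟩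
  refine ⟨?_, ?_⟩
  · rw [← hScard, ← Set.ncard_coe_finset]
    exact Set.ncard_le_ncard hSsub hfin
  · rintro ⟨x, hx, hx1, hx2⟩
    rw [← hScard, ← Set.ncard_coe_finset]
    refine Set.ncard_lt_ncard ⟨hSsub, fun h => ?_⟩ hfin
    have hxS := h ⟨hx, hx1⟩
    rw [hS, Finset.coe_image] at hxS
    obtain ⟨p, hp, rfl⟩ := hxS
    exact hx2 _ (hf p hp).2.2

theorem onW_one (hm : 1 ≤ m) {t : ℕ} (h : OnW i t 1) :
    upPos m i 1 t = col i t ∧ upPos m i 1 (t + 1) = col i t + 1 := by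
  have ht := h.1
  have hc := hi.col_bounds ht
  have h0 := hi.arrangement_upPos_one hm ht.le
  have h1 := hi.arrangement_upPos_one hm (j := t + 1) ht
  have hl : arrangement i t (col i t) = 1 := by
    have := hi.arrangement_lt ht
    have := hi.arrangement_bounds ht.le hc.1 hc.2.le
    rcases h.2 with h | h <;> omega
  exact ⟨(arrangement i t).injective (h0.trans hl.symm),
    (arrangement i (t + 1)).injective (h1.trans (hl.symm.trans (arrangement_succ_right ht).symm))⟩

theorem onW_last {t : ℕ} (h : OnW i t m) : arrangement i t (col i t + 1) = m := by
  have ht := h.1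
  have hc := hi.col_bounds ht
  have := hi.arrangement_lt ht
  have := hi.arrangement_bounds ht.le (x := col i t + 1) (by omega) (by omega)
  rcases h.2 with h | h <;> omega

/-- A path through a node on the last wire, below the first wire, which is not the lowest one in
its column. -/
theorem exists_path_of_not_lowest {t t' : ℕ} (ht : OnW i t m) (htt' : t < t')
    (ht' : t' < i.length) (hcol : col i t' = col i t) (hz : col i t + 1 ≤ upPos m i 1 (t + 1)) :
    ∃ k P, (k, P) ∈ paths m i ∧ Uses m P ∧
      ((∃ s ∈ P, s.outW ≤ k ∧ ∃ q, OnW i s.node q ∧ k < q) ∨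
        ∃ s ∈ P, s.outW = m ∧ k < s.inW ∧ s.inW ≠ m) := by
  have hlast := hi.onW_last ht
  replace ht := ht.1
  have hc := hi.col_bounds ht
  obtain ⟨k, hk1, hk2, hk3, hk4⟩ := exists_step_of_not
    (p := fun k => col i t + 1 ≤ upPos m i k (t + 1))
    (show 1 ≤ m by omega) hz (by rw [hi.upPos_eq_one (by omega)]; omega)
  obtain ⟨D, hD, hD'⟩ := hi.exists_down_right hk1 hk2 (j := t + 1) ht (col i t) (by omega) (by omega)
  obtain ⟨t₀, -, ht₀, h3, h4⟩ := exists_step_of_not (p := fun j => upPos m i k j ≤ col i t)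
    (Nat.zero_le (t + 1)) (by rw [hi.upPos_zero hk1 hk2.le]; exact hc.1) (by omega)
  have ht₀l : t₀ < i.length := by omega
  have hst : upPos m i k (t₀ + 1) = col i t₀ + 1 ∧ upPos m i k t₀ = col i t₀ := by
    rcases upPos_step m k ht₀l with h | h
    · exact h
    · omega
  have hc₀ : col i t₀ = col i t := by omega
  by_cases h0 : t₀ = t
  · subst h0
    obtain ⟨Q, hP, ⟨ha, hb⟩, hQ1, -, hQ2⟩ := hi.exists_turning_path hk1 hk2 ht hst.1 hD hD'
    refine ⟨k, _, ⟨hk1, hk2, hP⟩, ⟨_, List.mem_append_right _ List.mem_cons_self, Or.inr hlast⟩,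
      Or.inl ?_⟩
    have hlt : upPos m i k (t₀ + 1) < upPos m i k i.length := by
      have e1 := upPos_mono m k (i := i) (j := t₀ + 1) (j' := t') htt' ht'.le
      have e2 := upPos_mono m k (i := i) (j := t' + 1) (j' := i.length) ht' le_rfl
      rcases upPos_step m k ht' with h | h <;> omega
    obtain ⟨s, hs, q, hq⟩ := hQ2 hlt
    exact ⟨s, List.mem_append_left _ hs, (hQ1 s hs).2, q, hq⟩
  · have e1 := upPos_mono m k (i := i) (j := t₀ + 1) (j' := t) (by omega) ht.le
    have hzt : col i t + 1 < upPos m i k (t + 1) := by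
      rcases upPos_step m k ht with h | h <;> omega
    have hin := hi.lt_arrangement hk1 hk2.le ht.le (x := col i t) hc.1 (by omega)
    have hlt := hi.arrangement_lt ht
    rw [arrangement_succ_left ht, hlast] at hD
    have hD1 := hD.down hin hk2 (onW_left ht) (by rw [← hlast]; exact onW_right ht)
      (not_forb_of_ne (by simp only; omega))
    obtain ⟨R, hR, hR'⟩ := hi.exists_const_down hk1 hk2 (j₀ := t₀ + 1) (by omega) ht.le hc.1
      (fun j hj hj' => by
        have := upPos_mono m k (i := i) (j := t₀ + 1) (j' := j) hj (by omega)
        omega) hD1 (hD'.cons hin hk2 hzt)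
    have hR₀ : Walk i k (t₀ + 1) (arrangement i (t₀ + 1) (col i t₀))
        (R ++ ⟨t, arrangement i t (col i t), m⟩ :: D) := by
      rw [hc₀]
      exact hR
    obtain ⟨Q, hP, -⟩ := hi.exists_turning_path hk1 hk2 ht₀l hst.1 hR₀ hR'
    have hmem : (⟨t, arrangement i t (col i t), m⟩ : Step) ∈
        Q ++ ⟨t₀, arrangement i t₀ (col i t₀), arrangement i t₀ (col i t₀ + 1)⟩ ::
          (R ++ ⟨t, arrangement i t (col i t), m⟩ :: D) := by simp
    exact ⟨k, _, ⟨hk1, hk2, hP⟩, ⟨_, hmem, Or.inr rfl⟩, Or.inr ⟨_, hmem, rfl, hin, by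
      simp only
      omega⟩⟩

end IsLongestReducedWord

namespace IsLongestReducedWord

open Wiring

variable {m : ℕ} {i : List ℕ} (hi : IsLongestReducedWord m i)

include hi

theorem arrangement_le_of_col_ne {k c a b : ℕ} (hb : b ≤ i.length)
    (hcol : ∀ t, a ≤ t → t < b → col i t ≠ c)
    (hbase : ∀ x, c < x → x ≤ m → arrangement i b x ≤ k) :
    ∀ j, a ≤ j → j ≤ b → ∀ x, c < x → x ≤ m → arrangement i j x ≤ k := by
  refine decreasing_induction hbase fun t h1 h2 ih x hx hx' => ?_
  have ht : t < i.length := by omega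
  have hc := hi.col_bounds ht
  have hne := hcol t h1 h2
  by_cases e1 : x = col i t
  · subst e1
    rw [← arrangement_succ_right ht]
    exact ih _ (by omega) (by omega)
  · by_cases e2 : x = col i t + 1
    · subst e2
      rw [← arrangement_succ_left ht]
      exact ih _ (by omega) (by omega)
    · rw [← arrangement_succ_of_ne ht e1 e2]
      exact ih x hx hx'

/-- If the crossing of the first wire and the last one is the lowest node in an interior column,
then some path goes down along the last wire to this node and then up along the first wire. -/
theorem exists_path_of_lowest {p τ : ℕ} (hτ : τ < i.length) (hcol : col i τ = p)
    (hone : OnW i τ 1) (hlast : OnW i τ m) (hp : 1 < p) (hpm : p + 1 < m)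
    (hlow : ∀ t, τ < t → t < i.length → col i t ≠ p) :
    ∃ k P, (k, P) ∈ paths m i ∧ Uses 1 P ∧ ∃ s ∈ P, k < s.inW ∧ ∃ q, OnW i s.node q ∧ q ≤ k := by
  subst hcol
  set p := col i τ with hpdef
  have hm : 1 ≤ m := by omega
  obtain ⟨k, hk⟩ : ∃ k, k = m - p := ⟨_, rfl⟩
  have hk1 : 1 ≤ k := by omega
  have hk2 : k < m := by omega
  obtain ⟨hZτ, hZτ'⟩ := hi.onW_one hm hone
  have hXm := hi.onW_last hlast
  -- the positions `upPos m i k` below the crossing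
  have hZ : ∀ j, τ + 1 ≤ j → j ≤ i.length → upPos m i k j = p + 1 := by
    refine decreasing_induction (by rw [upPos_length]; omega) fun t h1 h2 ih => ?_
    have := hlow t (by omega) h2
    rcases upPos_step m k h2 with h | h <;> omega
  -- the next node on the first wire
  obtain ⟨τ₁, hτ₁, hτ₁l, h3, h4⟩ := exists_step_of_not (p := fun j => upPos m i 1 j ≤ p + 1)
    (show τ + 1 ≤ i.length from hτ) (by omega) (by rw [upPos_length]; omega)
  have hst₁ : upPos m i 1 (τ₁ + 1) = col i τ₁ + 1 ∧ upPos m i 1 τ₁ = col i τ₁ := by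
    rcases upPos_step m 1 hτ₁l with h | h
    · exact h
    · omega
  have hc₁ : col i τ₁ = p + 1 := by
    have := upPos_mono m 1 hτ₁ hτ₁l.le
    omega
  have hone₁ : arrangement i τ₁ (p + 1) = 1 := by
    rw [← hc₁, ← hst₁.2]
    exact hi.arrangement_upPos_one hm hτ₁l.le
  have hcolA : ∀ t, τ < t → t < τ₁ → col i t ≠ p + 1 := by
    intro t h5 h6 h7
    have e1 := upPos_mono m 1 (i := i) (j := τ + 1) (j' := t) h5 (by omega)
    have e2 := upPos_mono m 1 (i := i) (j := t) (j' := τ₁) h6.le (by omega)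
    have e3 : OnW i t 1 := by
      have := onW_left (i := i) (t := t) (by omega)
      rwa [h7, show p + 1 = upPos m i 1 t by omega, hi.arrangement_upPos_one hm (by omega)] at this
    have e4 := (hi.onW_one hm e3).2
    have e5 := upPos_mono m 1 (i := i) (j := t + 1) (j' := τ₁) h6 (by omega)
    omega
  -- the previous node on the last wire
  obtain ⟨τ₂, -, hτ₂, ⟨j₂, h5, h6, h7⟩, h8⟩ := exists_step_of_not
    (p := fun j => ∃ j', j ≤ j' ∧ j' ≤ τ ∧ arrangement i j' (p + 1) ≠ m) (Nat.zero_le τ)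
    ⟨0, le_rfl, Nat.zero_le _, by rw [arrangement_zero, Equiv.Perm.one_apply]; omega⟩
    (by
      rintro ⟨j', h5, h6, h7⟩
      obtain rfl : j' = τ := by omega
      exact h7 hXm)
  push Not at h8
  have hj₂ : j₂ = τ₂ := by
    by_contra hne
    exact h7 (h8 j₂ (by omega) h6)
  subst hj₂
  have hj₂l : j₂ < i.length := by omega
  have hnext := h8 (j₂ + 1) le_rfl (by omega)
  have hc₂ : col i j₂ = p + 1 := by
    by_contra hne
    by_cases hcp : p = col i j₂
    · have e1 := hi.arrangement_lt hj₂l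
      have e2 := hi.arrangement_bounds hj₂l.le (x := p + 1) (by omega) (by omega)
      rw [hcp, arrangement_succ_right hj₂l] at hnext
      rw [← hcp] at e1 hnext
      omega
    · rw [arrangement_succ_of_ne hj₂l (by omega) (by omega)] at hnext
      exact h7 hnext
  have hlast₂ : arrangement i j₂ (p + 1 + 1) = m := by
    rw [← hc₂] at hnext ⊢
    rw [← arrangement_succ_left hj₂l, hnext]
  have hcolB : ∀ t, j₂ < t → t < τ → col i t ≠ p ∧ col i t ≠ p + 1 := by
    intro t e1 e2
    have e3 := h8 t e1 e2.le
    have e4 := h8 (t + 1) (by omega) e2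
    constructor
    · intro h
      rw [← h, arrangement_succ_right (by omega), ← e3] at e4
      have := (arrangement i t).injective e4
      omega
    · intro h
      rw [← h, arrangement_succ_left (by omega), ← e3] at e4
      have := (arrangement i t).injective e4
      omega
  -- the wires on the right
  have hA := hi.arrangement_le_of_col_ne (k := k) (c := p) (a := τ + 1) le_rfl
    (fun t h h' => hlow t h h') fun x hx hx' => by
      rw [hi.arrangement_length (by omega) hx']
      omega
  have hB := hi.arrangement_le_of_col_ne (k := k) (c := p + 1) (a := j₂ + 1) (b := τ₁) hτ₁l.le
    (fun t h h' => by
      rcases lt_trichotomy t τ with e | e | e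
      · exact (hcolB t h e).2
      · rw [e]
        omega
      · exact hcolA t e h')
    (fun x hx hx' => hA τ₁ hτ₁ hτ₁l.le x (by omega) hx')
  -- the previous node on the first wire
  obtain ⟨τ₃, -, hτ₃, h9, h10⟩ := exists_step_of_not (p := fun j => upPos m i 1 j ≤ p - 1)
    (Nat.zero_le τ) (by rw [hi.upPos_zero le_rfl hm]; omega) (by omega)
  have hτ₃l : τ₃ < i.length := by omega
  have hst₃ : upPos m i 1 (τ₃ + 1) = col i τ₃ + 1 ∧ upPos m i 1 τ₃ = col i τ₃ := by
    rcases upPos_step m 1 hτ₃l with h | h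
    · exact h
    · omega
  have hmono₃ := upPos_mono m 1 (i := i) (j := τ₃ + 1) (j' := τ) hτ₃ hτ.le
  have hc₃ : col i τ₃ + 1 = p := by omega
  have hone₃ : arrangement i τ₃ (col i τ₃) = 1 := by
    rw [← hst₃.2]
    exact hi.arrangement_upPos_one hm hτ₃l.le
  have hno₁ : ∀ t, OnW i t 1 → ¬ (τ₃ + 1 ≤ t ∧ t < τ) := by
    rintro t ht ⟨e1, e2⟩
    have e3 := hi.onW_one hm ht
    have e4 := upPos_mono m 1 (i := i) e1 (by omega)
    have e5 := upPos_mono m 1 (i := i) (j := t + 1) (j' := τ) e2 hτ.le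
    omega
  have hZ₃ : upPos m i k (τ₃ + 1) = p := by
    refine decreasing_induction (p := fun j => upPos m i k j = p) (a := τ₃ + 1) (b := τ) ?_
      (fun t e1 e2 ih => ?_) _ le_rfl hτ₃
    · have := hZ (τ + 1) le_rfl hτ
      rcases upPos_step m k hτ with h | h <;> omega
    · rcases upPos_step m k (i := i) (t := t) (by omega) with h | h
      · exfalso
        have e4 := upPos_mono m 1 (i := i) (j := τ₃ + 1) (j' := t + 1) (by omega) (by omega)
        have e5 := upPos_mono m 1 (i := i) (j := t + 1) (j' := τ) e2 hτ.le
        have e6 := hi.arrangement_upPos_one hm (j := t + 1) (by omega)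
        rw [show upPos m i 1 (t + 1) = col i t + 1 by omega,
          arrangement_succ_right (by omega)] at e6
        have e7 := onW_left (i := i) (t := t) (by omega)
        rw [e6] at e7
        exact hno₁ t e7 ⟨e1, e2⟩
      · omega
  have hZ₃' : upPos m i (k + 1) (τ₃ + 1) ≤ col i τ₃ := by
    by_contra hcon
    have e1 := upPos_mono m (k + 1) (i := i) (j := τ₃ + 1) (j' := τ + 1) (by omega) hτ
    have e2 := upPos_mono m (k + 1) (i := i) (j := τ + 1) (j' := i.length) hτ le_rfl
    rw [upPos_length] at e2
    have e3 := hi.arrangement_upPos_le (k := k + 1) (by omega) hk2 (j := τ + 1) hτ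
    rw [show upPos m i (k + 1) (τ + 1) = col i τ by omega, arrangement_succ_left hτ, hXm] at e3
    omega
  -- assembling the path
  obtain ⟨D, hD, hD'⟩ := hi.exists_down_right hk1 hk2 (j := τ₃ + 1) hτ₃l (col i τ₃) hZ₃' (by omega)
  have hq := hi.lt_arrangement hk1 hk2.le (j := τ₃ + 1) hτ₃l (x := col i τ₃)
    (hi.col_bounds hτ₃l).1 (by omega)
  rw [arrangement_succ_left hτ₃l] at hD hq
  have W1 := ((hD.peak hk1 hq (hone₃ ▸ onW_left hτ₃l) (onW_right hτ₃l)).skip_up hk1 hτ₃ hτ.le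
    hno₁).valley hk2 hk1 hlast hone
  have W2 := W1.skip_down (j := j₂ + 1) hk2 hτ₂ hτ.le (by
    rintro t ht ⟨e1, e2⟩
    have e3 := hcolB t e1 e2
    rw [← h8 t e1 e2.le] at ht
    exact not_onW (by omega) (by omega) ht)
  have ha := hB (j₂ + 1) le_rfl (by omega) (p + 1 + 1) (by omega) (by omega)
  have W3 := W2.peak ha hk2 (by
    rw [← hc₂, arrangement_succ_right hj₂l]
    exact onW_left hj₂l) (by
    rw [← hlast₂, ← hc₂]
    exact onW_right hj₂l)
  obtain ⟨Q₁, W4, hQ₁, hQ₁'⟩ := exists_const_up (j₁ := τ₁) (by omega) hτ₁l.le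
    (fun j e1 e2 => hB j e1 e2 _ (by omega) (by omega)) (fun t e1 e2 => by
      rcases lt_trichotomy t τ with e | e | e
      · have := hcolB t e1 e
        omega
      · rw [e]
        omega
      · have := hcolA t e e2
        omega) W3
  have hb := hB τ₁ (by omega) le_rfl (p + 1 + 1) (by omega) (by omega)
  have hOn : OnW i τ₁ (arrangement i τ₁ (p + 1 + 1)) := by
    rw [← hc₁]
    exact onW_right hτ₁l
  have hgt : 1 < arrangement i τ₁ (p + 1 + 1) := by
    have := hi.arrangement_lt hτ₁l
    rw [hc₁] at this
    omega
  have W5 := W4.up hb hb hOn hOn (by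
    rintro ⟨-, q, ⟨-, hq⟩, h | h⟩
    · simp only at h
      omega
    · simp only at hq h
      rw [hc₁] at hq
      omega)
  have hpos : arrangement i τ₁ (p + 1 + 1) = arrangement i (τ₁ + 1) (upPos m i k (τ₁ + 1)) := by
    rw [hZ (τ₁ + 1) (by omega) hτ₁l, ← hc₁, arrangement_succ_left hτ₁l]
  rw [hpos] at W5
  obtain ⟨Q₂, W6, hQ₂, hQ₂', -⟩ := hi.exists_up hk1 hk2 hτ₁l W5
  have hQ₂c : ∀ s ∈ Q₂, p < col i s.node := by
    intro s hs
    have e1 := hQ₂' s hs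
    have e2 := (hQ₂.1 s hs).1
    have e3 := (W6.onW s (List.mem_append_left _ hs)).1.1
    have e4 := hlow s.node (by omega) e3
    rw [hZ _ (by omega) e3] at e1
    omega
  have hDc : ∀ s ∈ D, col i s.node < p := by
    intro s hs
    have e1 := (hD'.1 s hs).2.2.2
    have e3 := (hD.onW s hs).1.1
    have e4 := upPos_mono m k (i := i) (j := s.node + 1) (j' := i.length) e3 le_rfl
    rw [hZ i.length hτ le_rfl] at e4
    omega
  refine ⟨k, _, ⟨hk1, hk2, W6.nPath ?_⟩, ?_, ?_⟩
  · simp only [List.map_append, List.map_cons, List.nodup_append, List.nodup_cons, List.mem_cons,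
      List.mem_append, List.mem_map, not_or, not_exists, not_and]
    have hne : ∀ {t t' : ℕ}, col i t ≠ col i t' → t ≠ t' := fun h h' => h (by rw [h'])
    refine ⟨nodup_of_pairwise_gt hQ₂.2, ⟨⟨fun s hs => ?_, ?_, ?_, ?_, fun s hs => ?_⟩,
      nodup_of_pairwise_gt hQ₁.2, ⟨⟨?_, ?_, fun s hs => ?_⟩, ⟨?_, fun s hs => ?_⟩,
        fun s hs => ?_, nodup_of_pairwise_lt hD'.2⟩, ?_⟩, ?_⟩
    · have := (hQ₁' s hs).1
      omega
    · omega
    · exact hne (by omega)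
    · exact hne (by omega)
    · exact hne (by have := hDc s hs; omega)
    · exact hne (by omega)
    · exact hne (by omega)
    · exact hne (by have := hDc s hs; omega)
    · exact hne (by omega)
    · exact hne (by have := hDc s hs; omega)
    · have := (hD'.1 s hs).1
      omega
    · rintro _ ⟨s, hs, rfl⟩ b hb'
      have e1 := (hQ₁' s hs).2
      rcases hb' with rfl | rfl | rfl | ⟨u, hu, rfl⟩
      · exact hne (by omega)
      · exact hne (by omega)
      · exact hne (by omega)
      · exact hne (by have := hDc u hu; omega)
    · rintro _ ⟨s, hs, rfl⟩ b hb'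
      have e1 := (hQ₂.1 s hs).1
      have e2 := hQ₂c s hs
      rcases hb' with rfl | ⟨u, hu, rfl⟩ | rfl | rfl | rfl | ⟨u, hu, rfl⟩
      · omega
      · have := (hQ₁' u hu).1
        omega
      · omega
      · omega
      · omega
      · exact hne (by have := hDc u hu; omega)
  · exact ⟨⟨τ₃, 1, arrangement i τ₃ (col i τ₃ + 1)⟩, by simp, Or.inl rfl⟩
  · exact ⟨⟨τ, m, 1⟩, by simp, hk2, 1, hone, hk1⟩

end IsLongestReducedWord

namespace Wiring

/-- The letters of the word lie in `{1, …, m - 1}`. -/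
def Letters (m : ℕ) (i : List ℕ) : Prop := ∀ a ∈ i, 1 ≤ a ∧ a < m

/-- The mirror image of a word. -/
def mirror (m : ℕ) (i : List ℕ) : List ℕ := i.map fun a => m - a

/-- The mirror image of a step, in the opposite direction. -/
def Step.mirror (m : ℕ) (s : Step) : Step := ⟨s.node, m + 1 - s.outW, m + 1 - s.inW⟩

/-- The mirror image of a path, in the opposite direction. -/
def mirrorPath (m : ℕ) (p : ℕ × List Step) : ℕ × List Step :=
  (m - p.1, (p.2.map (Step.mirror m)).reverse)

section

variable {m : ℕ} {i : List ℕ}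

theorem length_mirror (m : ℕ) (i : List ℕ) : (mirror m i).length = i.length := by simp [mirror]

theorem col_mirror {t : ℕ} (ht : t < i.length) : col (mirror m i) t = m - col i t := by
  simp [col, mirror, ht]

theorem Letters.mirror (h : Letters m i) : Letters m (mirror m i) := by
  intro a ha
  obtain ⟨b, hb, rfl⟩ := List.mem_map.mp ha
  have := h b hb
  omega

theorem Letters.mirror_mirror (h : Letters m i) : Wiring.mirror m (Wiring.mirror m i) = i := by
  rw [Wiring.mirror, Wiring.mirror, List.map_map]
  conv_rhs => rw [← List.map_id i]
  refine List.map_congr_left fun a ha => ?_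
  have := h a ha
  simp only [Function.comp_apply, id]
  omega

theorem Letters.col_bounds (h : Letters m i) {t : ℕ} (ht : t < i.length) :
    1 ≤ col i t ∧ col i t < m := by
  have := h i[t] (List.getElem_mem ht)
  simpa [col, ht] using this

theorem Letters.arrangement_bounds (h : Letters m i) {j : ℕ} (hj : j ≤ i.length) :
    ∀ x, 1 ≤ x → x ≤ m → 1 ≤ arrangement i j x ∧ arrangement i j x ≤ m := by
  induction j with
  | zero =>
    intro x h1 h2
    simpa [arrangement_zero] using ⟨h1, h2⟩
  | succ t ih =>
    intro x h1 h2
    have ht : t < i.length := by omega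
    have hc := h.col_bounds ht
    by_cases e1 : x = col i t
    · subst e1
      rw [arrangement_succ_left ht]
      exact ih (by omega) _ (by omega) (by omega)
    · by_cases e2 : x = col i t + 1
      · subst e2
        rw [arrangement_succ_right ht]
        exact ih (by omega) _ (by omega) (by omega)
      · rw [arrangement_succ_of_ne ht e1 e2]
        exact ih (by omega) x h1 h2

theorem Letters.onW_bounds (h : Letters m i) {t r : ℕ} (hr : OnW i t r) : 1 ≤ r ∧ r ≤ m := by
  have hc := h.col_bounds hr.1
  rcases hr.2 with e | e
  · rw [e]
    exact h.arrangement_bounds hr.1.le _ (by omega) (by omega)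
  · rw [e]
    exact h.arrangement_bounds hr.1.le _ (by omega) (by omega)

theorem Letters.arrangement_mirror (h : Letters m i) {j : ℕ} (hj : j ≤ i.length) :
    ∀ x, 1 ≤ x → x ≤ m →
      arrangement (Wiring.mirror m i) j x = m + 1 - arrangement i j (m + 1 - x) := by
  induction j with
  | zero =>
    intro x h1 h2
    simp only [arrangement_zero, Equiv.Perm.one_apply]
    omega
  | succ t ih =>
    intro x h1 h2
    have ht : t < i.length := by omega
    have ht' : t < (Wiring.mirror m i).length := by rwa [length_mirror]
    have hc := h.col_bounds ht
    have hm := col_mirror (m := m) ht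
    by_cases e1 : x = m - col i t
    · rw [e1, ← hm, arrangement_succ_left ht', hm, ih (by omega) _ (by omega) (by omega),
        show m + 1 - (m - col i t + 1) = col i t by omega,
        show m + 1 - (m - col i t) = col i t + 1 by omega, arrangement_succ_right ht]
    · by_cases e2 : x = m - col i t + 1
      · rw [e2, ← hm, arrangement_succ_right ht', hm, ih (by omega) _ (by omega) (by omega),
          show m + 1 - (m - col i t + 1) = col i t by omega,
          show m + 1 - (m - col i t) = col i t + 1 by omega, arrangement_succ_left ht]
      · rw [arrangement_succ_of_ne ht' (by omega) (by omega),
          arrangement_succ_of_ne ht (by omega) (by omega), ih (by omega) x h1 h2]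

theorem Letters.onW_mirror (h : Letters m i) {t r : ℕ} (hr : OnW i t r) :
    OnW (Wiring.mirror m i) t (m + 1 - r) := by
  have ht := hr.1
  have hc := h.col_bounds ht
  refine ⟨by rw [length_mirror]; exact ht, ?_⟩
  rw [col_mirror ht, h.arrangement_mirror ht.le _ (by omega) (by omega),
    h.arrangement_mirror ht.le _ (by omega) (by omega),
    show m + 1 - (m - col i t + 1) = col i t by omega,
    show m + 1 - (m - col i t) = col i t + 1 by omega]
  rcases hr.2 with e | e
  · exact Or.inr (by rw [e])
  · exact Or.inl (by rw [e])

theorem Letters.onW_of_mirror (h : Letters m i) {t r : ℕ} (hr : OnW (Wiring.mirror m i) t r) :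
    OnW i t (m + 1 - r) := by
  have := h.mirror.onW_mirror hr
  rwa [h.mirror_mirror] at this

theorem Letters.lowest_mirror (h : Letters m i) {t r : ℕ} (hr : Lowest i r t) :
    Lowest (Wiring.mirror m i) (m + 1 - r) t := by
  refine ⟨h.onW_mirror hr.1, fun t' ht' => hr.2 t' ?_⟩
  have hb := h.onW_bounds hr.1
  have := h.onW_of_mirror ht'
  rwa [show m + 1 - (m + 1 - r) = r by omega] at this

theorem Letters.next_mirror (h : Letters m i) {k r t t' : ℕ} (hk : k < m)
    (hr : Next i k r t t') : Next (Wiring.mirror m i) (m - k) (m + 1 - r) t' t := by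
  have hb := h.onW_bounds hr.1
  have hon : ∀ u, OnW (Wiring.mirror m i) u (m + 1 - r) → OnW i u r := by
    intro u hu
    have := h.onW_of_mirror hu
    rwa [show m + 1 - (m + 1 - r) = r by omega] at this
  obtain ⟨h1, h2, h3⟩ := hr
  refine ⟨h.onW_mirror h2, h.onW_mirror h1, ?_⟩
  by_cases hrk : r ≤ k
  · rw [if_pos hrk] at h3
    rw [if_neg (by omega)]
    exact ⟨h3.1, fun u hu => h3.2 u (hon u hu)⟩
  · rw [if_neg hrk] at h3
    rw [if_pos (by omega)]
    exact ⟨h3.1, fun u hu => h3.2 u (hon u hu)⟩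

theorem Letters.nPath_mirror (h : Letters m i) {k : ℕ} {P : List Step} (hk : k < m)
    (hP : NPath i k P) :
    NPath (Wiring.mirror m i) (m - k) (P.map (Step.mirror m)).reverse := by
  refine ⟨?_, ?_, ?_, ?_, ?_, ?_⟩
  · obtain ⟨s, hs, h1, h2⟩ := hP.finish
    refine ⟨s.mirror m, by simp [hs], by simp only [Step.mirror]; omega, ?_⟩
    have := h.lowest_mirror h2
    rwa [show m + 1 - (k + 1) = m - k by omega] at this
  · obtain ⟨s, hs, h1, h2⟩ := hP.start
    refine ⟨s.mirror m, by simp [hs], by simp only [Step.mirror]; omega, ?_⟩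
    have := h.lowest_mirror h2
    rwa [show m + 1 - k = m - k + 1 by omega] at this
  · intro s hs
    rw [List.mem_reverse, List.mem_map] at hs
    obtain ⟨u, hu, rfl⟩ := hs
    exact ⟨h.onW_mirror (hP.onW u hu).2, h.onW_mirror (hP.onW u hu).1⟩
  · rw [List.isChain_reverse, List.isChain_map]
    refine hP.oriented.imp fun s s' hs => ?_
    refine ⟨by simp only [Step.mirror]; rw [hs.1], ?_⟩
    have := h.next_mirror hk hs.2
    rw [hs.1] at this
    exact this
  · rw [List.map_reverse, List.nodup_reverse, List.map_map]
    exact hP.nodup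
  · intro s hs
    rw [List.mem_reverse, List.mem_map] at hs
    obtain ⟨u, hu, rfl⟩ := hs
    rintro ⟨h1, q, hq, h2⟩
    have b1 := h.onW_bounds (hP.onW u hu).1
    have b2 := h.onW_bounds (hP.onW u hu).2
    have b3 := h.mirror.onW_bounds hq
    simp only [Step.mirror] at h1 h2 hq
    exact hP.noForb u hu ⟨by omega, m + 1 - q, h.onW_of_mirror hq, by omega⟩

theorem Letters.mirrorPath_mem (h : Letters m i) {p : ℕ × List Step} (hp : p ∈ paths m i) :
    mirrorPath m p ∈ paths m (Wiring.mirror m i) := by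
  obtain ⟨h1, h2, h3⟩ := hp
  exact ⟨by simp only [mirrorPath]; omega, by simp only [mirrorPath]; omega,
    h.nPath_mirror h2 h3⟩

theorem Letters.mirrorPath_mirrorPath (h : Letters m i) {p : ℕ × List Step} (hp : p ∈ paths m i) :
    mirrorPath m (mirrorPath m p) = p := by
  obtain ⟨k, P⟩ := p
  obtain ⟨h1, h2, h3⟩ := hp
  simp only [mirrorPath, List.map_reverse, List.reverse_reverse, List.map_map, Prod.mk.injEq]
  refine ⟨by simp only at h2; omega, ?_⟩
  conv_rhs => rw [← List.map_id P]
  refine List.map_congr_left fun s hs => ?_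
  have b1 := h.onW_bounds (h3.onW s hs).1
  have b2 := h.onW_bounds (h3.onW s hs).2
  simp only [Function.comp_apply, Step.mirror, id]
  ext <;> simp only <;> omega

theorem Letters.ncard_paths_mirror (h : Letters m i) :
    (paths m (Wiring.mirror m i)).ncard = (paths m i).ncard := by
  symm
  refine Set.ncard_congr (fun p _ => mirrorPath m p) (fun p hp => h.mirrorPath_mem hp) ?_ ?_
  · intro p q hp hq hpq
    rw [← h.mirrorPath_mirrorPath hp, hpq, h.mirrorPath_mirrorPath hq]
  · intro q hq
    refine ⟨mirrorPath m q, ?_, h.mirror.mirrorPath_mirrorPath hq⟩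
    have := h.mirror.mirrorPath_mem hq
    rwa [h.mirror_mirror] at this

end

end Wiring

namespace IsLongestReducedWord

open Wiring

variable {m : ℕ} {i : List ℕ} (hi : IsLongestReducedWord m i)

include hi

theorem letters : Letters m i := hi.1

theorem mirror : IsLongestReducedWord m (mirror m i) := by
  refine ⟨hi.letters.mirror, by rw [length_mirror]; exact hi.2.1, fun x h1 h2 => ?_⟩
  have h := hi.letters.arrangement_mirror le_rfl x h1 h2
  rw [hi.arrangement_length (by omega) (by omega)] at h
  rw [← length_mirror m i, arrangement, List.take_length] at h
  rw [h]
  omega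

theorem onW_mirror_iff {t : ℕ} {r r' : ℕ} (hr : r + r' = m + 1) :
    OnW (Wiring.mirror m i) t r ↔ OnW i t r' := by
  constructor
  · intro h
    have := hi.letters.onW_of_mirror h
    rwa [show m + 1 - r = r' by omega] at this
  · intro h
    have := hi.letters.onW_mirror h
    rwa [show m + 1 - r' = r by omega] at this

/-- If some node on the last wire, at or below the first wire, is not the lowest one in its column,
then the mirror image has more than `m - 1` paths which run along the first wire. -/
theorem lt_ncard_mirror_of_not_lowest {t t' : ℕ} (ht : OnW i t m) (htt' : t < t')
    (ht' : t' < i.length) (hcol : col i t' = col i t) (hz : col i t + 1 ≤ upPos m i 1 (t + 1)) :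
    m - 1 < {p ∈ paths m (Wiring.mirror m i) | Uses 1 p.2}.ncard := by
  have hb := hi.letters
  obtain ⟨k, P, hP, hu, h⟩ := hi.exists_path_of_not_lowest ht htt' ht' hcol hz
  refine hi.mirror.le_ncard_uses_one.2 ⟨_, hb.mirrorPath_mem hP, ?_, fun t₀ hl => ?_⟩
  · obtain ⟨s, hs, h1⟩ := hu
    refine ⟨s.mirror m, by simpa [mirrorPath] using ⟨s, hs, rfl⟩, ?_⟩
    simp only [Step.mirror]
    omega
  · have hk := hP.2.1
    have hk1 := hP.1
    simp only at hk hk1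
    have hmem : ∀ s ∈ P, s.mirror m ∈ (mirrorPath m (k, P)).2 := fun s hs => by
      simpa [mirrorPath] using ⟨s, hs, rfl⟩
    rcases h with ⟨s, hs, h1, q, hq, hkq⟩ | ⟨s, hs, h1, h2, h3⟩
    · have := hl.down _ (hmem s hs) (by simp only [mirrorPath, Step.mirror]; omega) _
        (hb.onW_mirror hq)
      simp only [mirrorPath] at this
      omega
    · have b1 := hb.onW_bounds (hP.2.2.onW s hs).1
      have := hl.out _ (hmem s hs) (by simp only [Step.mirror]; omega)
      simp only [mirrorPath, Step.mirror] at this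
      omega

theorem onW_one_of_upPos (hm : 1 ≤ m) {t : ℕ} (ht : t < i.length) (h : upPos m i 1 t = col i t) :
    OnW i t 1 := by
  have := onW_left ht
  rwa [← h, hi.arrangement_upPos_one hm ht.le] at this

theorem upPos_one_ne (hm : 1 ≤ m) {t : ℕ} (ht : t < i.length) : upPos m i 1 t ≠ col i t + 1 := by
  intro h
  have h1 := onW_right ht
  rw [← h, hi.arrangement_upPos_one hm ht.le] at h1
  have := (hi.onW_one hm h1).1
  omega

/-- If neither the nodes on the first wire nor those on the last one are all the lowest in their
columns, then the word or its mirror image has more than `m - 1` paths which run along the first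
wire. -/
theorem lt_ncard_or_lt_ncard_mirror
    (h₁ : ∃ t t', OnW i t 1 ∧ t < t' ∧ t' < i.length ∧ col i t' = col i t)
    (h₂ : ∃ t t', OnW i t m ∧ t < t' ∧ t' < i.length ∧ col i t' = col i t) :
    m - 1 < {p ∈ paths m i | Uses 1 p.2}.ncard ∨
      m - 1 < {p ∈ paths m (Wiring.mirror m i) | Uses 1 p.2}.ncard := by
  obtain ⟨s, s', hs, hss', hs', hcs⟩ := h₁
  obtain ⟨t, t', ht, htt', ht', hct⟩ := h₂
  have hcolt := hi.col_bounds ht.1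
  have hcols := hi.col_bounds hs.1
  have hm : 1 ≤ m := by omega
  have hlen := length_mirror m i
  by_cases hz : col i t + 1 ≤ upPos m i 1 (t + 1)
  · exact Or.inr (hi.lt_ncard_mirror_of_not_lowest ht htt' ht' hct hz)
  by_cases hz' : m - col i s + 1 ≤ upPos m (Wiring.mirror m i) 1 (s + 1)
  · left
    have := hi.mirror.lt_ncard_mirror_of_not_lowest (t := s) (t' := s')
      ((hi.onW_mirror_iff (by omega)).mpr hs) hss' (by omega)
      (by rw [col_mirror hs', col_mirror hs.1, hcs]) (by rw [col_mirror hs.1]; exact hz')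
    rwa [hi.letters.mirror_mirror] at this
  -- the crossing of the two wires
  set z : ℕ → ℕ := upPos m (Wiring.mirror m i) 1 with hzdef
  have hzb : ∀ j, j ≤ i.length → 1 ≤ z j ∧ z j ≤ m := by
    intro j hj
    have := hi.mirror.upPos_bounds (k := 1) hm (j := j) (by omega)
    rw [hzdef]
    omega
  have hlast : ∀ j, j ≤ i.length → arrangement i j (m + 1 - z j) = m := by
    intro j hj
    have h1 := hi.mirror.arrangement_upPos_one hm (j := j) (by omega)
    have h2 := hzb j hj
    rw [hi.letters.arrangement_mirror hj _ h2.1 h2.2] at h1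
    omega
  have hne : ∀ j, j ≤ i.length → upPos m i 1 j ≠ m + 1 - z j := by
    intro j hj h
    have h1 := hi.arrangement_upPos_one hm hj
    rw [h, hlast j hj] at h1
    omega
  have hzstep : ∀ u, u < i.length → z (u + 1) = m - col i u + 1 ∧ z u = m - col i u ∨
      z (u + 1) ≠ m - col i u + 1 ∧ z u = z (u + 1) := by
    intro u hu
    have := upPos_step m 1 (i := Wiring.mirror m i) (t := u) (by omega)
    rwa [col_mirror hu] at this
  have hzmono : ∀ u u', u ≤ u' → u' ≤ i.length → z u ≤ z u' := fun u u' h h' =>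
    upPos_mono m 1 h (by omega)
  obtain ⟨τ, -, hτ, h1, h2⟩ := exists_step_of_not (p := fun j => upPos m i 1 j + z j < m + 1)
    (Nat.zero_le i.length) (by
      rw [hi.upPos_zero le_rfl hm, hzdef, hi.mirror.upPos_zero le_rfl hm]
      omega) (by
      have := hzb i.length le_rfl
      rw [upPos_length]
      omega)
  have hcτ := hi.col_bounds hτ
  have hX : upPos m i 1 τ = col i τ ∧ upPos m i 1 (τ + 1) = col i τ + 1 ∧
      z τ = m - col i τ ∧ z (τ + 1) = m - col i τ + 1 := by
    have e1 := hne (τ + 1) hτ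
    have e2 := hne τ hτ.le
    have e3 := hzb (τ + 1) hτ
    have e4 := hzb τ hτ.le
    rcases upPos_step m 1 hτ with h | h <;> rcases hzstep τ hτ with h' | h' <;> omega
  have hone : OnW i τ 1 := hi.onW_one_of_upPos hm hτ hX.1
  have hlast' : OnW i τ m := by
    have h3 := onW_right hτ
    have h4 := hlast τ hτ.le
    rw [hX.2.2.1, show m + 1 - (m - col i τ) = col i τ + 1 by omega] at h4
    rwa [h4] at h3
  by_cases hlow : ∃ u, τ < u ∧ u < i.length ∧ col i u = col i τ
  · obtain ⟨u, hu, hu', hcu⟩ := hlow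
    exact Or.inr (hi.lt_ncard_mirror_of_not_lowest hlast' hu hu' hcu hX.2.1.ge)
  push Not at hlow
  have hz₁ : z (t + 1) = m - col i t + 1 := by
    have := hi.mirror.onW_one hm ((hi.onW_mirror_iff (by omega)).mpr ht)
    rw [col_mirror ht.1] at this
    exact this.2
  have hz₂ := (hi.onW_one hm hs).2
  have htτ : t < τ := by
    by_contra hcon
    have e1 := hzmono (τ + 1) (t + 1) (by omega) ht.1
    have e2 := upPos_mono m 1 (i := i) (j := τ + 1) (j' := t + 1) (by omega) ht.1
    omega
  have hsτ : s < τ := by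
    by_contra hcon
    have e1 := hzmono (τ + 1) (s + 1) (by omega) hs.1
    have e2 := upPos_mono m 1 (i := i) (j := τ + 1) (j' := s + 1) (by omega) hs.1
    omega
  have e1 := hzmono (t + 1) τ htτ hτ.le
  have e2 := upPos_mono m 1 (i := i) (j := s + 1) (j' := τ) hsτ hτ.le
  obtain ⟨k, P, hP, hu, r, hr, hr1, q, hq, hqk⟩ := hi.exists_path_of_lowest hτ rfl hone hlast'
    (by omega) (by omega) fun u hu hu' => hlow u hu hu'
  refine Or.inl (hi.le_ncard_uses_one.2 ⟨_, hP, hu, fun t₀ hl => ?_⟩)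
  have := hl.down r hr hr1 q hq
  omega

end IsLongestReducedWord

namespace Wiring

/-- The bijection `σ` of the nodes preserves the columns, the wires, and the order of the nodes on
the same wire or in the same column. -/
structure IsNodeIso (σ : Equiv.Perm ℕ) (i i' : List ℕ) : Prop where
  length : i'.length = i.length
  lt : ∀ t, σ t < i.length ↔ t < i.length
  col : ∀ t, t < i.length → col i' (σ t) = col i t
  onW : ∀ t r, OnW i' (σ t) r ↔ OnW i t r
  order : ∀ t t', t < i.length → t' < i.length →
    (Wiring.col i t = Wiring.col i t' ∨ ∃ r, OnW i t r ∧ OnW i t' r) → (σ t < σ t' ↔ t < t')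

theorem IsNodeIso.refl (i : List ℕ) : IsNodeIso (Equiv.refl ℕ) i i :=
  ⟨rfl, fun _ => Iff.rfl, fun _ _ => rfl, fun _ _ => Iff.rfl, fun _ _ _ _ _ => Iff.rfl⟩

theorem IsNodeIso.trans {σ τ : Equiv.Perm ℕ} {i i' i'' : List ℕ} (h : IsNodeIso σ i i')
    (h' : IsNodeIso τ i' i'') : IsNodeIso (σ.trans τ) i i'' := by
  have hlt : ∀ t, t < i.length → σ t < i'.length := fun t ht => by
    rw [h.length]
    exact (h.lt t).mpr ht
  refine ⟨h'.length.trans h.length, fun t => ?_, fun t ht => ?_, fun t r => ?_,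
    fun t t' ht ht' hr => ?_⟩
  · have := h'.lt (σ t)
    rw [h.length, h.lt] at this
    exact this
  · exact (h'.col (σ t) (hlt t ht)).trans (h.col t ht)
  · exact (h'.onW (σ t) r).trans (h.onW t r)
  · refine (h'.order (σ t) (σ t') (hlt t ht) (hlt t' ht') ?_).trans (h.order t t' ht ht' hr)
    rcases hr with hr | ⟨r, hr⟩
    · left
      rw [h.col t ht, h.col t' ht', hr]
    · exact Or.inr ⟨r, (h.onW t r).mpr hr.1, (h.onW t' r).mpr hr.2⟩

theorem IsNodeIso.symm {σ : Equiv.Perm ℕ} {i i' : List ℕ} (h : IsNodeIso σ i i') :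
    IsNodeIso σ.symm i' i := by
  have hlt : ∀ t, t < i'.length → σ.symm t < i.length := fun t ht => by
    rw [← h.lt, Equiv.apply_symm_apply, ← h.length]
    exact ht
  have hcol : ∀ t, t < i'.length → Wiring.col i (σ.symm t) = Wiring.col i' t := fun t ht => by
    rw [← h.col _ (hlt t ht), Equiv.apply_symm_apply]
  have hon : ∀ t r, OnW i (σ.symm t) r ↔ OnW i' t r := fun t r => by
    rw [← h.onW, Equiv.apply_symm_apply]
  refine ⟨h.length.symm, fun t => ?_, hcol, hon, fun t t' ht ht' hr => ?_⟩
  · rw [h.length, ← h.lt, Equiv.apply_symm_apply]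
  · rw [← h.order _ _ (hlt t ht) (hlt t' ht'), Equiv.apply_symm_apply, Equiv.apply_symm_apply]
    rcases hr with hr | ⟨r, hr⟩
    · left
      rw [hcol t ht, hcol t' ht', hr]
    · exact Or.inr ⟨r, (hon t r).mpr hr.1, (hon t' r).mpr hr.2⟩

/-- The step with its node replaced by its image. -/
def Step.map (σ : Equiv.Perm ℕ) (s : Step) : Step := ⟨σ s.node, s.inW, s.outW⟩

theorem Step.map_injective (σ : Equiv.Perm ℕ) : Function.Injective (Step.map σ) := by
  rintro ⟨t, a, b⟩ ⟨t', a', b'⟩ h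
  simp only [Step.map, Step.mk.injEq] at h
  obtain ⟨h1, rfl, rfl⟩ := h
  rw [σ.injective h1]

section

variable {σ : Equiv.Perm ℕ} {i i' : List ℕ}

theorem IsNodeIso.order_of_onW (h : IsNodeIso σ i i') {t t' r : ℕ} (ht : OnW i t r)
    (ht' : OnW i t' r) : σ t < σ t' ↔ t < t' :=
  h.order t t' ht.1 ht'.1 (Or.inr ⟨r, ht, ht'⟩)

theorem IsNodeIso.forall_onW (h : IsNodeIso σ i i') {r : ℕ} {p : ℕ → Prop} :
    (∀ t, OnW i' t r → p t) ↔ ∀ t, OnW i t r → p (σ t) := by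
  constructor
  · exact fun hp t ht => hp _ ((h.onW t r).mpr ht)
  · intro hp t ht
    have := hp (σ.symm t) (by rw [← h.onW, Equiv.apply_symm_apply]; exact ht)
    rwa [Equiv.apply_symm_apply] at this

theorem IsNodeIso.lowest (h : IsNodeIso σ i i') {t r : ℕ} (ht : Lowest i r t) :
    Lowest i' r (σ t) := by
  refine ⟨(h.onW t r).mpr ht.1, h.forall_onW.mpr fun t' ht' => ?_⟩
  have h1 := h.order_of_onW ht.1 ht'
  have h2 := ht.2 t' ht'
  by_contra hcon
  have := h1.mp (by omega)
  omega

theorem IsNodeIso.next (h : IsNodeIso σ i i') {k t t' r : ℕ} (ht : Next i k r t t') :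
    Next i' k r (σ t) (σ t') := by
  obtain ⟨h1, h2, h3⟩ := ht
  refine ⟨(h.onW t r).mpr h1, (h.onW t' r).mpr h2, ?_⟩
  split_ifs at h3 ⊢
  · refine ⟨(h.order_of_onW h2 h1).mpr h3.1, h.forall_onW.mpr fun u hu => ?_⟩
    rw [h.order_of_onW h2 hu, h.order_of_onW hu h1]
    exact h3.2 u hu
  · refine ⟨(h.order_of_onW h1 h2).mpr h3.1, h.forall_onW.mpr fun u hu => ?_⟩
    rw [h.order_of_onW h1 hu, h.order_of_onW hu h2]
    exact h3.2 u hu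

theorem IsNodeIso.nPath (h : IsNodeIso σ i i') {k : ℕ} {P : List Step} (hP : NPath i k P) :
    NPath i' k (P.map (Step.map σ)) := by
  refine ⟨?_, ?_, ?_, ?_, ?_, ?_⟩
  · obtain ⟨s, hs, h1, h2⟩ := hP.start
    exact ⟨s.map σ, by simp [hs], h1, h.lowest h2⟩
  · obtain ⟨s, hs, h1, h2⟩ := hP.finish
    exact ⟨s.map σ, by simp [hs], h1, h.lowest h2⟩
  · intro s hs
    obtain ⟨u, hu, rfl⟩ := List.mem_map.mp hs
    exact ⟨(h.onW _ _).mpr (hP.onW u hu).1, (h.onW _ _).mpr (hP.onW u hu).2⟩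
  · rw [List.isChain_map]
    exact hP.oriented.imp fun s s' hs => ⟨hs.1, h.next hs.2⟩
  · have : (P.map (Step.map σ)).map Step.node = (P.map Step.node).map σ := by
      simp [List.map_map, Function.comp_def, Step.map]
    rw [this]
    exact hP.nodup.map σ.injective
  · intro s hs
    obtain ⟨u, hu, rfl⟩ := List.mem_map.mp hs
    rintro ⟨h1, q, hq, h2⟩
    exact hP.noForb u hu ⟨h1, q, (h.onW _ _).mp hq, h2⟩

theorem IsNodeIso.ncard_paths_le (h : IsNodeIso σ i i') (m : ℕ) (p : Step → Prop)
    (hp : ∀ s, p (s.map σ) ↔ p s) :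
    {x ∈ paths m i | ∃ s ∈ x.2, p s}.ncard ≤ {x ∈ paths m i' | ∃ s ∈ x.2, p s}.ncard := by
  refine Set.ncard_le_ncard_of_injOn (Prod.map id (List.map (Step.map σ))) ?_ ?_ ?_
  · rintro ⟨k, P⟩ ⟨⟨h1, h2, h3⟩, s, hs, hs'⟩
    exact ⟨⟨h1, h2, h.nPath h3⟩, s.map σ, List.mem_map_of_mem hs, (hp s).mpr hs'⟩
  · exact (Function.Injective.prodMap Function.injective_id
      (List.map_injective_iff.mpr (Step.map_injective σ))).injOn
  · exact (finite_paths m i').subset fun x hx => hx.1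

theorem IsNodeIso.ncard_uses (h : IsNodeIso σ i i') (m w : ℕ) :
    {x ∈ paths m i | Uses w x.2}.ncard = {x ∈ paths m i' | Uses w x.2}.ncard :=
  le_antisymm (h.ncard_paths_le m (fun s => s.inW = w ∨ s.outW = w) fun _ => Iff.rfl)
    (h.symm.ncard_paths_le m (fun s => s.inW = w ∨ s.outW = w) fun _ => Iff.rfl)

theorem IsNodeIso.ncard_paths (h : IsNodeIso σ i i') (m : ℕ) :
    (paths m i).ncard = (paths m i').ncard := by
  have key : ∀ i, paths m i = {x ∈ paths m i | ∃ s ∈ x.2, (fun _ => True) s} := by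
    intro i
    ext x
    refine ⟨fun hx => ⟨hx, ?_⟩, fun hx => hx.1⟩
    obtain ⟨s, hs, -⟩ := hx.2.2.start
    exact ⟨s, List.mem_of_mem_head? hs, trivial⟩
  rw [key i, key i']
  exact le_antisymm (h.ncard_paths_le m _ fun _ => Iff.rfl)
    (h.symm.ncard_paths_le m _ fun _ => Iff.rfl)

/-- A node on the wire `r` which is not the lowest one in its column. -/
theorem IsNodeIso.exists_not_lowest (h : IsNodeIso σ i i') {r : ℕ}
    (hex : ∃ t t', OnW i t r ∧ t < t' ∧ t' < i.length ∧ Wiring.col i t' = Wiring.col i t) :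
    ∃ t t', OnW i' t r ∧ t < t' ∧ t' < i'.length ∧ Wiring.col i' t' = Wiring.col i' t := by
  obtain ⟨t, t', h1, h2, h3, h4⟩ := hex
  exact ⟨σ t, σ t', (h.onW t r).mpr h1, (h.order t t' h1.1 h3 (Or.inl h4.symm)).mpr h2,
    by rw [h.length]; exact (h.lt t').mpr h3, by rw [h.col t' h3, h.col t h1.1, h4]⟩

end

section TwoMoves

theorem col_append_left {l r : List ℕ} {t : ℕ} (ht : t < l.length) : col (l ++ r) t = col l t := by
  simp [col, List.getD, List.getElem?_append_left ht]

theorem col_append_right {l r : List ℕ} {t : ℕ} (ht : l.length ≤ t) :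
    col (l ++ r) t = col r (t - l.length) := by
  simp [col, List.getD, List.getElem?_append_right ht]

theorem arrangement_append {l r : List ℕ} {j : ℕ} (hj : j ≤ l.length) :
    arrangement (l ++ r) j = arrangement l j := by
  simp [arrangement, List.take_append_of_le_length hj]

theorem swap_succ_commute {a b : ℕ} (h : a + 1 < b ∨ b + 1 < a) :
    Equiv.swap a (a + 1) * Equiv.swap b (b + 1) = Equiv.swap b (b + 1) * Equiv.swap a (a + 1) := by
  apply Equiv.Perm.Disjoint.commute
  intro x
  by_cases hx : x = a ∨ x = a + 1
  · right
    exact Equiv.swap_apply_of_ne_of_ne (by omega) (by omega)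
  · left
    exact Equiv.swap_apply_of_ne_of_ne (by omega) (by omega)

variable {w w' : List ℕ}

theorem _root_.TwoMove.isNodeIso (h : TwoMove w w') : ∃ σ, IsNodeIso σ w w' := by
  obtain ⟨l, r, a, b, hab, rfl, rfl⟩ := h
  set w := l ++ [a, b] ++ r with hw
  set w' := l ++ [b, a] ++ r with hw'
  set n := l.length with hn
  have hlen : w'.length = w.length := by simp [hw, hw']
  have hnw : n + 1 < w.length := by
    simp [hw, hn]
  have ca : col w n = a := by simp [hw, hn, col]
  have cb : col w (n + 1) = b := by simp [hw, hn, col]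
  have cb' : col w' n = b := by simp [hw', hn, col]
  have ca' : col w' (n + 1) = a := by simp [hw', hn, col]
  have hcol : ∀ t, t ≠ n → t ≠ n + 1 → col w' t = col w t := by
    intro t h1 h2
    by_cases ht : t < n
    · rw [hw, hw', List.append_assoc, List.append_assoc, col_append_left ht, col_append_left ht]
    · rw [hw, hw', col_append_right (by simp; omega), col_append_right (by simp; omega)]
      simp
  have harr₀ : ∀ j, j ≤ n → arrangement w' j = arrangement w j := by
    intro j hj
    rw [hw, hw', List.append_assoc, List.append_assoc, arrangement_append hj,
      arrangement_append hj]
  have a1 : arrangement w (n + 1) = arrangement w n * Equiv.swap a (a + 1) := by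
    rw [arrangement_succ (by omega), ca]
  have a1' : arrangement w' (n + 1) = arrangement w n * Equiv.swap b (b + 1) := by
    rw [arrangement_succ (by omega), cb', harr₀ n le_rfl]
  have harr : ∀ j, j ≤ w.length → j ≠ n + 1 → arrangement w' j = arrangement w j := by
    intro j
    induction j with
    | zero => exact fun _ _ => harr₀ 0 (Nat.zero_le _)
    | succ t ih =>
      intro hj hjn
      by_cases ht : t = n + 1
      · subst ht
        rw [arrangement_succ (i := w') (t := n + 1) (by omega),
          arrangement_succ (i := w) (t := n + 1) (by omega), ca', cb, a1, a1', mul_assoc,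
          mul_assoc, swap_succ_commute hab]
      · rw [arrangement_succ (i := w') (t := t) (by omega),
          arrangement_succ (i := w) (t := t) (by omega), ih (by omega) ht,
          hcol t (by omega) ht]
  have hon : ∀ r, (OnW w' (n + 1) r ↔ OnW w n r) ∧ (OnW w' n r ↔ OnW w (n + 1) r) := by
    intro r
    unfold OnW
    rw [ca, cb, ca', cb', a1, a1', harr n (by omega) (by omega), hlen]
    simp only [Equiv.Perm.mul_apply]
    rw [Equiv.swap_apply_of_ne_of_ne (show a ≠ b by omega) (by omega),
      Equiv.swap_apply_of_ne_of_ne (show a + 1 ≠ b by omega) (by omega),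
      Equiv.swap_apply_of_ne_of_ne (show b ≠ a by omega) (by omega),
      Equiv.swap_apply_of_ne_of_ne (show b + 1 ≠ a by omega) (by omega)]
    constructor
    · exact and_congr (by omega) Iff.rfl
    · exact and_congr (by omega) Iff.rfl
  have hdisj : ∀ r, ¬ (OnW w n r ∧ OnW w (n + 1) r) := by
    rintro r ⟨⟨-, h1⟩, -, h2⟩
    rw [ca] at h1
    rw [cb, a1] at h2
    simp only [Equiv.Perm.mul_apply] at h2
    rw [Equiv.swap_apply_of_ne_of_ne (show b ≠ a by omega) (by omega),
      Equiv.swap_apply_of_ne_of_ne (show b + 1 ≠ a by omega) (by omega)] at h2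
    have inj : ∀ x y, arrangement w n x = arrangement w n y → x = y :=
      fun x y h => (arrangement w n).injective h
    rcases h1 with h1 | h1 <;> rcases h2 with h2 | h2 <;>
      · have := inj _ _ (h1.symm.trans h2)
        omega
  have hσ : ∀ t, Equiv.swap n (n + 1) t = if t = n then n + 1 else if t = n + 1 then n else t :=
    fun t => Equiv.swap_apply_def _ _ _
  refine ⟨Equiv.swap n (n + 1), hlen, fun t => ?_, fun t ht => ?_, fun t r => ?_,
    fun t t' ht ht' hr => ?_⟩
  · rw [hσ]
    split_ifs <;> omega
  · rw [hσ]
    split_ifs with h1 h2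
    · rw [h1, ca, ca']
    · rw [h2, cb, cb']
    · exact hcol t h1 h2
  · rw [hσ]
    split_ifs with h1 h2
    · rw [h1]
      exact (hon r).1
    · rw [h2]
      exact (hon r).2
    · unfold OnW
      rw [hcol t h1 h2, hlen]
      refine and_congr_right fun ht => ?_
      rw [harr t ht.le h2]
  · have hne : ¬ (t = n ∧ t' = n + 1) ∧ ¬ (t = n + 1 ∧ t' = n) := by
      constructor
      · rintro ⟨rfl, rfl⟩
        rcases hr with hr | ⟨r, hr⟩
        · omega
        · exact hdisj r hr
      · rintro ⟨rfl, rfl⟩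
        rcases hr with hr | ⟨r, hr⟩
        · omega
        · exact hdisj r ⟨hr.2, hr.1⟩
    rw [hσ, hσ]
    split_ifs <;> omega

theorem _root_.TwoMove.isLongestReducedWord {m : ℕ} (h : TwoMove w w')
    (hw : IsLongestReducedWord m w) : IsLongestReducedWord m w' := by
  obtain ⟨l, r, a, b, hab, rfl, rfl⟩ := h
  obtain ⟨h1, h2, h3⟩ := hw
  refine ⟨fun c hc => h1 c ?_, by rw [← h2]; simp, fun p hp hp' => ?_⟩
  · simp only [List.mem_append, List.mem_cons] at hc ⊢
    tauto
  · rw [← h3 p hp hp']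
    simp only [List.map_append, List.map_cons, List.map_nil, List.prod_append, List.prod_cons,
      List.prod_nil, mul_one]
    rw [swap_succ_commute hab]

theorem _root_.TwoMoves.isNodeIso {c : ℕ} (h : TwoMoves c w w') : ∃ σ, IsNodeIso σ w w' := by
  induction h with
  | refl w => exact ⟨_, .refl w⟩
  | step h _ ih =>
    obtain ⟨σ, hσ⟩ := h.isNodeIso
    obtain ⟨τ, hτ⟩ := ih
    exact ⟨_, hσ.trans hτ⟩

theorem _root_.TwoMoves.isLongestReducedWord {m c : ℕ} (h : TwoMoves c w w')
    (hw : IsLongestReducedWord m w) : IsLongestReducedWord m w' := by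
  induction h with
  | refl w => exact hw
  | step h _ ih => exact ih (h.isLongestReducedWord hw)

end TwoMoves

end Wiring

/-- The word `w'` is obtained from `w` by 2-moves. -/
def TwoMoveEquiv (w w' : List ℕ) : Prop := ∃ c, TwoMoves c w w'

namespace TwoMoveEquiv

theorem refl (w : List ℕ) : TwoMoveEquiv w w := ⟨0, .refl w⟩

theorem trans {w w' w'' : List ℕ} (h : TwoMoveEquiv w w') (h' : TwoMoveEquiv w' w'') :
    TwoMoveEquiv w w'' := by
  obtain ⟨c, h⟩ := h
  induction h with
  | refl => exact h'
  | step h1 _ ih =>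
    obtain ⟨c', h2⟩ := ih h'
    exact ⟨c' + 1, .step h1 h2⟩

theorem append {w w' : List ℕ} (h : TwoMoveEquiv w w') (x y : List ℕ) :
    TwoMoveEquiv (x ++ w ++ y) (x ++ w' ++ y) := by
  obtain ⟨c, h⟩ := h
  refine ⟨c, ?_⟩
  induction h with
  | refl w => exact .refl _
  | step h1 _ ih =>
    refine .step ?_ ih
    obtain ⟨l, r, a, b, hab, rfl, rfl⟩ := h1
    exact ⟨x ++ l, r ++ y, a, b, hab, by simp, by simp⟩

theorem cons {w w' : List ℕ} (h : TwoMoveEquiv w w') (a : ℕ) :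
    TwoMoveEquiv (a :: w) (a :: w') := by
  simpa using h.append [a] []

theorem cons_append {a : ℕ} {u : List ℕ} (h : ∀ b ∈ u, a + 1 < b ∨ b + 1 < a) (r : List ℕ) :
    TwoMoveEquiv (a :: (u ++ r)) (u ++ a :: r) := by
  induction u with
  | nil => exact refl _
  | cons b u ih =>
    have h1 : TwoMoveEquiv (a :: b :: (u ++ r)) (b :: a :: (u ++ r)) :=
      ⟨1, .step ⟨[], u ++ r, a, b, h b (by simp), rfl, rfl⟩ (.refl _)⟩
    exact h1.trans ((ih fun b' hb' => h b' (List.mem_cons_of_mem _ hb')).cons b)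

theorem mirror {m : ℕ} {w w' : List ℕ} (hw : Wiring.Letters m w) (h : TwoMoveEquiv w w') :
    TwoMoveEquiv (Wiring.mirror m w) (Wiring.mirror m w') := by
  obtain ⟨c, h⟩ := h
  refine ⟨c, ?_⟩
  induction h with
  | refl w => exact .refl _
  | step h1 _ ih =>
    obtain ⟨l, r, a, b, hab, rfl, rfl⟩ := h1
    have ha := hw a (by simp)
    have hb := hw b (by simp)
    refine .step ⟨Wiring.mirror m l, Wiring.mirror m r, m - a, m - b, by omega,
      by simp [Wiring.mirror], rfl⟩ ?_
    have := ih fun c hc => hw c (by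
      simp only [List.mem_append, List.mem_cons] at hc ⊢
      tauto)
    simpa [Wiring.mirror] using this

end TwoMoveEquiv

namespace Wiring

/-- Along the word `w`, a wire at position `p` moves only to the right, to the position `q`. -/
def MovesRight (q : ℕ) : ℕ → List ℕ → Prop
  | p, [] => p = q
  | p, c :: w => (c = p ∧ MovesRight q (p + 1) w) ∨ (c ≠ p ∧ c + 1 ≠ p ∧ MovesRight q p w)

theorem MovesRight.le {q : ℕ} : ∀ {w : List ℕ} {p : ℕ}, MovesRight q p w → p ≤ q := by
  intro w
  induction w with
  | nil => exact fun h => le_of_eq h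
  | cons c w ih =>
    rintro p (⟨-, h⟩ | ⟨-, -, h⟩)
    · have := ih h
      omega
    · exact ih h

/-- The nodes on a wire which moves only to the right can be made consecutive by 2-moves. -/
theorem MovesRight.exists_twoMoveEquiv {q : ℕ} : ∀ {w : List ℕ} {p : ℕ}, MovesRight q p w →
    ∃ u v, TwoMoveEquiv w (u ++ List.range' p (q - p) ++ v) ∧ ∀ a ∈ u, p < a := by
  intro w
  induction w with
  | nil =>
    intro p h
    obtain rfl : p = q := h
    exact ⟨[], [], by simpa using TwoMoveEquiv.refl _, by simp⟩
  | cons c w ih =>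
    rintro p (⟨rfl, h⟩ | ⟨h1, h2, h⟩)
    · obtain ⟨u, v, he, hu⟩ := ih h
      have hlt := h.le
      refine ⟨u, v, ?_, fun a ha => by have := hu a ha; omega⟩
      have h3 := TwoMoveEquiv.cons_append (a := c) (u := u)
        (fun b hb => by have := hu b hb; omega) (List.range' (c + 1) (q - (c + 1)) ++ v)
      rw [← List.append_assoc] at h3
      have h4 := (he.cons c).trans h3
      rw [show q - c = q - (c + 1) + 1 by omega, List.range'_succ]
      simpa using h4
    · obtain ⟨u, v, he, hu⟩ := ih h
      by_cases hcp : p < c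
      · refine ⟨c :: u, v, by simpa using he.cons c, fun a ha => ?_⟩
        rcases List.mem_cons.mp ha with rfl | ha
        · exact hcp
        · exact hu a ha
      · refine ⟨u, c :: v, (he.cons c).trans (TwoMoveEquiv.cons_append (fun b hb => ?_) v), hu⟩
        rcases List.mem_append.mp hb with hb | hb
        · have := hu b hb
          omega
        · rw [List.mem_range'_1] at hb
          omega

end Wiring

namespace IsLongestReducedWord

open Wiring

variable {m : ℕ} {i : List ℕ} (hi : IsLongestReducedWord m i)

include hi

theorem movesRight (hm : 1 ≤ m) : MovesRight m 1 i := by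
  have := decreasing_induction (a := 0) (b := i.length)
    (p := fun j => MovesRight m (upPos m i 1 j) (i.drop j)) ?_ (fun t _ ht ih => ?_) 0 le_rfl
    (Nat.zero_le _)
  · simpa [hi.upPos_zero le_rfl hm] using this
  · rw [List.drop_length, upPos_length]
    exact Nat.add_sub_cancel _ _
  · have hc : i[t] = col i t := by simp [col, ht]
    rw [List.drop_eq_getElem_cons ht, hc]
    have hne := hi.upPos_one_ne hm ht
    by_cases h : upPos m i 1 t = col i t
    · left
      have h1 := (hi.onW_one hm (hi.onW_one_of_upPos hm ht h)).2
      rw [h1] at ih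
      exact ⟨h.symm, by rw [h]; exact ih⟩
    · right
      refine ⟨Ne.symm h, Ne.symm hne, ?_⟩
      rcases upPos_step m 1 ht with h' | h'
      · exact absurd h'.2 h
      · rw [h'.2]
        exact ih

theorem exists_twoMoveEquiv (hm : 1 ≤ m) :
    ∃ u v, TwoMoveEquiv i (u ++ List.range' 1 (m - 1) ++ v) := by
  obtain ⟨u, v, h, -⟩ := (hi.movesRight hm).exists_twoMoveEquiv
  exact ⟨u, v, h⟩

end IsLongestReducedWord

theorem Wiring.mirror_range' (n : ℕ) :
    Wiring.mirror (n + 1) (List.range' 1 n) = (List.range' 1 n).reverse := by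
  apply List.ext_getElem
  · simp [Wiring.mirror]
  · intro k h1 h2
    simp [Wiring.mirror] at h1 ⊢
    omega

theorem AD.isLeastSplitting_splitting {b : AD} {n : ℕ} {i : List ℕ}
    (hi : IsLongestReducedWord (n + 1) i) : b.IsLeastSplitting n i (b.splitting n i) := by
  apply Classical.epsilon_spec (p := b.IsLeastSplitting n i)
  have hex : ∃ c u v, TwoMoves c i (u ++ b.block n ++ v) := by
    cases b with
    | A =>
      obtain ⟨u, v, c, h⟩ := hi.exists_twoMoveEquiv (by omega)
      exact ⟨c, u, v, h⟩
    | D =>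
      obtain ⟨u, v, h⟩ := hi.mirror.exists_twoMoveEquiv (by omega)
      obtain ⟨c, h'⟩ := h.mirror hi.mirror.letters
      rw [hi.letters.mirror_mirror] at h'
      refine ⟨c, Wiring.mirror (n + 1) u, Wiring.mirror (n + 1) v, ?_⟩
      rw [AD.block, ← Wiring.mirror_range']
      simpa [Wiring.mirror] using h'
  classical
  obtain ⟨u, v, h⟩ := Nat.find_spec hex
  exact ⟨(u, v), Nat.find hex, h, fun c' u' v' h' => Nat.find_min' hex ⟨u', v', h'⟩⟩

theorem AD.twoMoveEquiv_splitting (b : AD) {n : ℕ} {i : List ℕ}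
    (hi : IsLongestReducedWord (n + 1) i) :
    TwoMoveEquiv i ((b.splitting n i).1 ++ b.block n ++ (b.splitting n i).2) := by
  obtain ⟨c, h, -⟩ := AD.isLeastSplitting_splitting (b := b) hi
  exact ⟨c, h⟩

namespace Wiring

/-- The word `u A_n v`. -/
def blockWord (n : ℕ) (u v : List ℕ) : List ℕ := u ++ List.range' 1 n ++ v

/-- The word `(u - 1) v`. -/
def contractWord (u v : List ℕ) : List ℕ := u.map (· - 1) ++ v

/-- The node of `u A_n v` which corresponds to a node of `(u - 1) v`. -/
def liftNode (n : ℕ) (u : List ℕ) (t : ℕ) : ℕ := if t < u.length then t else t + n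

/-- The node belongs to the block `A_n` of `u A_n v`. -/
def InBlock (n : ℕ) (u : List ℕ) (t : ℕ) : Prop := u.length ≤ t ∧ t < u.length + n

variable {n : ℕ} {u v : List ℕ}

theorem length_blockWord : (blockWord n u v).length = u.length + n + v.length := by
  simp [blockWord]
  omega

theorem length_contractWord : (contractWord u v).length = u.length + v.length := by
  simp [contractWord]

theorem col_blockWord_left {t : ℕ} (ht : t < u.length) : col (blockWord n u v) t = col u t := by
  rw [blockWord, List.append_assoc, col_append_left ht]

theorem col_blockWord_block {j : ℕ} (hj : j < n) :
    col (blockWord n u v) (u.length + j) = j + 1 := by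
  rw [blockWord, List.append_assoc, col_append_right (by omega), col_append_left (by simp; omega)]
  simp [col, hj, add_comm]

theorem col_blockWord_right {t : ℕ} (ht : u.length ≤ t) :
    col (blockWord n u v) (t + n) = col (contractWord u v) t := by
  rw [blockWord, col_append_right (by simp; omega), contractWord, col_append_right (by simpa)]
  simp
  congr 1
  omega

theorem col_contractWord_left {t : ℕ} (ht : t < u.length) :
    col (contractWord u v) t = col u t - 1 := by
  rw [contractWord, col_append_left (by simpa)]
  simp [col, ht]

theorem liftNode_not_inBlock {t : ℕ} : ¬ InBlock n u (liftNode n u t) := by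
  unfold InBlock liftNode
  split_ifs <;> omega

theorem liftNode_injective : Function.Injective (liftNode n u) := by
  intro t t' h
  unfold liftNode at h
  split_ifs at h <;> omega

theorem arrangement_block {j : ℕ} (hj : j ≤ n) :
    (∀ x, 1 ≤ x → x ≤ j → arrangement (blockWord n u v) (u.length + j) x =
      arrangement (blockWord n u v) u.length (x + 1)) ∧
    (∀ x, j + 1 < x → arrangement (blockWord n u v) (u.length + j) x =
      arrangement (blockWord n u v) u.length x) := by
  have hlen := length_blockWord (n := n) (u := u) (v := v)
  induction j with
  | zero => exact ⟨fun x h1 h2 => by omega, fun x _ => rfl⟩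
  | succ j ih =>
    obtain ⟨h1, h2⟩ := ih (by omega)
    have ht : u.length + j < (blockWord n u v).length := by omega
    have hc := col_blockWord_block (u := u) (v := v) (show j < n by omega)
    rw [← add_assoc]
    refine ⟨fun x hx hx' => ?_, fun x hx => ?_⟩
    · by_cases e : x = j + 1
      · rw [e, ← hc, arrangement_succ_left ht, hc, h2 _ (by omega)]
      · rw [arrangement_succ_of_ne ht (by omega) (by omega), h1 x hx (by omega)]
    · rw [arrangement_succ_of_ne ht (by omega) (by omega), h2 x (by omega)]

section

variable (hi : IsLongestReducedWord (n + 1) (blockWord n u v))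

include hi

theorem upPos_block {j : ℕ} (hj : j ≤ n) :
    upPos (n + 1) (blockWord n u v) 1 (u.length + j) = j + 1 := by
  have hlen := length_blockWord (n := n) (u := u) (v := v)
  have hge : ∀ j, j ≤ n → j + 1 ≤ upPos (n + 1) (blockWord n u v) 1 (u.length + j) := by
    intro j
    induction j with
    | zero => exact fun _ => (hi.upPos_bounds (k := 1) (by omega) (by omega)).1
    | succ j ih =>
      intro hj
      have h1 := ih (by omega)
      have hc := col_blockWord_block (u := u) (v := v) (show j < n by omega)
      have h2 := hi.upPos_one_ne (by omega) (t := u.length + j) (by omega)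
      have h3 := upPos_mono (n + 1) 1 (i := blockWord n u v) (j := u.length + j)
        (j' := u.length + (j + 1)) (by omega) (by omega)
      by_cases h4 : upPos (n + 1) (blockWord n u v) 1 (u.length + j) = j + 1
      · have h5 := (hi.onW_one (by omega)
          (hi.onW_one_of_upPos (by omega) (t := u.length + j) (by omega) (by omega))).2
        rw [← add_assoc, h5]
        omega
      · omega
  refine decreasing_induction (a := 0) (b := n)
    (p := fun j => upPos (n + 1) (blockWord n u v) 1 (u.length + j) = j + 1) ?_
    (fun t _ ht ih => ?_) j (Nat.zero_le _) hj
  · have h1 := hge n le_rfl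
    have h2 := hi.upPos_bounds (k := 1) (by omega) (j := u.length + n) (by omega)
    omega
  · have hc := col_blockWord_block (u := u) (v := v) ht
    rcases upPos_step (n + 1) 1 (i := blockWord n u v) (t := u.length + t) (by omega) with h | h
    · omega
    · exfalso
      apply h.1
      rw [hc, add_assoc, ih]

theorem two_le_col_left {t : ℕ} (ht : t < u.length) : 2 ≤ col u t ∧ col u t ≤ n := by
  have hlen := length_blockWord (n := n) (u := u) (v := v)
  have h0 := hi.col_bounds (t := t) (by omega)
  have hc := col_blockWord_left (n := n) (v := v) ht
  refine ⟨?_, by omega⟩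
  by_contra hcon
  have h1 := upPos_block hi (Nat.zero_le n)
  rw [add_zero] at h1
  have h2 := upPos_mono (n + 1) 1 (i := blockWord n u v) (j := t + 1) (j' := u.length) ht (by omega)
  have h3 := upPos_mono (n + 1) 1 (i := blockWord n u v) (j := t) (j' := t + 1) (by omega) (by omega)
  have h4 := (hi.upPos_bounds (k := 1) (by omega) (j := t) (by omega)).1
  have h5 := (hi.onW_one (by omega)
    (hi.onW_one_of_upPos (by omega) (t := t) (by omega) (by omega))).2
  omega

theorem col_right_lt {t : ℕ} (ht : u.length ≤ t) (ht' : t < (contractWord u v).length) :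
    1 ≤ col (contractWord u v) t ∧ col (contractWord u v) t < n := by
  have hlen := length_blockWord (n := n) (u := u) (v := v)
  have hlen' := length_contractWord (u := u) (v := v)
  have h0 := hi.col_bounds (t := t + n) (by omega)
  have hc := col_blockWord_right (n := n) (v := v) ht
  refine ⟨by omega, ?_⟩
  by_contra hcon
  have h1 := upPos_block hi le_rfl
  have h2 := upPos_mono (n + 1) 1 (i := blockWord n u v) (j := u.length + n) (j' := t + n)
    (by omega) (by omega)
  have h3 := (hi.upPos_bounds (k := 1) (by omega) (j := t + n) (by omega)).2
  have h4 := hi.upPos_one_ne (by omega) (t := t + n) (by omega)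
  omega

theorem letters_contractWord : Letters n (contractWord u v) := by
  intro a ha
  obtain ⟨t, ht, rfl⟩ := List.mem_iff_getElem.mp ha
  have hc : (contractWord u v)[t] = col (contractWord u v) t := by simp [col, ht]
  rw [hc]
  by_cases htu : t < u.length
  · have := two_le_col_left hi htu
    rw [col_contractWord_left htu]
    omega
  · exact col_right_lt hi (by omega) ht

theorem arrangement_left {j : ℕ} (hj : j ≤ u.length) : ∀ x, 1 ≤ x →
    arrangement (blockWord n u v) j (x + 1) = arrangement (contractWord u v) j x + 1 := by
  have hlen := length_blockWord (n := n) (u := u) (v := v)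
  have hlen' := length_contractWord (u := u) (v := v)
  induction j with
  | zero => simp [arrangement_zero]
  | succ t ih =>
    intro x hx
    have ht : t < (blockWord n u v).length := by omega
    have ht' : t < (contractWord u v).length := by omega
    have hc := col_blockWord_left (n := n) (u := u) (v := v) (t := t) (by omega)
    have hc' := col_contractWord_left (u := u) (v := v) (t := t) (by omega)
    have h2 := two_le_col_left hi (t := t) (by omega)
    by_cases e1 : x = col (contractWord u v) t
    · rw [e1, arrangement_succ_left ht', show col (contractWord u v) t + 1 =
        col (blockWord n u v) t by omega, arrangement_succ_left ht, ← ih (by omega) _ (by omega)]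
    · by_cases e2 : x = col (contractWord u v) t + 1
      · rw [e2, arrangement_succ_right ht', show col (contractWord u v) t + 1 + 1 =
          col (blockWord n u v) t + 1 by omega, arrangement_succ_right ht,
          ← ih (by omega) _ (by omega)]
        congr 1
        omega
      · rw [arrangement_succ_of_ne ht' e1 e2, arrangement_succ_of_ne ht (by omega) (by omega),
          ih (by omega) x hx]

theorem arrangement_right {j : ℕ} (hj : u.length ≤ j) (hj' : j ≤ (contractWord u v).length) :
    ∀ x, 1 ≤ x → x ≤ n →
    arrangement (blockWord n u v) (j + n) x = arrangement (contractWord u v) j x + 1 := by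
  have hlen := length_blockWord (n := n) (u := u) (v := v)
  have hlen' := length_contractWord (u := u) (v := v)
  induction j, hj using Nat.le_induction with
  | base =>
    intro x h1 h2
    rw [(arrangement_block le_rfl).1 x h1 h2, arrangement_left hi le_rfl x h1]
  | succ t htu ih =>
    intro x h1 h2
    have ht : t + n < (blockWord n u v).length := by omega
    have ht' : t < (contractWord u v).length := by omega
    have hc := col_blockWord_right (n := n) (u := u) (v := v) htu
    have hb := col_right_lt hi htu ht'
    rw [show t + 1 + n = t + n + 1 by omega]
    by_cases e1 : x = col (contractWord u v) t
    · rw [e1, arrangement_succ_left ht', ← hc, arrangement_succ_left ht, hc,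
        ih (by omega) _ (by omega) (by omega)]
    · by_cases e2 : x = col (contractWord u v) t + 1
      · rw [e2, arrangement_succ_right ht', ← hc, arrangement_succ_right ht, hc,
          ih (by omega) _ (by omega) (by omega)]
      · rw [arrangement_succ_of_ne ht' e1 e2, arrangement_succ_of_ne ht (by omega) (by omega),
          ih (by omega) x h1 h2]

theorem onW_lift {t q : ℕ} :
    OnW (blockWord n u v) (liftNode n u t) q ↔ ∃ r, q = r + 1 ∧ OnW (contractWord u v) t r := by
  have hlen := length_blockWord (n := n) (u := u) (v := v)
  have hlen' := length_contractWord (u := u) (v := v)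
  have hlt : liftNode n u t < (blockWord n u v).length ↔ t < (contractWord u v).length := by
    unfold liftNode
    split_ifs <;> omega
  by_cases ht : t < (contractWord u v).length
  · have key : arrangement (blockWord n u v) (liftNode n u t)
          (col (blockWord n u v) (liftNode n u t)) =
          arrangement (contractWord u v) t (col (contractWord u v) t) + 1 ∧
        arrangement (blockWord n u v) (liftNode n u t)
          (col (blockWord n u v) (liftNode n u t) + 1) =
          arrangement (contractWord u v) t (col (contractWord u v) t + 1) + 1 := by
      unfold liftNode
      split_ifs with htu
      · have hc := col_blockWord_left (n := n) (u := u) (v := v) htu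
        have hc' := col_contractWord_left (u := u) (v := v) htu
        have h2 := two_le_col_left hi htu
        rw [show col (blockWord n u v) t = col (contractWord u v) t + 1 by omega,
          arrangement_left hi htu.le _ (by omega), arrangement_left hi htu.le _ (by omega)]
        exact ⟨rfl, rfl⟩
      · have hb := col_right_lt hi (by omega) ht
        rw [col_blockWord_right (by omega), arrangement_right hi (by omega) ht.le _ hb.1 hb.2.le,
          arrangement_right hi (by omega) ht.le _ (by omega) (by omega)]
        exact ⟨rfl, rfl⟩
    unfold OnW
    rw [key.1, key.2, hlt]
    constructor
    · rintro ⟨h1, h2 | h2⟩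
      · exact ⟨_, h2, h1, Or.inl rfl⟩
      · exact ⟨_, h2, h1, Or.inr rfl⟩
    · rintro ⟨r, rfl, h1, h2⟩
      exact ⟨h1, by omega⟩
  · constructor
    · exact fun h => absurd (hlt.mp h.1) ht
    · rintro ⟨r, -, h⟩
      exact absurd h.1 ht

theorem onW_block {j q : ℕ} (hj : j < n) : OnW (blockWord n u v) (u.length + j) q ↔
    q = 1 ∨ q = arrangement (blockWord n u v) u.length (j + 2) := by
  have hlen := length_blockWord (n := n) (u := u) (v := v)
  have h1 := hi.arrangement_upPos_one (by omega) (j := u.length + j) (by omega)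
  rw [upPos_block hi hj.le] at h1
  unfold OnW
  rw [col_blockWord_block hj, h1, (arrangement_block hj.le).2 (j + 1 + 1) (by omega)]
  have : u.length + j < (blockWord n u v).length := by omega
  simp [this]

/-- The crossing of a wire with the first wire lies in the block. -/
theorem exists_block_node {w : ℕ} (h1 : 1 ≤ w) (h2 : w ≤ n) : ∃ X, InBlock n u X ∧
    (∀ t, InBlock n u t → (OnW (blockWord n u v) t (w + 1) ↔ t = X)) ∧
    ∀ q, OnW (blockWord n u v) X q ↔ q = 1 ∨ q = w + 1 := by
  have hlen := length_blockWord (n := n) (u := u) (v := v)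
  obtain ⟨x, hx⟩ := (arrangement (blockWord n u v) u.length).surjective (w + 1)
  have hx1 : 1 ≤ x ∧ x ≤ n + 1 := by
    by_contra hcon
    rw [hi.arrangement_of_not_mem (by omega) hcon] at hx
    omega
  have h0 := upPos_block hi (Nat.zero_le n)
  have h3 := hi.arrangement_upPos_one (by omega) (j := u.length) (by omega)
  rw [add_zero] at h0
  rw [h0] at h3
  have hx2 : x ≠ 1 := by
    rintro rfl
    rw [zero_add] at h3
    omega
  refine ⟨u.length + (x - 2), ⟨by omega, by omega⟩, fun t ht => ?_, fun q => ?_⟩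
  · obtain ⟨j, rfl⟩ : ∃ j, t = u.length + j := ⟨t - u.length, by have := ht.1; omega⟩
    have hj : j < n := by have := ht.2; omega
    rw [onW_block hi hj]
    constructor
    · rintro (h | h)
      · omega
      · rw [← hx] at h
        have := (arrangement _ _).injective h
        omega
    · intro h
      right
      rw [show j + 2 = x by omega, hx]
  · rw [onW_block hi (by omega), show x - 2 + 2 = x by omega, hx]

end

/-- The step of a path in `u A_n v` which corresponds to a step in `(u - 1) v`. -/
def Step.lift (n : ℕ) (u : List ℕ) (s : Step) : Step :=
  ⟨liftNode n u s.node, s.inW + 1, s.outW + 1⟩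

theorem Step.lift_injective : Function.Injective (Step.lift n u) := by
  rintro ⟨t, a, b⟩ ⟨t', a', b'⟩ h
  simp only [Step.lift, Step.mk.injEq] at h
  obtain ⟨h1, h2, h3⟩ := h
  rw [liftNode_injective h1, show a = a' by omega, show b = b' by omega]

open Classical in
/-- The path `Q` in `u A_n v` is the path `P` in `(u - 1) v` with straight crossings of the first
wire inserted. -/
def IsLift (n : ℕ) (u : List ℕ) (Q P : List Step) : Prop :=
  Q.filter (fun s => ¬ InBlock n u s.node) = P.map (Step.lift n u) ∧
    ∀ s ∈ Q, s.inW ≠ 1 ∧ s.outW ≠ 1 ∧ (InBlock n u s.node → s.inW = s.outW)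

theorem IsLift.cons_lift {Q P : List Step} (h : IsLift n u Q P) {s : Step} (h1 : 1 ≤ s.inW)
    (h2 : 1 ≤ s.outW) : IsLift n u (s.lift n u :: Q) (s :: P) := by
  have hb : ¬ InBlock n u (s.lift n u).node := liftNode_not_inBlock
  refine ⟨?_, fun x hx => ?_⟩
  · rw [List.filter_cons_of_pos (by simpa using hb), h.1, List.map_cons]
  · rcases List.mem_cons.mp hx with rfl | hx
    · refine ⟨?_, ?_, fun hb' => absurd hb' hb⟩ <;> simp only [Step.lift] <;> omega
    · exact h.2 x hx

theorem IsLift.cons_block {Q P : List Step} (h : IsLift n u Q P) {X w : ℕ} (hX : InBlock n u X)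
    (hw : w ≠ 1) : IsLift n u (⟨X, w, w⟩ :: Q) P := by
  refine ⟨?_, fun x hx => ?_⟩
  · rw [List.filter_cons_of_neg (by simpa using hX), h.1]
  · rcases List.mem_cons.mp hx with rfl | hx
    · exact ⟨hw, hw, fun _ => rfl⟩
    · exact h.2 x hx

section

variable (hi : IsLongestReducedWord (n + 1) (blockWord n u v))

include hi

theorem cross_up {k w : ℕ} (h1 : 1 ≤ w) (h2 : w ≤ n) (hw : w ≤ k) {Q P : List Step}
    (hQ : Walk (blockWord n u v) (k + 1) u.length (w + 1) Q) (hP : IsLift n u Q P) :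
    ∃ Q', Walk (blockWord n u v) (k + 1) (u.length + n) (w + 1) Q' ∧ IsLift n u Q' P := by
  have hlen := length_blockWord (n := n) (u := u) (v := v)
  obtain ⟨X, hX, h3, h4⟩ := exists_block_node hi h1 h2
  have hX' := hX
  obtain ⟨hX1, hX2⟩ := hX'
  have hon := (h4 (w + 1)).mpr (Or.inr rfl)
  have W1 := hQ.skip_up (j' := X) (by omega) hX1 (by omega) fun t ht hc => by
    have := (h3 t ⟨hc.1, by omega⟩).mp ht
    omega
  have W2 := W1.up (t := X) (a := w + 1) (by omega) (by omega) hon hon (by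
    rintro ⟨-, q, hq, h | h⟩
    · simp only at h
      omega
    · have := (h4 q).mp hq
      simp only at h
      omega)
  have W3 := W2.skip_up (j' := u.length + n) (by omega) (by omega) (by omega) fun t ht hc => by
    have := (h3 t ⟨by omega, hc.2⟩).mp ht
    omega
  exact ⟨_, W3, hP.cons_block hX (by omega)⟩

theorem cross_down {k w : ℕ} (hk : 1 ≤ k) (h2 : w ≤ n) (hw : k < w) {Q P : List Step}
    (hQ : Walk (blockWord n u v) (k + 1) (u.length + n) (w + 1) Q) (hP : IsLift n u Q P) :
    ∃ Q', Walk (blockWord n u v) (k + 1) u.length (w + 1) Q' ∧ IsLift n u Q' P := by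
  have hlen := length_blockWord (n := n) (u := u) (v := v)
  obtain ⟨X, hX, h3, h4⟩ := exists_block_node hi (w := w) (by omega) h2
  have hX' := hX
  obtain ⟨hX1, hX2⟩ := hX'
  have hon := (h4 (w + 1)).mpr (Or.inr rfl)
  have W1 := hQ.skip_down (j := X + 1) (by omega) (by omega) (by omega) fun t ht hc => by
    have := (h3 t ⟨by omega, hc.2⟩).mp ht
    omega
  have W2 := W1.down (t := X) (a := w + 1) (by omega) (by omega) hon hon (by
    rintro ⟨-, q, hq, h | h⟩
    · have := (h4 q).mp hq
      simp only at h
      omega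
    · simp only at h
      omega)
  have W3 := W2.skip_down (j := u.length) (by omega) (by omega) (by omega) fun t ht hc => by
    have := (h3 t ⟨hc.1, by omega⟩).mp ht
    omega
  exact ⟨_, W3, hP.cons_block hX (by omega)⟩

/-- Every walk in `(u - 1) v` can be lifted to `u A_n v`. -/
theorem exists_lift {k : ℕ} (hk : 1 ≤ k) (hkn : k < n) {j w : ℕ} {P : List Step}
    (hP : Walk (contractWord u v) k j w P) :
    (1 ≤ w ∧ w ≤ n) ∧
    (j ≤ u.length → ∃ Q, Walk (blockWord n u v) (k + 1) j (w + 1) Q ∧ IsLift n u Q P) ∧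
    (u.length ≤ j → ∃ Q, Walk (blockWord n u v) (k + 1) (j + n) (w + 1) Q ∧ IsLift n u Q P) := by
  have hlen := length_blockWord (n := n) (u := u) (v := v)
  have hlen' := length_contractWord (u := u) (v := v)
  have hL := letters_contractWord hi
  have hup : ∀ {j w P}, 1 ≤ w → w ≤ n → w ≤ k → (j ≤ u.length → ∃ Q,
      Walk (blockWord n u v) (k + 1) j (w + 1) Q ∧ IsLift n u Q P) → u.length = j →
      ∃ Q, Walk (blockWord n u v) (k + 1) (j + n) (w + 1) Q ∧ IsLift n u Q P := by
    intro j w P h1 h2 h3 h4 h5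
    obtain ⟨Q, hQ, hQ'⟩ := h4 h5.ge
    rw [← h5] at hQ ⊢
    exact cross_up hi h1 h2 h3 hQ hQ'
  have hdown : ∀ {j w P}, w ≤ n → k < w → (u.length ≤ j → ∃ Q,
      Walk (blockWord n u v) (k + 1) (j + n) (w + 1) Q ∧ IsLift n u Q P) → u.length = j →
      ∃ Q, Walk (blockWord n u v) (k + 1) j (w + 1) Q ∧ IsLift n u Q P := by
    intro j w P h2 h3 h4 h5
    obtain ⟨Q, hQ, hQ'⟩ := h4 h5.le
    rw [← h5] at hQ ⊢
    exact cross_down hi hk h2 h3 hQ hQ'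
  have hleft : ∀ t, t < u.length → liftNode n u t = t := fun t ht => if_pos ht
  have hright : ∀ t, u.length ≤ t → liftNode n u t = t + n := fun t ht => if_neg (by omega)
  have hnot : ∀ {t w}, ¬ OnW (contractWord u v) t w →
      ¬ OnW (blockWord n u v) (liftNode n u t) (w + 1) := by
    intro t w h h'
    obtain ⟨r, h1, h2⟩ := (onW_lift hi).mp h'
    obtain rfl : w = r := by omega
    exact h h2
  induction hP with
  | done =>
    have hmain : ∃ Q, Walk (blockWord n u v) (k + 1) ((contractWord u v).length + n) (k + 1 + 1) Q ∧
        IsLift n u Q [] := by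
      refine ⟨[], ?_, by simp [IsLift]⟩
      rw [show (contractWord u v).length + n = (blockWord n u v).length by omega]
      exact .done
    exact ⟨⟨by omega, by omega⟩,
      fun h => hdown (by omega) (by omega) (fun _ => hmain) (by omega), fun _ => hmain⟩
  | @skipUp t w P h1 h2 h3 _ ih =>
    obtain ⟨hw, ih1, ih2⟩ := ih
    have hmain1 : t + 1 ≤ u.length →
        ∃ Q, Walk (blockWord n u v) (k + 1) (t + 1) (w + 1) Q ∧ IsLift n u Q P := by
      intro ht
      obtain ⟨Q, hQ, hQ'⟩ := ih1 (by omega)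
      have := hnot h3
      rw [hleft t ht] at this
      exact ⟨Q, .skipUp (by omega) (by omega) this hQ, hQ'⟩
    refine ⟨hw, hmain1, fun ht => ?_⟩
    by_cases htu : u.length = t + 1
    · exact hup hw.1 hw.2 h1 hmain1 htu
    · obtain ⟨Q, hQ, hQ'⟩ := ih2 (by omega)
      have := hnot h3
      rw [hright t (by omega)] at this
      rw [show t + 1 + n = t + n + 1 by omega]
      exact ⟨Q, .skipUp (by omega) (by omega) this hQ, hQ'⟩
  | @skipDown t w P h1 h2 h3 _ ih =>
    obtain ⟨hw, ih1, ih2⟩ := ih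
    have hmain2 : u.length ≤ t →
        ∃ Q, Walk (blockWord n u v) (k + 1) (t + n) (w + 1) Q ∧ IsLift n u Q P := by
      intro ht
      obtain ⟨Q, hQ, hQ'⟩ := ih2 (by omega)
      have := hnot h3
      rw [hright t ht] at this
      rw [show t + 1 + n = t + n + 1 by omega] at hQ
      exact ⟨Q, .skipDown (by omega) (by omega) this hQ, hQ'⟩
    refine ⟨hw, fun ht => ?_, hmain2⟩
    by_cases htu : u.length = t
    · exact hdown hw.2 h1 hmain2 htu
    · obtain ⟨Q, hQ, hQ'⟩ := ih1 (by omega)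
      have := hnot h3
      rw [hleft t (by omega)] at this
      exact ⟨Q, .skipDown (by omega) (by omega) this hQ, hQ'⟩
  | @step s P h1 h2 h3 _ ih =>
    obtain ⟨-, ih1, ih2⟩ := ih
    have b1 := hL.onW_bounds h1
    have b2 := hL.onW_bounds h2
    have o1 : OnW (blockWord n u v) (s.lift n u).node (s.lift n u).inW :=
      (onW_lift hi).mpr ⟨_, rfl, h1⟩
    have o2 : OnW (blockWord n u v) (s.lift n u).node (s.lift n u).outW :=
      (onW_lift hi).mpr ⟨_, rfl, h2⟩
    have hf : ¬ (s.lift n u).Forb (blockWord n u v) (k + 1) := by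
      rintro ⟨e, q, hq, hq'⟩
      obtain ⟨r, rfl, hr⟩ := (onW_lift hi).mp hq
      simp only [Step.lift] at e hq'
      exact h3 ⟨by omega, r, hr, by omega⟩
    have hpre : (s.lift n u).pre (k + 1) = s.pre k + (if s.node < u.length then 0 else n) := by
      simp only [Step.pre, Step.lift, liftNode, Nat.add_le_add_iff_right]
      by_cases e1 : s.inW ≤ k <;> by_cases e2 : s.node < u.length <;> simp [e1, e2]; omega
    have hpost : (s.lift n u).post (k + 1) = s.post k + (if s.node < u.length then 0 else n) := by
      simp only [Step.post, Step.lift, liftNode, Nat.add_le_add_iff_right]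
      by_cases e1 : s.outW ≤ k <;> by_cases e2 : s.node < u.length <;> simp [e1, e2]; omega
    have hpre' : s.inW ≤ k ∧ s.pre k = s.node + 1 ∨ k < s.inW ∧ s.pre k = s.node := by
      simp only [Step.pre]
      split_ifs <;> omega
    have hpost' : s.post k = s.node + 1 ∨ s.post k = s.node := by
      simp only [Step.post]
      split_ifs <;> omega
    refine ⟨b1, ?_⟩
    by_cases hs : s.node < u.length
    · rw [if_pos hs, add_zero] at hpre hpost
      obtain ⟨Q, hQ, hQ'⟩ := ih1 (by omega)
      have W := Walk.step o1 o2 hf (P := Q) (by rw [hpost]; exact hQ)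
      rw [hpre] at W
      have hmain : s.pre k ≤ u.length → ∃ Q,
          Walk (blockWord n u v) (k + 1) (s.pre k) (s.inW + 1) Q ∧ IsLift n u Q (s :: P) :=
        fun _ => ⟨_, W, hQ'.cons_lift b1.1 b2.1⟩
      exact ⟨hmain, fun h => hup b1.1 b1.2 (by omega) hmain (by omega)⟩
    · rw [if_neg hs] at hpre hpost
      obtain ⟨Q, hQ, hQ'⟩ := ih2 (by omega)
      have W := Walk.step o1 o2 hf (P := Q) (by rw [hpost]; exact hQ)
      rw [hpre] at W
      have hmain : u.length ≤ s.pre k → ∃ Q,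
          Walk (blockWord n u v) (k + 1) (s.pre k + n) (s.inW + 1) Q ∧ IsLift n u Q (s :: P) :=
        fun _ => ⟨_, W, hQ'.cons_lift b1.1 b2.1⟩
      exact ⟨fun h => hdown b1.2 (by omega) hmain (by omega), hmain⟩

theorem IsLift.nodup {k : ℕ} : ∀ {Q : List Step},
    (Q.IsChain fun s s' => s.outW = s'.inW ∧ Next (blockWord n u v) k s.outW s.node s'.node) →
    (∀ s ∈ Q.getLast?, s.outW = k + 1 ∧ Lowest (blockWord n u v) (k + 1) s.node) →
    (∀ s ∈ Q, OnW (blockWord n u v) s.node s.inW ∧ OnW (blockWord n u v) s.node s.outW) →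
    ∀ {P : List Step}, IsLift n u Q P → (P.map Step.node).Nodup → (Q.map Step.node).Nodup := by
  classical
  suffices h : ∀ {Q : List Step},
      (Q.IsChain fun s s' => s.outW = s'.inW ∧ Next (blockWord n u v) k s.outW s.node s'.node) →
      (∀ s ∈ Q.getLast?, s.outW = k + 1 ∧ Lowest (blockWord n u v) (k + 1) s.node) →
      (∀ s ∈ Q, OnW (blockWord n u v) s.node s.inW ∧ OnW (blockWord n u v) s.node s.outW) →
      (∀ s ∈ Q, s.inW ≠ 1 ∧ s.outW ≠ 1 ∧ (InBlock n u s.node → s.inW = s.outW)) →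
      ((Q.filter fun s => ¬ InBlock n u s.node).map Step.node).Nodup →
      (Q.map Step.node).Nodup by
    intro Q h1 h2 h3 P hP hn
    refine h h1 h2 h3 hP.2 ?_
    have e := hP.1
    have e2 : (P.map (Step.lift n u)).map Step.node = (P.map Step.node).map (liftNode n u) := by
      simp [List.map_map, Function.comp_def, Step.lift]
    have e3 := congrArg (List.map Step.node) e
    rw [e2] at e3
    convert hn.map liftNode_injective using 1
  intro Q
  induction Q with
  | nil => simp
  | cons s Q ih =>
    intro h1 h2 h3 h4 h5
    have hQ : (Q.map Step.node).Nodup := by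
      refine ih h1.of_cons (fun x hx => h2 x ?_) (fun x hx => h3 x (by simp [hx]))
        (fun x hx => h4 x (by simp [hx])) ?_
      · cases Q with
        | nil => simp at hx
        | cons y Q => simpa using hx
      · exact h5.sublist (((List.sublist_cons_self s Q).filter _).map _)
    rw [List.map_cons, List.nodup_cons]
    refine ⟨fun hs => ?_, hQ⟩
    obtain ⟨s', hs', e⟩ := List.mem_map.mp hs
    by_cases hb : InBlock n u s.node
    · have g := h4 s (by simp)
      have g' := h4 s' (by simp [hs'])
      have f := h3 s (by simp)
      have f' := h3 s' (by simp [hs'])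
      have bd := hi.letters.onW_bounds f.1
      obtain ⟨X, -, hX2, hX3⟩ := exists_block_node hi (w := s.inW - 1) (by omega) (by omega)
      rw [show s.inW - 1 + 1 = s.inW by omega] at hX2 hX3
      have hsX : s.node = X := (hX2 _ hb).mp f.1
      rw [e, hsX] at f'
      have d1 := (hX3 _).mp f'.1
      have d2 := (hX3 _).mp f'.2
      have io := g.2.2 hb
      obtain rfl : s' = s := by
        ext
        · exact e
        · omega
        · omega
      cases Q with
      | nil => simp at hs'
      | cons x Q =>
        rw [List.isChain_cons_cons] at h1
        obtain ⟨⟨-, hx⟩, h1⟩ := h1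
        have hxX : x.node ≠ s'.node := by
          have := hx.2.2
          split_ifs at this <;> omega
        have hxb : ¬ InBlock n u x.node := fun hxb => by
          have h6 := hx.2.1
          rw [← io] at h6
          have := (hX2 _ hxb).mp h6
          omega
        have hs'' : s' ∈ Q := by
          rcases List.mem_cons.mp hs' with h | h
          · rw [← h] at hxX
            exact absurd rfl hxX
          · exact h
        obtain ⟨A, B, rfl⟩ := List.append_of_mem hs''
        cases B with
        | nil =>
          obtain ⟨h6, h7⟩ := h2 s' (by
            rw [← List.cons_append, ← List.cons_append, List.getLast?_append]
            simp)
          have h8 := hx.2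
          rw [h6, if_neg (by omega)] at h8
          have := h7.2 _ h8.1
          omega
        | cons y B =>
          have hy : Next (blockWord n u v) k s'.outW s'.node y.node := by
            have : [s', y] <:+: x :: (A ++ s' :: y :: B) := ⟨x :: A, B, by simp⟩
            have := h1.infix this
            simp only [List.isChain_cons_cons] at this
            exact this.1.2
          have hxy : y.node = x.node := by
            obtain ⟨-, hx1, hx2⟩ := hx
            obtain ⟨-, hy1, hy2⟩ := hy
            split_ifs at hx2 hy2
            · have := hx2.2 _ hy1
              have := hy2.2 _ hx1
              omega
            · have := hx2.2 _ hy1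
              have := hy2.2 _ hx1
              omega
          simp only [List.map_cons, List.nodup_cons] at hQ
          exact hQ.1 (List.mem_map.mpr ⟨y, by simp, hxy⟩)
    · have hb' : ¬ InBlock n u s'.node := by rwa [e]
      rw [List.filter_cons_of_pos (by simpa using hb), List.map_cons, List.nodup_cons] at h5
      exact h5.1 (List.mem_map.mpr ⟨s', List.mem_filter.mpr ⟨hs', by simpa using hb'⟩, e⟩)

/-- The paths of `(u - 1) v` give distinct paths of `u A_n v` which avoid the first wire. -/
theorem ncard_paths_contractWord_le : (paths n (contractWord u v)).ncard ≤
    {p ∈ paths (n + 1) (blockWord n u v) | ¬ Uses 1 p.2}.ncard := by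
  classical
  have hlen := length_blockWord (n := n) (u := u) (v := v)
  have hlen' := length_contractWord (u := u) (v := v)
  have key : ∀ p ∈ paths n (contractWord u v), ∃ Q,
      NPath (blockWord n u v) (p.1 + 1) Q ∧ IsLift n u Q p.2 := by
    rintro ⟨k, P⟩ ⟨h1, h2, h3⟩
    simp only at h1 h2 h3
    obtain ⟨-, -, h4⟩ := exists_lift hi h1 h2 h3.walk
    obtain ⟨Q, hQ, hQ'⟩ := h4 (by omega)
    rw [show (contractWord u v).length + n = (blockWord n u v).length by omega] at hQ
    exact ⟨Q, hQ.nPath (hQ'.nodup hi hQ.oriented hQ.finish hQ.onW h3.nodup), hQ'⟩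
  choose! f hf hf' using key
  refine Set.ncard_le_ncard_of_injOn (fun p => (p.1 + 1, f p)) ?_ ?_ ?_
  · intro p hp
    refine ⟨⟨by simp, by simpa using hp.2.1, hf p hp⟩, ?_⟩
    rintro ⟨s, hs, hs'⟩
    have := (hf' p hp).2 s hs
    omega
  · rintro ⟨k, P⟩ hp ⟨k', P'⟩ hp' e
    simp only [Prod.mk.injEq, Nat.add_right_cancel_iff] at e
    obtain ⟨rfl, e⟩ := e
    have h1 := (hf' _ hp).1
    have h2 := (hf' _ hp').1
    rw [e] at h1
    have h3 := h1.symm.trans h2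
    rw [Prod.mk.injEq]
    exact ⟨rfl, List.map_injective_iff.mpr Step.lift_injective h3⟩
  · exact (finite_paths _ _).subset fun x hx => hx.1

end

end Wiring

open Wiring

theorem TwoMoveEquiv.isNodeIso {w w' : List ℕ} (h : TwoMoveEquiv w w') :
    ∃ σ, IsNodeIso σ w w' :=
  h.elim fun _ h => h.isNodeIso

theorem TwoMoveEquiv.isLongestReducedWord {m : ℕ} {w w' : List ℕ} (h : TwoMoveEquiv w w')
    (hw : IsLongestReducedWord m w) : IsLongestReducedWord m w' :=
  h.elim fun _ h => h.isLongestReducedWord hw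

namespace IsLongestReducedWord

variable {n : ℕ} {i u v : List ℕ} (hi : IsLongestReducedWord (n + 1) i)

include hi

theorem ncard_paths_contractWord_add_le (h : TwoMoveEquiv i (blockWord n u v)) :
    (paths n (contractWord u v)).ncard + {p ∈ paths (n + 1) i | Uses 1 p.2}.ncard ≤
      (paths (n + 1) i).ncard := by
  obtain ⟨σ, hσ⟩ := h.isNodeIso
  have hB := h.isLongestReducedWord hi
  have h1 := ncard_paths_contractWord_le hB
  have hfin := finite_paths (n + 1) (blockWord n u v)
  have h2 : {p ∈ paths (n + 1) (blockWord n u v) | ¬ Uses 1 p.2} =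
      paths (n + 1) (blockWord n u v) \ {p ∈ paths (n + 1) (blockWord n u v) | Uses 1 p.2} := by
    ext p
    simp only [Set.mem_ofPred_eq, Set.mem_sdiff]
    tauto
  rw [h2] at h1
  have h3 := Set.ncard_sdiff_add_ncard_of_subset
    (s := {p ∈ paths (n + 1) (blockWord n u v) | Uses 1 p.2}) (fun p hp => hp.1) hfin
  rw [hσ.ncard_uses, hσ.ncard_paths]
  omega

theorem exists_not_lowest_one (h : TwoMoveEquiv i (blockWord n u v)) (hv : v ≠ []) :
    ∃ t t', OnW i t 1 ∧ t < t' ∧ t' < i.length ∧ col i t' = col i t := by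
  obtain ⟨σ, hσ⟩ := h.isNodeIso
  have hB := h.isLongestReducedWord hi
  have hlen := length_blockWord (n := n) (u := u) (v := v)
  have hpos := List.length_pos_of_ne_nil hv
  have hc := hB.letters.col_bounds (t := u.length + n) (by omega)
  have hj : col (blockWord n u v) (u.length + n) - 1 < n := by omega
  refine hσ.symm.exists_not_lowest
    ⟨_, u.length + n, (onW_block hB hj).mpr (Or.inl rfl), by omega, by omega, ?_⟩
  rw [col_blockWord_block hj]
  omega

theorem twoMoveEquiv_mirror_splitting :
    TwoMoveEquiv (Wiring.mirror (n + 1) i)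
      (blockWord n (Wiring.mirror (n + 1) (AD.D.splitting n i).1)
        (Wiring.mirror (n + 1) (AD.D.splitting n i).2)) := by
  have h := (AD.D.twoMoveEquiv_splitting hi).mirror hi.letters
  have hr : Letters (n + 1) (List.range' 1 n) := fun a ha => by
    have := List.mem_range'_1.mp ha
    omega
  have e := hr.mirror_mirror
  rw [mirror_range'] at e
  simp only [AD.block, Wiring.mirror, List.map_append] at h e ⊢
  rw [e] at h
  exact h

theorem ncard_paths_contraction_D :
    (paths n (AD.D.contraction n i)).ncard =
      (paths n (contractWord (Wiring.mirror (n + 1) (AD.D.splitting n i).1)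
        (Wiring.mirror (n + 1) (AD.D.splitting n i).2))).ncard := by
  have hL := ((AD.D.twoMoveEquiv_splitting hi).isLongestReducedWord hi).letters
  have hC := letters_contractWord
    (hi.twoMoveEquiv_mirror_splitting.isLongestReducedWord hi.mirror)
  rw [← hC.ncard_paths_mirror]
  congr 2
  simp only [AD.contraction, contractWord, Wiring.mirror, List.map_append, List.map_map]
  congr 1
  · conv_lhs => rw [← List.map_id (AD.D.splitting n i).1]
    refine List.map_congr_left fun a ha => ?_
    have := hL a (by simp [ha])
    simp only [Function.comp, id]
    omega
  · refine List.map_congr_left fun a ha => ?_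
    have := hL a (by simp [ha])
    simp only [Function.comp]
    omega

end IsLongestReducedWord

theorem mainTheorem5 (n : ℕ) (i : List ℕ) (hi : i ∈ ReducedWords (n + 1)) :
    (∀ b : AD, numFacets n (b.contraction n i) + n ≤ numFacets (n + 1) i) ∧
    (0 < AD.A.ind n i * AD.D.ind n i →
      ∃ b : AD, numFacets n (b.contraction n i) + n < numFacets (n + 1) i) := by
  have hi : IsLongestReducedWord (n + 1) i := hi
  simp only [numFacets_eq_ncard_paths]
  have eA : TwoMoveEquiv i (blockWord n (AD.A.splitting n i).1 (AD.A.splitting n i).2) :=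
    AD.A.twoMoveEquiv_splitting hi
  have eD := hi.twoMoveEquiv_mirror_splitting
  have hA : (paths n (AD.A.contraction n i)).ncard + _ ≤ _ :=
    hi.ncard_paths_contractWord_add_le eA
  have hD := hi.mirror.ncard_paths_contractWord_add_le eD
  rw [← hi.ncard_paths_contraction_D, hi.letters.ncard_paths_mirror] at hD
  refine ⟨fun b => ?_, fun h => ?_⟩
  · cases b with
    | A =>
      have := hi.le_ncard_uses_one.1
      omega
    | D =>
      have := hi.mirror.le_ncard_uses_one.1
      omega
  · have hA' : (AD.A.splitting n i).2 ≠ [] := List.ne_nil_of_length_pos (Nat.pos_of_mul_pos_right h)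
    have hD' : Wiring.mirror (n + 1) (AD.D.splitting n i).2 ≠ [] := by
      apply List.ne_nil_of_length_pos
      rw [length_mirror]
      exact Nat.pos_of_mul_pos_left h
    obtain ⟨t, t', h1, h2, h3, h4⟩ := hi.mirror.exists_not_lowest_one eD hD'
    rw [length_mirror] at h3
    rw [hi.onW_mirror_iff (r' := n + 1) (by omega)] at h1
    rw [col_mirror h3, col_mirror h1.1] at h4
    have c1 := hi.letters.col_bounds h3
    have c2 := hi.letters.col_bounds h1.1
    rcases hi.lt_ncard_or_lt_ncard_mirror (hi.exists_not_lowest_one eA hA')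
      ⟨t, t', h1, h2, h3, by omega⟩ with hlt | hlt
    · exact ⟨.A, by omega⟩
    · exact ⟨.D, by omega⟩
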